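/- Let $\Bbbk$ be a field. Let $\mathcal C,\mathcal D$ be $\Bbbk$-linear abelian monoidal categories with $\Bbbk$-bilinear tensor products. Assume that $\mathcal C$ is finite ($\Bbbk$-linearly equivalent to the category of finite-dimensional modules over a finite-dimensional $\Bbbk$-algebra) and rigid (every object has a left and a right dual), and that $\otimes_{\mathcal D}$ is right exact in each variable. Let $F:\mathcal C\to\mathcal D$ be a $\Bbbk$-linear right exact monoidal functor with structure isomorphisms $F^{(2)}_{X,Y}:F(X)\otimes F(Y)\xrightarrow{\sim}F(X\otimes Y)$ and $\mathbf 1\cong F(\mathbf 1)$; neither the categories nor $F$ need be strict. Associativity and unit isomorphisms are suppressed below. *Centralizer.* $\mathcal Z(F)$ has as objects the pairs $\mathsf V=(V,\rho^V)$ of an object $V\in\mathcal D$ and a natural isomorphism $\rho^V_X:V\otimes F(X)\to F(X)\otimes V$ with $\rho^V_{X\otimes Y}\circ(\mathrm{id}_V\otimes F^{(2)}_{X,Y})=(F^{(2)}_{X,Y}\otimes\mathrm{id}_V)\circ(\mathrm{id}_{F(X)}\otimes\rho^V_Y)\circ(\rho^V_X\otimes\mathrm{id}_{F(Y)})$; morphisms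 are the morphisms of $\mathcal D$ that commute with the $\rho$'s. Let $\mathcal U_F:\mathcal Z(F)\to\mathcal D$ be the forgetful functor. *Davydov–Yetter complex.* For $\mathsf V,\mathsf W\in\mathcal Z(F)$ and $n\ge 0$, $C^n_{\mathrm{DY}}(F;\mathsf V,\mathsf W)$ is the space of natural transformations $f_{X_1,\dots,X_n}:V\otimes F(X_1)\otimes\dots\otimes F(X_n)\to F(X_1\otimes\dots\otimes X_n)\otimes W$ (so $V\to F(\mathbf 1)\otimes W$ for $n=0$). The differential is $\delta^n=\sum_{i=0}^{n+1}(-1)^i\partial_i^n$, where $\partial^n_i(f)_{X_1,\dots,X_{n+1}}$ equals - for $i=0$: $(F^{(2)}_{X_1,\,X_2\otimes\dots\otimes X_{n+1}}\otimes\mathrm{id}_W)\circ(\mathrm{id}_{F(X_1)}\otimes f_{X_2,\dots,X_{n+1}})\circ(\rho^V_{X_1}\otimes\mathrm{id})$; - for $1\le i\le n$: $f_{X_1,\dots,X_i\otimes X_{i+1},\dots,X_{n+1}}\circ(\mathrm{id}\otimes F^{(2)}_{X_i,X_{i+1}}\otimes\mathrm{id})$; - for $i=n+1$: $(F^{(2)}_{X_1\otimes\dots\otimes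 X_n,\,X_{n+1}}\otimes\mathrm{id}_W)\circ(\mathrm{id}\otimes\rho^W_{X_{n+1}})\circ(f_{X_1,\dots,X_n}\otimes\mathrm{id}_{F(X_{n+1})})$. Its cohomology is denoted $H^\bullet_{\mathrm{DY}}(F;\mathsf V,\mathsf W)$. *Relative Ext.* A morphism $f$ of $\mathcal Z(F)$ is allowable if $\mathcal U_F(f)\circ s\circ\mathcal U_F(f)=\mathcal U_F(f)$ for some morphism $s$ of $\mathcal D$. An object $P$ of $\mathcal Z(F)$ is relatively projective if every morphism out of $P$ lifts along every allowable epimorphism. A relatively projective resolution of $\mathsf V$ is an exact sequence $0\leftarrow\mathsf V\leftarrow P_0\leftarrow P_1\leftarrow\cdots$ of allowable morphisms with all $P_n$ relatively projective, and $\mathrm{Ext}^n_{\mathcal Z(F),\mathcal D}(\mathsf V,\mathsf W)$ is the $n$-th cohomology of $\mathrm{Hom}_{\mathcal Z(F)}(P_\bullet,\mathsf W)$. If $\mathcal F_F$ is a left adjoint of $\mathcal U_F$, put $G=\mathcal F_F\,\mathcal U_F$ with counit $\varepsilon$; then $\mathrm{Bar}^\bullet(\mathsf V)$ is the complex with terms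 $G^{n+1}(\mathsf V)$ in degree $n\geq 0$ and differential $d_n=\sum_{i=0}^n(-1)^iG^{n-i}(\varepsilon_{G^i(\mathsf V)}):G^{n+1}(\mathsf V)\to G^n(\mathsf V)$ for $n\ge 1$. **Theorem.** The category $\mathcal Z(F)$ is abelian, and $\mathcal U_F$ is additive, exact and faithful and has a left adjoint. For every left adjoint $\mathcal F_F\dashv\mathcal U_F$ and all $\mathsf V,\mathsf W\in\mathcal Z(F)$, there is an isomorphism of cochain complexes of $\Bbbk$-vector spaces $$C^\bullet_{\mathrm{DY}}(F;\mathsf V,\mathsf W)\;\cong\;\mathrm{Hom}_{\mathcal Z(F)}\bigl(\mathrm{Bar}^\bullet(\mathsf V),\mathsf W\bigr),$$ and $\mathrm{Bar}^\bullet(\mathsf V)$ is the underlying complex of a relatively projective resolution of $\mathsf V$. Moreover, for all $n\ge 0$ (and for every relatively projective resolution of $\mathsf V$ used to compute the right-hand side), there is an isomorphism of $\Bbbk$-vector spaces $$H^n_{\mathrm{DY}}(F;\mathsf V,\mathsf W)\;\cong\;\mathrm{Ext}^n_{\mathcal Z(F),\mathcal D}(\mathsf V,\mathsf W).$$ -/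

import Mathlib

open CategoryTheory MonoidalCategory Limits
universe w v v₁ v₂ u u₁ u₂

noncomputable section

namespace DavydovYetter

section Tuples

variable {C : Type u₁} [Category.{v₁} C] [MonoidalCategory C]

/-- The iterated tensor product `X₁ ⊗ (X₂ ⊗ (⋯ ⊗ (Xₙ ⊗ 𝟙)))` of an `n`-tuple of objects. -/
def tensorTuple : ∀ {n : ℕ}, (Fin n → C) → C
  | 0, _ => 𝟙_ C
  | _ + 1, X => X 0 ⊗ tensorTuple (fun i => X i.succ)

/-- The iterated tensor product of an `n`-tuple of morphisms. -/
def tensorTupleMap : ∀ {n : ℕ} {X Y : Fin n → C}, (∀ i, X i ⟶ Y i) →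
    (tensorTuple X ⟶ tensorTuple Y)
  | 0, _, _, _ => 𝟙 _
  | _ + 1, _, _, g => g 0 ⊗ₘ tensorTupleMap (fun i => g i.succ)

lemma tensorTupleMap_id : ∀ {n : ℕ} (X : Fin n → C),
    tensorTupleMap (fun i => 𝟙 (X i)) = 𝟙 (tensorTuple X)
  | 0, _ => rfl
  | _ + 1, X => by
      simp only [tensorTupleMap, tensorTupleMap_id]
      exact id_tensorHom_id _ _

lemma tensorTupleMap_comp : ∀ {n : ℕ} {X Y Z : Fin n → C} (g : ∀ i, X i ⟶ Y i)
    (h : ∀ i, Y i ⟶ Z i),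
    tensorTupleMap (fun i => g i ≫ h i) = tensorTupleMap g ≫ tensorTupleMap h
  | 0, _, _, _, _, _ => (Category.comp_id _).symm
  | _ + 1, _, _, _, g, h => by
      simp only [tensorTupleMap, tensorTupleMap_comp]
      exact (tensorHom_comp_tensorHom _ _ _ _).symm

variable (C) in
/-- The iterated tensor product as a functor `C × ⋯ × C ⥤ C`. -/
def tensorFunctor (n : ℕ) : (Fin n → C) ⥤ C where
  obj X := tensorTuple X
  map g := tensorTupleMap g
  map_id X := tensorTupleMap_id X
  map_comp g h := tensorTupleMap_comp g h

/-- `merge j (X₀, …, Xₙ) = (X₀, …, Xⱼ ⊗ Xⱼ₊₁, …, Xₙ)`. -/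
def merge : ∀ {n : ℕ}, Fin n → (Fin (n + 1) → C) → (Fin n → C)
  | 0, j, _ => j.elim0
  | n + 1, j, X =>
      Fin.cases (motive := fun _ => Fin (n + 1) → C)
        (Fin.cons (X 0 ⊗ X 1) (fun i => X i.succ.succ))
        (fun j' => Fin.cons (X 0) (merge j' (fun i => X i.succ))) j

/-- `merge` on morphisms. -/
def mergeMap : ∀ {n : ℕ} (j : Fin n) {X Y : Fin (n + 1) → C}, (∀ i, X i ⟶ Y i) →
    ∀ i, merge j X i ⟶ merge j Y i
  | 0, j, _, _, _ => j.elim0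
  | n + 1, j, X, Y, g =>
      Fin.cases (motive := fun j => ∀ i, merge j X i ⟶ merge j Y i)
        (Fin.cases (motive := fun i => merge 0 X i ⟶ merge 0 Y i)
          (g 0 ⊗ₘ g 1) (fun i => g i.succ.succ))
        (fun j' => Fin.cases (motive := fun i => merge j'.succ X i ⟶ merge j'.succ Y i)
          (g 0) (mergeMap j' (fun i => g i.succ))) j

variable {D : Type u₂} [Category.{v₂} D] [MonoidalCategory D]

/-- The isomorphism `F X₀ ⊗ ⋯ ⊗ F Xₙ ≅ F X₀ ⊗ ⋯ ⊗ F (Xⱼ ⊗ Xⱼ₊₁) ⊗ ⋯ ⊗ F Xₙ` given by the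
monoidal structure of `F`. -/
def mergeIso (F : C ⥤ D) [F.Monoidal] : ∀ {n : ℕ} (j : Fin n) (X : Fin (n + 1) → C),
    tensorTuple (fun i => F.obj (X i)) ≅ tensorTuple (fun i => F.obj (merge j X i))
  | 0, j, _ => j.elim0
  | n + 1, j, X =>
      Fin.cases (motive := fun j =>
          tensorTuple (fun i => F.obj (X i)) ≅ tensorTuple (fun i => F.obj (merge j X i)))
        ((α_ (F.obj (X 0)) (F.obj (X 1)) (tensorTuple (fun i => F.obj (X i.succ.succ)))).symm ≪≫
          whiskerRightIso (Functor.Monoidal.μIso F (X 0) (X 1)) _)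
        (fun j' => whiskerLeftIso (F.obj (X 0)) (mergeIso F j' (fun i => X i.succ))) j

/-- The isomorphism `X₀ ⊗ ⋯ ⊗ Xₙ ≅ (X₀ ⊗ ⋯ ⊗ Xₙ₋₁) ⊗ Xₙ`. -/
def splitLast : ∀ {n : ℕ} (X : Fin (n + 1) → C),
    tensorTuple X ≅ tensorTuple (fun i => X i.castSucc) ⊗ X (Fin.last n)
  | 0, X => (ρ_ (X 0)) ≪≫ (λ_ (X 0)).symm
  | n + 1, X => whiskerLeftIso (X 0) (splitLast (fun i => X i.succ)) ≪≫
      (α_ (X 0) (tensorTuple (fun i : Fin n => X i.castSucc.succ)) (X (Fin.last (n + 1)))).symm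

lemma mergeIso_naturality (F : C ⥤ D) [F.Monoidal] : ∀ {n : ℕ} (j : Fin n)
    {X Y : Fin (n + 1) → C} (g : ∀ i, X i ⟶ Y i),
    tensorTupleMap (fun i => F.map (g i)) ≫ (mergeIso F j Y).hom =
      (mergeIso F j X).hom ≫ tensorTupleMap (fun i => F.map (mergeMap j g i))
  | 0, j, _, _, _ => j.elim0
  | n + 1, j, X, Y, g => by
      refine Fin.cases ?_ (fun j' => ?_) j
      · change (F.map (g 0) ⊗ₘ (F.map (g 1) ⊗ₘ tensorTupleMap (fun i => F.map (g i.succ.succ)))) ≫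
          (α_ _ _ _).inv ≫ Functor.LaxMonoidal.μ F (Y 0) (Y 1) ▷ _ =
          ((α_ _ _ _).inv ≫ Functor.LaxMonoidal.μ F (X 0) (X 1) ▷ _) ≫
            (F.map (g 0 ⊗ₘ g 1) ⊗ₘ tensorTupleMap (fun i => F.map (g i.succ.succ)))
        rw [associator_inv_naturality_assoc, Category.assoc, ← tensorHom_id, ← tensorHom_id,
          tensorHom_comp_tensorHom, tensorHom_comp_tensorHom, Functor.LaxMonoidal.μ_natural]
        simp
      · change (F.map (g 0) ⊗ₘ tensorTupleMap (fun i => F.map (g i.succ))) ≫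
          F.obj (Y 0) ◁ (mergeIso F j' (fun i => Y i.succ)).hom =
          (F.obj (X 0) ◁ (mergeIso F j' (fun i => X i.succ)).hom) ≫
          (F.map (g 0) ⊗ₘ tensorTupleMap (fun i => F.map (mergeMap j' (fun i => g i.succ) i)))
        rw [← id_tensorHom, ← id_tensorHom, tensorHom_comp_tensorHom, tensorHom_comp_tensorHom,
          mergeIso_naturality F j' (fun i => g i.succ)]
        simp

lemma splitLast_naturality : ∀ {n : ℕ} {X Y : Fin (n + 1) → C} (g : ∀ i, X i ⟶ Y i),
    tensorTupleMap g ≫ (splitLast Y).hom =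
      (splitLast X).hom ≫ (tensorTupleMap (fun i => g i.castSucc) ⊗ₘ g (Fin.last n))
  | 0, X, Y, g => by
      change (g 0 ⊗ₘ 𝟙 (𝟙_ C)) ≫ (ρ_ (Y 0)).hom ≫ (λ_ (Y 0)).inv =
        ((ρ_ (X 0)).hom ≫ (λ_ (X 0)).inv) ≫ (𝟙 (𝟙_ C) ⊗ₘ g 0)
      simp
  | n + 1, X, Y, g => by
      change (g 0 ⊗ₘ tensorTupleMap (fun i => g i.succ)) ≫
        (Y 0 ◁ (splitLast (fun i => Y i.succ)).hom) ≫ (α_ _ _ _).inv =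
        (X 0 ◁ (splitLast (fun i => X i.succ)).hom ≫ (α_ _ _ _).inv) ≫
          ((g 0 ⊗ₘ tensorTupleMap (fun i => g i.castSucc.succ)) ⊗ₘ g (Fin.last (n + 1)))
      rw [Category.assoc, ← associator_inv_naturality, ← id_tensorHom, ← id_tensorHom,
        tensorHom_comp_tensorHom_assoc, tensorHom_comp_tensorHom_assoc,
        splitLast_naturality (fun i => g i.succ)]
      simp only [Category.comp_id, Category.id_comp]
      rfl

lemma tensorTupleMap_map_id (F : C ⥤ D) {n : ℕ} (X : Fin n → C) :
    tensorTupleMap (fun i => F.map (𝟙 (X i))) = 𝟙 (tensorTuple (fun i => F.obj (X i))) := by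
  simp only [F.map_id]
  exact tensorTupleMap_id _

lemma merge_merge_aux₁ (F : C ⥤ D) [F.Monoidal] (X Y Z : C) {T : D} (t : T ⟶ T) (ht : t = 𝟙 T) :
    (F.obj X ◁ ((α_ _ _ T).inv ≫ Functor.LaxMonoidal.μ F Y Z ▷ T)) ≫
      ((α_ _ _ T).inv ≫ Functor.LaxMonoidal.μ F X (Y ⊗ Z) ▷ T) ≫ (F.map (α_ X Y Z).inv ⊗ₘ t) =
    ((α_ _ _ (F.obj Z ⊗ T)).inv ≫ Functor.LaxMonoidal.μ F X Y ▷ (F.obj Z ⊗ T)) ≫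
      ((α_ _ _ T).inv ≫ Functor.LaxMonoidal.μ F (X ⊗ Y) Z ▷ T) := by
  subst ht
  have h := Functor.LaxMonoidal.associativity_inv F X Y Z
  simp only [tensorHom_id, Category.assoc, whiskerLeft_comp, associator_inv_naturality_middle_assoc,
    ← comp_whiskerRight, h]
  simp only [comp_whiskerRight, associator_inv_naturality_left_assoc]
  monoidal

lemma merge_merge_aux₂ (F : C ⥤ D) [F.Monoidal] (X Y : C) {T T' : D} (m : T ⟶ T')
    (t : T' ⟶ T') (ht : t = 𝟙 T') :
    (F.obj X ◁ (F.obj Y ◁ m)) ≫ ((α_ _ _ T').inv ≫ Functor.LaxMonoidal.μ F X Y ▷ T') ≫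
      (F.map (𝟙 (X ⊗ Y)) ⊗ₘ t) =
    ((α_ _ _ T).inv ≫ Functor.LaxMonoidal.μ F X Y ▷ T) ≫ (F.obj (X ⊗ Y) ◁ m) := by
  subst ht
  rw [F.map_id, id_tensorHom, whiskerLeft_id, Category.comp_id, Category.assoc,
    ← MonoidalCategory.whisker_exchange]
  monoidal

lemma merge_merge_aux₃ (F : C ⥤ D) (X : C) {T T₁ T₂ T₃ T₄ : D} (a : T ⟶ T₁) (b : T₁ ⟶ T₂)
    (t : T₂ ⟶ T₃) (c : T ⟶ T₄) (d : T₄ ⟶ T₃) (h : a ≫ b ≫ t = c ≫ d) :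
    (F.obj X ◁ a) ≫ (F.obj X ◁ b) ≫ (F.map (𝟙 X) ⊗ₘ t) =
    (F.obj X ◁ c) ≫ (F.obj X ◁ d) := by
  rw [F.map_id, id_tensorHom, ← whiskerLeft_comp, ← whiskerLeft_comp, ← whiskerLeft_comp, h]

/-- Merging first at `j + 1` and then at `i ≤ j` agrees with merging first at `i` and then at `j`,
up to a morphism of tuples. -/
lemma merge_merge (F : C ⥤ D) [F.Monoidal] : ∀ {n : ℕ} (i j : Fin n), i ≤ j →
    ∀ (X : Fin (n + 2) → C),
    ∃ θ : ∀ k, merge i (merge j.succ X) k ⟶ merge j (merge i.castSucc X) k,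
      (mergeIso F j.succ X).hom ≫ (mergeIso F i _).hom ≫ tensorTupleMap (fun k => F.map (θ k)) =
        (mergeIso F i.castSucc X).hom ≫ (mergeIso F j _).hom ∧
      (mergeIso (𝟭 C) j.succ X).hom ≫ (mergeIso (𝟭 C) i _).hom ≫
          tensorTupleMap (fun k => (𝟭 C).map (θ k)) =
        (mergeIso (𝟭 C) i.castSucc X).hom ≫ (mergeIso (𝟭 C) j _).hom
  | 0, i, _, _, _ => i.elim0
  | n + 1, i, j, hij, X => by
      revert hij
      refine Fin.cases ?_ (fun i' => ?_) i <;> refine Fin.cases ?_ (fun j' => ?_) j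
      · intro _
        exact ⟨Fin.cases (α_ (X 0) (X 1) (X 2)).inv (fun k => 𝟙 (X k.succ.succ.succ)),
          merge_merge_aux₁ F _ _ _ _ (tensorTupleMap_map_id F fun k => X k.succ.succ.succ),
          merge_merge_aux₁ (𝟭 C) _ _ _ _
            (tensorTupleMap_map_id (𝟭 C) fun k => X k.succ.succ.succ)⟩
      · intro _
        exact ⟨Fin.cases (𝟙 (X 0 ⊗ X 1)) (fun k => 𝟙 (merge j' (fun i => X i.succ.succ) k)),
          merge_merge_aux₂ F _ _ _ _
            (tensorTupleMap_map_id F (merge j' fun i => X i.succ.succ)),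
          merge_merge_aux₂ (𝟭 C) _ _ _ _
            (tensorTupleMap_map_id (𝟭 C) (merge j' fun i => X i.succ.succ))⟩
      · intro h
        simp at h
      · intro h
        obtain ⟨θ, h1, h2⟩ := merge_merge F i' j' (by simpa using h) (fun i => X i.succ)
        refine ⟨Fin.cases (𝟙 (X 0)) θ, ?_, ?_⟩
        · exact merge_merge_aux₃ F (X 0) _ _ _ _ _ h1
        · exact merge_merge_aux₃ (𝟭 C) (X 0) _ _ _ _ _ h2

lemma merge_castSucc_aux₁ (F : C ⥤ D) [F.Monoidal] (X Y Z : C) {T T' : D}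
    (s : T ⟶ T' ⊗ F.obj Z) (t : T' ⟶ T') (ht : t = 𝟙 T') :
    ((α_ _ _ T).inv ≫ Functor.LaxMonoidal.μ F X Y ▷ T) ≫
      (F.obj (X ⊗ Y) ◁ s ≫ (α_ _ T' (F.obj Z)).inv) =
    (F.obj X ◁ (F.obj Y ◁ s ≫ (α_ _ T' (F.obj Z)).inv) ≫ (α_ _ _ (F.obj Z)).inv) ≫
      (((α_ _ _ T').inv ≫ Functor.LaxMonoidal.μ F X Y ▷ T') ≫ (F.map (𝟙 (X ⊗ Y)) ⊗ₘ t) ⊗ₘ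
        F.map (𝟙 Z)) := by
  subst ht
  rw [F.map_id, F.map_id, id_tensorHom, tensorHom_id, whiskerLeft_id, Category.comp_id,
    Category.assoc, ← MonoidalCategory.whisker_exchange_assoc]
  monoidal

lemma merge_castSucc_aux₂ (F : C ⥤ D) [F.Monoidal] (X : C) {L L' T T₁ T₂ T₃ T₄ : D} (m : T ⟶ T₁)
    (s : T₁ ⟶ T₂ ⊗ L') (s' : T ⟶ T₃ ⊗ L) (m' : T₃ ⟶ T₄) (t : T₄ ⟶ T₂) (l : L ⟶ L')
    (h : m ≫ s = s' ≫ (m' ≫ t ⊗ₘ l)) :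
    (F.obj X ◁ m) ≫ (F.obj X ◁ s ≫ (α_ _ _ _).inv) =
    (F.obj X ◁ s' ≫ (α_ _ _ _).inv) ≫ ((F.obj X ◁ m') ≫ (F.map (𝟙 X) ⊗ₘ t) ⊗ₘ l) := by
  rw [← whiskerLeft_comp_assoc, h, F.map_id, id_tensorHom, ← whiskerLeft_comp, Category.assoc,
    ← id_tensorHom _ (m' ≫ t), ← associator_inv_naturality]
  simp

lemma merge_castSucc (F : C ⥤ D) [F.Monoidal] : ∀ {n : ℕ} (i : Fin n) (X : Fin (n + 2) → C),
    ∃ (θ : ∀ k, merge i (fun i => X i.castSucc) k ⟶ merge i.castSucc X k.castSucc)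
      (l : X (Fin.last (n + 1)) ⟶ merge i.castSucc X (Fin.last n)),
      (mergeIso F i.castSucc X).hom ≫ (splitLast (fun k => F.obj (merge i.castSucc X k))).hom =
        (splitLast (fun i => F.obj (X i))).hom ≫
          ((mergeIso F i (fun i => X i.castSucc)).hom ≫ tensorTupleMap (fun k => F.map (θ k))
            ⊗ₘ F.map l) ∧
      (mergeIso (𝟭 C) i.castSucc X).hom ≫
          (splitLast (fun k => (𝟭 C).obj (merge i.castSucc X k))).hom =
        (splitLast (fun i => (𝟭 C).obj (X i))).hom ≫
          ((mergeIso (𝟭 C) i (fun i => X i.castSucc)).hom ≫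
            tensorTupleMap (fun k => (𝟭 C).map (θ k)) ⊗ₘ (𝟭 C).map l)
  | 0, i, _ => i.elim0
  | n + 1, i, X => by
      refine Fin.cases ?_ (fun i' => ?_) i
      · refine ⟨Fin.cases (𝟙 (X 0 ⊗ X 1)) (fun k => 𝟙 (X k.castSucc.succ.succ)),
          𝟙 (X (Fin.last (n + 2))), ?_, ?_⟩
        · exact merge_castSucc_aux₁ F _ _ _ _ _
            (tensorTupleMap_map_id F fun k : Fin n => X k.castSucc.succ.succ)
        · exact merge_castSucc_aux₁ (𝟭 C) _ _ _ _ _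
            (tensorTupleMap_map_id (𝟭 C) fun k : Fin n => X k.castSucc.succ.succ)
      · obtain ⟨θ, l, h1, h2⟩ := merge_castSucc F i' (fun i => X i.succ)
        refine ⟨Fin.cases (𝟙 (X 0)) θ, l, ?_, ?_⟩
        · exact merge_castSucc_aux₂ F (X 0) _ _ _ _ _ _ h1
        · exact merge_castSucc_aux₂ (𝟭 C) (X 0) _ _ _ _ _ _ h2

lemma merge_last_aux₁ (F : C ⥤ D) [F.Monoidal] (X Y : C) :
    ((α_ (F.obj X) (F.obj Y) (𝟙_ D)).inv ≫ Functor.LaxMonoidal.μ F X Y ▷ 𝟙_ D) ≫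
      (ρ_ (F.obj (X ⊗ Y))).hom ≫ (λ_ (F.obj (X ⊗ Y))).inv =
    (F.obj X ◁ ((ρ_ (F.obj Y)).hom ≫ (λ_ (F.obj Y)).inv) ≫ (α_ _ (𝟙_ D) _).inv) ≫
      ((ρ_ (F.obj X)).hom ≫ (λ_ (F.obj X)).inv) ▷ F.obj Y ≫ (α_ (𝟙_ D) _ _).hom ≫
        (𝟙 (𝟙_ D) ⊗ₘ (Functor.LaxMonoidal.μ F X Y ≫ F.map (𝟙 (X ⊗ Y)))) := by
  rw [F.map_id, Category.comp_id, id_tensorHom, Category.assoc, rightUnitor_naturality_assoc]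
  monoidal

lemma merge_last_aux₂ (F : C ⥤ D) [F.Monoidal] (X : C) {L L' K T T₁ T₂ T₃ T₄ : D} (m : T ⟶ T₁)
    (s : T₁ ⟶ T₂ ⊗ L') (s' : T ⟶ T₃ ⊗ L) (s'' : T₃ ⟶ T₄ ⊗ K) (t : T₄ ⟶ T₂) (l : K ⊗ L ⟶ L')
    (h : m ≫ s = s' ≫ s'' ▷ L ≫ (α_ _ _ _).hom ≫ (t ⊗ₘ l)) :
    (F.obj X ◁ m) ≫ (F.obj X ◁ s ≫ (α_ _ _ _).inv) =
    (F.obj X ◁ s' ≫ (α_ _ _ _).inv) ≫ (F.obj X ◁ s'' ≫ (α_ _ _ _).inv) ▷ L ≫ (α_ _ _ _).hom ≫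
      ((F.map (𝟙 X) ⊗ₘ t) ⊗ₘ l) := by
  rw [← whiskerLeft_comp_assoc, h, F.map_id]
  simp only [whiskerLeft_comp, Category.assoc, ← id_tensorHom (F.obj X) (t ⊗ₘ l)]
  rw [associator_inv_naturality]
  monoidal

lemma merge_last (F : C ⥤ D) [F.Monoidal] : ∀ {n : ℕ} (X : Fin (n + 2) → C),
    ∃ (θ : ∀ k : Fin n, X k.castSucc.castSucc ⟶ merge (Fin.last n) X k.castSucc)
      (l : X (Fin.last n).castSucc ⊗ X (Fin.last (n + 1)) ⟶ merge (Fin.last n) X (Fin.last n)),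
      (mergeIso F (Fin.last n) X).hom ≫
          (splitLast (fun k => F.obj (merge (Fin.last n) X k))).hom =
        (splitLast (fun i => F.obj (X i))).hom ≫
          (splitLast (fun i : Fin (n + 1) => F.obj (X i.castSucc))).hom ▷ _ ≫ (α_ _ _ _).hom ≫
          (tensorTupleMap (fun k => F.map (θ k)) ⊗ₘ (Functor.LaxMonoidal.μ F _ _ ≫ F.map l)) ∧
      (mergeIso (𝟭 C) (Fin.last n) X).hom ≫
          (splitLast (fun k => (𝟭 C).obj (merge (Fin.last n) X k))).hom =
        (splitLast (fun i => (𝟭 C).obj (X i))).hom ≫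
          (splitLast (fun i : Fin (n + 1) => (𝟭 C).obj (X i.castSucc))).hom ▷ _ ≫
          (α_ _ _ _).hom ≫ (tensorTupleMap (fun k => (𝟭 C).map (θ k)) ⊗ₘ
            (Functor.LaxMonoidal.μ (𝟭 C) _ _ ≫ (𝟭 C).map l))
  | 0, X => ⟨fun k => k.elim0, 𝟙 (X 0 ⊗ X 1), merge_last_aux₁ F _ _, merge_last_aux₁ (𝟭 C) _ _⟩
  | n + 1, X => by
      obtain ⟨θ, l, h1, h2⟩ := merge_last F (fun i => X i.succ)
      refine ⟨Fin.cases (𝟙 (X 0)) θ, l, ?_, ?_⟩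
      · exact merge_last_aux₂ F (X 0) _ _ _ _ _ _ h1
      · exact merge_last_aux₂ (𝟭 C) (X 0) _ _ _ _ _ _ h2

end Tuples

open Functor.LaxMonoidal

section Centralizer

variable {C : Type u₁} [Category.{v₁} C] [MonoidalCategory C]
  {D : Type u₂} [Category.{v₂} D] [MonoidalCategory D]

/-- The objects of the centralizer `𝒵(F)` of a monoidal functor `F : C ⥤ D`: objects `V` of `D` with
a half-braiding `V ⊗ F(-) ≅ F(-) ⊗ V` relative to `F`. -/
structure Centralizer (F : C ⥤ D) [F.Monoidal] where
  /-- The underlying object. -/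
  obj : D
  /-- The half-braiding. -/
  β : ∀ X : C, obj ⊗ F.obj X ≅ F.obj X ⊗ obj
  naturality : ∀ {X Y : C} (g : X ⟶ Y), obj ◁ F.map g ≫ (β Y).hom = (β X).hom ≫ F.map g ▷ obj
  monoidal : ∀ X Y : C, obj ◁ μ F X Y ≫ (β (X ⊗ Y)).hom =
    (α_ obj (F.obj X) (F.obj Y)).inv ≫ (β X).hom ▷ F.obj Y ≫ (α_ (F.obj X) obj (F.obj Y)).hom ≫
      F.obj X ◁ (β Y).hom ≫ (α_ (F.obj X) (F.obj Y) obj).inv ≫ μ F X Y ▷ obj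

namespace Centralizer

variable {F : C ⥤ D} [F.Monoidal]

/-- A morphism of the centralizer is a morphism of `D` that commutes with the half-braidings. -/
@[ext]
structure Hom (V W : Centralizer F) where
  /-- The underlying morphism. -/
  hom : V.obj ⟶ W.obj
  comm : ∀ X : C, hom ▷ F.obj X ≫ (W.β X).hom = (V.β X).hom ≫ F.obj X ◁ hom

instance : Category (Centralizer F) where
  Hom V W := Hom V W
  id V := ⟨𝟙 V.obj, fun X => by simp⟩
  comp f g := ⟨f.hom ≫ g.hom, fun X => by
    rw [comp_whiskerRight, Category.assoc, g.comm, ← Category.assoc, f.comm, Category.assoc,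
      whiskerLeft_comp]⟩

@[ext]
lemma hom_ext {V W : Centralizer F} {f g : V ⟶ W} (h : f.hom = g.hom) : f = g := Hom.ext h

@[simp] lemma id_hom (V : Centralizer F) : (𝟙 V : V ⟶ V).hom = 𝟙 V.obj := rfl

@[simp] lemma comp_hom {U V W : Centralizer F} (f : U ⟶ V) (g : V ⟶ W) :
    (f ≫ g).hom = f.hom ≫ g.hom := rfl

variable (F) in
/-- The forgetful functor `𝒰_F : 𝒵(F) ⥤ D`. -/
def forget : Centralizer F ⥤ D where
  obj V := V.obj
  map f := f.hom

section Linear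

variable [Preadditive D] [MonoidalPreadditive D]

instance (V W : Centralizer F) : Zero (V ⟶ W) := ⟨⟨(0 : V.obj ⟶ W.obj), fun X => by
    rw [MonoidalPreadditive.zero_whiskerRight, MonoidalPreadditive.whiskerLeft_zero,
      zero_comp, comp_zero]⟩⟩
instance (V W : Centralizer F) : Add (V ⟶ W) :=
  ⟨fun f g => ⟨f.hom + g.hom, fun X => by
    rw [MonoidalPreadditive.add_whiskerRight, MonoidalPreadditive.whiskerLeft_add,
      Preadditive.add_comp, Preadditive.comp_add, f.comm, g.comm]⟩⟩
instance (V W : Centralizer F) : Neg (V ⟶ W) :=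
  ⟨fun f => ⟨-f.hom, fun X => by
    have h1 : (-f.hom) ▷ F.obj X = -(f.hom ▷ F.obj X) := (tensorRight (F.obj X)).map_neg
    have h2 : F.obj X ◁ (-f.hom) = -(F.obj X ◁ f.hom) := (tensorLeft (F.obj X)).map_neg
    rw [h1, h2, Preadditive.neg_comp, Preadditive.comp_neg, f.comm]⟩⟩
instance (V W : Centralizer F) : Sub (V ⟶ W) :=
  ⟨fun f g => ⟨f.hom - g.hom, fun X => by
    have h1 : (f.hom - g.hom) ▷ F.obj X = f.hom ▷ F.obj X - g.hom ▷ F.obj X :=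
      (tensorRight (F.obj X)).map_sub
    have h2 : F.obj X ◁ (f.hom - g.hom) = F.obj X ◁ f.hom - F.obj X ◁ g.hom :=
      (tensorLeft (F.obj X)).map_sub
    rw [h1, h2, Preadditive.sub_comp, Preadditive.comp_sub, f.comm, g.comm]⟩⟩
instance natSMulHom (V W : Centralizer F) : SMul ℕ (V ⟶ W) :=
  ⟨fun n f => ⟨n • f.hom, fun X => by
    have h1 : (n • f.hom) ▷ F.obj X = n • (f.hom ▷ F.obj X) :=
      ((tensorRight (F.obj X)).map_nsmul)
    have h2 : F.obj X ◁ (n • f.hom) = n • (F.obj X ◁ f.hom) :=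
      ((tensorLeft (F.obj X)).map_nsmul)
    rw [h1, h2, Preadditive.nsmul_comp, Preadditive.comp_nsmul, f.comm]⟩⟩
instance intSMulHom (V W : Centralizer F) : SMul ℤ (V ⟶ W) :=
  ⟨fun n f => ⟨n • f.hom, fun X => by
    have h1 : (n • f.hom) ▷ F.obj X = n • (f.hom ▷ F.obj X) :=
      ((tensorRight (F.obj X)).map_zsmul)
    have h2 : F.obj X ◁ (n • f.hom) = n • (F.obj X ◁ f.hom) :=
      ((tensorLeft (F.obj X)).map_zsmul)
    rw [h1, h2, Preadditive.zsmul_comp, Preadditive.comp_zsmul, f.comm]⟩⟩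

instance (V W : Centralizer F) : AddCommGroup (V ⟶ W) :=
  Function.Injective.addCommGroup (fun f : V ⟶ W => f.hom) (fun _ _ h => Hom.ext h) rfl
    (fun _ _ => rfl) (fun _ => rfl) (fun _ _ => rfl) (fun _ _ => rfl) (fun _ _ => rfl)

instance : Preadditive (Centralizer F) where
  add_comp _ _ _ f f' g := Hom.ext (Preadditive.add_comp _ _ _ f.hom f'.hom g.hom)
  comp_add _ _ _ f g g' := Hom.ext (Preadditive.comp_add _ _ _ f.hom g.hom g'.hom)

instance : (forget F).Additive where
  map_add := rfl

variable (k : Type w) [Semiring k] [Linear k D] [MonoidalLinear k D]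

instance smulHom (V W : Centralizer F) : SMul k (V ⟶ W) :=
  ⟨fun r f => ⟨r • f.hom, fun X => by simp [f.comm]⟩⟩

/-- The underlying morphism, as an additive map. -/
def homAddHom (V W : Centralizer F) : (V ⟶ W) →+ (V.obj ⟶ W.obj) where
  toFun f := f.hom
  map_zero' := rfl
  map_add' _ _ := rfl

instance moduleHom (V W : Centralizer F) : Module k (V ⟶ W) :=
  Function.Injective.module k (homAddHom V W) (fun _ _ h => Hom.ext h) (fun _ _ => rfl)

instance : Linear k (Centralizer F) where
  homModule V W := moduleHom k V W
  smul_comp _ _ _ r f g := Hom.ext (Linear.smul_comp _ _ _ r f.hom g.hom)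
  comp_smul _ _ _ f r g := Hom.ext (Linear.comp_smul _ _ _ f.hom r g.hom)

end Linear

end Centralizer

end Centralizer

section Cochains

variable {C : Type u₁} [Category.{v₁} C] [MonoidalCategory C]
  {D : Type u₂} [Category.{v₂} D] [MonoidalCategory D] {F : C ⥤ D} [F.Monoidal]
  (V W : Centralizer F)

/-- Davydov--Yetter `n`-cochains: natural transformations
`V ⊗ F X₁ ⊗ ⋯ ⊗ F Xₙ ⟶ F (X₁ ⊗ ⋯ ⊗ Xₙ) ⊗ W` of functors `C × ⋯ × C ⥤ D`. -/
abbrev Cochain (n : ℕ) : Type (max u₁ v₂) :=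
  (Functor.pi (fun _ : Fin n => F) ⋙ tensorFunctor D n ⋙ tensorLeft V.obj) ⟶
    (tensorFunctor C n ⋙ F ⋙ tensorRight W.obj)

variable {V W}

/-- The component of a cochain at a tuple of objects. -/
def Cochain.comp {n : ℕ} (f : Cochain V W n) (X : Fin n → C) :
    V.obj ⊗ tensorTuple (fun i => F.obj (X i)) ⟶ F.obj (tensorTuple X) ⊗ W.obj :=
  f.app X

lemma Cochain.comp_naturality {n : ℕ} (f : Cochain V W n) {X Y : Fin n → C} (g : ∀ i, X i ⟶ Y i) :
    V.obj ◁ tensorTupleMap (fun i => F.map (g i)) ≫ f.comp Y =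
      f.comp X ≫ F.map (tensorTupleMap g) ▷ W.obj :=
  f.naturality g

/-- `V ⊗ F X ⊗ S ⟶ F X ⊗ V ⊗ S ⟶ F X ⊗ F P ⊗ W ⟶ F (X ⊗ P) ⊗ W`, using the half-braiding of `V`. -/
def actLeft (X : C) {S : D} {P : C} (f : V.obj ⊗ S ⟶ F.obj P ⊗ W.obj) :
    V.obj ⊗ (F.obj X ⊗ S) ⟶ F.obj (X ⊗ P) ⊗ W.obj :=
  (α_ V.obj (F.obj X) S).inv ≫ (V.β X).hom ▷ S ≫ (α_ (F.obj X) V.obj S).hom ≫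
    F.obj X ◁ f ≫ (α_ (F.obj X) (F.obj P) W.obj).inv ≫ μ F X P ▷ W.obj

/-- `V ⊗ S ⊗ F Y ⟶ F P ⊗ W ⊗ F Y ⟶ F P ⊗ F Y ⊗ W ⟶ F (P ⊗ Y) ⊗ W`, using the half-braiding of `W`. -/
def actRight {S : D} {P : C} (f : V.obj ⊗ S ⟶ F.obj P ⊗ W.obj) (Y : C) :
    V.obj ⊗ (S ⊗ F.obj Y) ⟶ F.obj (P ⊗ Y) ⊗ W.obj :=
  (α_ V.obj S (F.obj Y)).inv ≫ f ▷ F.obj Y ≫ (α_ (F.obj P) W.obj (F.obj Y)).hom ≫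
    F.obj P ◁ (W.β Y).hom ≫ (α_ (F.obj P) (F.obj Y) W.obj).inv ≫ μ F P Y ▷ W.obj

lemma actLeft_naturality {X X' : C} (g : X ⟶ X') {S S' : D} (x : S ⟶ S') {P P' : C} (p : P ⟶ P')
    (f : V.obj ⊗ S ⟶ F.obj P ⊗ W.obj) (f' : V.obj ⊗ S' ⟶ F.obj P' ⊗ W.obj)
    (h : V.obj ◁ x ≫ f' = f ≫ F.map p ▷ W.obj) :
    V.obj ◁ (F.map g ⊗ₘ x) ≫ actLeft X' f' = actLeft X f ≫ F.map (g ⊗ₘ p) ▷ W.obj := by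
  unfold actLeft
  calc _ = 𝟙 _ ⊗≫ V.obj ◁ F.obj X ◁ x ⊗≫ (V.obj ◁ F.map g ≫ (V.β X').hom) ▷ S' ⊗≫
        F.obj X' ◁ f' ⊗≫ μ F X' P' ▷ W.obj := by
          rw [MonoidalCategory.tensorHom_def']; monoidal
    _ = 𝟙 _ ⊗≫ ((V.obj ⊗ F.obj X) ◁ x ≫ (V.β X).hom ▷ S') ⊗≫
        (F.map g ▷ (V.obj ⊗ S') ≫ F.obj X' ◁ f') ⊗≫ μ F X' P' ▷ W.obj := by
          rw [V.naturality]; monoidal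
    _ = 𝟙 _ ⊗≫ (V.β X).hom ▷ S ⊗≫ F.obj X ◁ (V.obj ◁ x ≫ f') ⊗≫
        (F.map g ▷ F.obj P' ≫ μ F X' P') ▷ W.obj := by
          rw [← MonoidalCategory.whisker_exchange (F.map g) f',
            MonoidalCategory.whisker_exchange (V.β X).hom x]; monoidal
    _ = 𝟙 _ ⊗≫ (V.β X).hom ▷ S ⊗≫ F.obj X ◁ f ⊗≫
        (F.obj X ◁ F.map p ≫ μ F X P') ▷ W.obj ≫ F.map (g ▷ P') ▷ W.obj := by
          rw [h, μ_natural_left]; monoidal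
    _ = _ := by
          rw [μ_natural_right, MonoidalCategory.tensorHom_def', F.map_comp]; monoidal

lemma actRight_naturality {S S' : D} (x : S ⟶ S') {P P' : C} (p : P ⟶ P')
    (f : V.obj ⊗ S ⟶ F.obj P ⊗ W.obj) (f' : V.obj ⊗ S' ⟶ F.obj P' ⊗ W.obj)
    (h : V.obj ◁ x ≫ f' = f ≫ F.map p ▷ W.obj) {Y Y' : C} (g : Y ⟶ Y') :
    V.obj ◁ (x ⊗ₘ F.map g) ≫ actRight f' Y' = actRight f Y ≫ F.map (p ⊗ₘ g) ▷ W.obj := by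
  unfold actRight
  calc _ = 𝟙 _ ⊗≫ (V.obj ⊗ S) ◁ F.map g ⊗≫ (V.obj ◁ x ≫ f') ▷ F.obj Y' ⊗≫
        F.obj P' ◁ (W.β Y').hom ⊗≫ μ F P' Y' ▷ W.obj := by
          rw [MonoidalCategory.tensorHom_def']; monoidal
    _ = 𝟙 _ ⊗≫ ((V.obj ⊗ S) ◁ F.map g ≫ f ▷ F.obj Y') ⊗≫
        (F.map p ▷ (W.obj ⊗ F.obj Y') ≫ F.obj P' ◁ (W.β Y').hom) ⊗≫ μ F P' Y' ▷ W.obj := by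
          rw [h]; monoidal
    _ = 𝟙 _ ⊗≫ f ▷ F.obj Y ⊗≫ F.obj P ◁ (W.obj ◁ F.map g ≫ (W.β Y').hom) ⊗≫
        (F.map p ▷ F.obj Y' ≫ μ F P' Y') ▷ W.obj := by
          rw [← MonoidalCategory.whisker_exchange (F.map p) (W.β Y').hom,
            MonoidalCategory.whisker_exchange f (F.map g)]; monoidal
    _ = 𝟙 _ ⊗≫ f ▷ F.obj Y ⊗≫ F.obj P ◁ (W.β Y).hom ⊗≫
        (F.obj P ◁ F.map g ≫ μ F P Y') ▷ W.obj ≫ F.map (p ▷ Y') ▷ W.obj := by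
          rw [W.naturality, μ_natural_left]; monoidal
    _ = _ := by
          rw [μ_natural_right, MonoidalCategory.tensorHom_def', F.map_comp]; monoidal

lemma actLeft_actLeft (X Y : C) {S : D} {P : C} (f : V.obj ⊗ S ⟶ F.obj P ⊗ W.obj) :
    V.obj ◁ ((α_ _ _ _).inv ≫ μ F X Y ▷ S) ≫ actLeft (X ⊗ Y) f ≫ F.map (α_ X Y P).hom ▷ W.obj =
      actLeft X (actLeft Y f) := by
  unfold actLeft
  calc _ = 𝟙 _ ⊗≫ (V.obj ◁ μ F X Y ≫ (V.β (X ⊗ Y)).hom) ▷ S ⊗≫ F.obj (X ⊗ Y) ◁ f ⊗≫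
        μ F (X ⊗ Y) P ▷ W.obj ≫ F.map (α_ X Y P).hom ▷ W.obj := by monoidal
    _ = 𝟙 _ ⊗≫ (V.β X).hom ▷ F.obj Y ▷ S ⊗≫ F.obj X ◁ (V.β Y).hom ▷ S ⊗≫
        (μ F X Y ▷ (V.obj ⊗ S) ≫ F.obj (X ⊗ Y) ◁ f) ⊗≫
        μ F (X ⊗ Y) P ▷ W.obj ≫ F.map (α_ X Y P).hom ▷ W.obj := by
          rw [V.monoidal]; monoidal
    _ = 𝟙 _ ⊗≫ (V.β X).hom ▷ F.obj Y ▷ S ⊗≫ F.obj X ◁ (V.β Y).hom ▷ S ⊗≫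
        F.obj X ◁ F.obj Y ◁ f ⊗≫
        (μ F X Y ▷ F.obj P ≫ μ F (X ⊗ Y) P ≫ F.map (α_ X Y P).hom) ▷ W.obj := by
          rw [← MonoidalCategory.whisker_exchange]; monoidal
    _ = _ := by rw [associativity]; monoidal

lemma actLeft_actRight (X Y : C) {S : D} {P : C} (f : V.obj ⊗ S ⟶ F.obj P ⊗ W.obj) :
    V.obj ◁ (α_ (F.obj X) S (F.obj Y)).inv ≫ actRight (actLeft X f) Y ≫
      F.map (α_ X P Y).hom ▷ W.obj = actLeft X (actRight f Y) := by
  unfold actLeft actRight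
  calc _ = 𝟙 _ ⊗≫ (V.β X).hom ▷ S ▷ F.obj Y ⊗≫ F.obj X ◁ f ▷ F.obj Y ⊗≫
        (μ F X P ▷ (W.obj ⊗ F.obj Y) ≫ F.obj (X ⊗ P) ◁ (W.β Y).hom) ⊗≫
        μ F (X ⊗ P) Y ▷ W.obj ≫ F.map (α_ X P Y).hom ▷ W.obj := by monoidal
    _ = 𝟙 _ ⊗≫ (V.β X).hom ▷ S ▷ F.obj Y ⊗≫ F.obj X ◁ f ▷ F.obj Y ⊗≫
        F.obj X ◁ F.obj P ◁ (W.β Y).hom ⊗≫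
        (μ F X P ▷ F.obj Y ≫ μ F (X ⊗ P) Y ≫ F.map (α_ X P Y).hom) ▷ W.obj := by
          rw [← MonoidalCategory.whisker_exchange]; monoidal
    _ = _ := by rw [associativity]; monoidal

lemma actRight_actRight (X Y : C) {S : D} {P : C} (f : V.obj ⊗ S ⟶ F.obj P ⊗ W.obj) :
    V.obj ◁ ((α_ _ _ _).hom ≫ S ◁ μ F X Y) ≫ actRight f (X ⊗ Y) =
      actRight (actRight f X) Y ≫ F.map (α_ P X Y).hom ▷ W.obj := by
  unfold actRight
  symm
  calc _ = 𝟙 _ ⊗≫ f ▷ F.obj X ▷ F.obj Y ⊗≫ F.obj P ◁ (W.β X).hom ▷ F.obj Y ⊗≫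
        (μ F P X ▷ (W.obj ⊗ F.obj Y) ≫ F.obj (P ⊗ X) ◁ (W.β Y).hom) ⊗≫
        μ F (P ⊗ X) Y ▷ W.obj ≫ F.map (α_ P X Y).hom ▷ W.obj := by monoidal
    _ = 𝟙 _ ⊗≫ f ▷ F.obj X ▷ F.obj Y ⊗≫ F.obj P ◁ (W.β X).hom ▷ F.obj Y ⊗≫
        F.obj P ◁ F.obj X ◁ (W.β Y).hom ⊗≫
        (μ F P X ▷ F.obj Y ≫ μ F (P ⊗ X) Y ≫ F.map (α_ P X Y).hom) ▷ W.obj := by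
          rw [← MonoidalCategory.whisker_exchange]; monoidal
    _ = 𝟙 _ ⊗≫ f ▷ (F.obj X ⊗ F.obj Y) ⊗≫ F.obj P ◁ ((α_ _ _ _).inv ≫ (W.β X).hom ▷ F.obj Y ≫
          (α_ _ _ _).hom ≫ F.obj X ◁ (W.β Y).hom ≫ (α_ _ _ _).inv ≫ μ F X Y ▷ W.obj) ⊗≫
        μ F P (X ⊗ Y) ▷ W.obj := by
          rw [associativity]; monoidal
    _ = 𝟙 _ ⊗≫ (f ▷ (F.obj X ⊗ F.obj Y) ≫ (F.obj P ⊗ W.obj) ◁ μ F X Y) ⊗≫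
          F.obj P ◁ (W.β (X ⊗ Y)).hom ⊗≫ μ F P (X ⊗ Y) ▷ W.obj := by
          rw [← W.monoidal]; monoidal
    _ = _ := by rw [← MonoidalCategory.whisker_exchange]; monoidal

@[ext]
lemma Cochain.ext_comp {n : ℕ} {f g : Cochain V W n} (h : ∀ X, f.comp X = g.comp X) : f = g :=
  NatTrans.ext (funext h)

/-- The zeroth coface: `∂₀ f` at `(X₀, …, Xₙ)` is
`V ⊗ F X₀ ⊗ F X₁ ⊗ ⋯ ⊗ F Xₙ ⟶ F X₀ ⊗ V ⊗ F X₁ ⊗ ⋯ ⊗ F Xₙ ⟶ F X₀ ⊗ F (X₁ ⊗ ⋯ ⊗ Xₙ) ⊗ W ⟶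
F (X₀ ⊗ ⋯ ⊗ Xₙ) ⊗ W`. -/
def cofaceZero {n : ℕ} (f : Cochain V W n) : Cochain V W (n + 1) where
  app X := actLeft (X 0) (f.comp (fun i => X i.succ))
  naturality _ _ g := actLeft_naturality (g 0) (tensorTupleMap fun i => F.map (g i.succ))
    (tensorTupleMap fun i => g i.succ) _ _ (f.comp_naturality fun i => g i.succ)

/-- The inner cofaces: `∂ⱼ₊₁ f` at `(X₀, …, Xₙ)` is given by `f` at `(X₀, …, Xⱼ ⊗ Xⱼ₊₁, …, Xₙ)`,
precomposed with the monoidal structure `F Xⱼ ⊗ F Xⱼ₊₁ ⟶ F (Xⱼ ⊗ Xⱼ₊₁)`. -/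
def cofaceMid {n : ℕ} (j : Fin n) (f : Cochain V W n) : Cochain V W (n + 1) where
  app X := V.obj ◁ (mergeIso F j X).hom ≫ f.comp (merge j X) ≫
    F.map (mergeIso (𝟭 C) j X).inv ▷ W.obj
  naturality X Y g := by
    change V.obj ◁ tensorTupleMap (fun i => F.map (g i)) ≫ V.obj ◁ (mergeIso F j Y).hom ≫
      f.comp (merge j Y) ≫ F.map (mergeIso (𝟭 C) j Y).inv ▷ W.obj =
      (V.obj ◁ (mergeIso F j X).hom ≫ f.comp (merge j X) ≫
        F.map (mergeIso (𝟭 C) j X).inv ▷ W.obj) ≫ F.map (tensorTupleMap g) ▷ W.obj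
    have h : tensorTupleMap (mergeMap j g) ≫ (mergeIso (𝟭 C) j Y).inv =
        (mergeIso (𝟭 C) j X).inv ≫ tensorTupleMap g := by
      rw [Iso.comp_inv_eq, Category.assoc, Iso.eq_inv_comp]
      exact (mergeIso_naturality (𝟭 C) j g).symm
    rw [← whiskerLeft_comp_assoc, mergeIso_naturality, whiskerLeft_comp_assoc,
      ← Category.assoc (_ ◁ tensorTupleMap _), f.comp_naturality (mergeMap j g)]
    simp only [Category.assoc, ← comp_whiskerRight, ← F.map_comp]
    rw [← h]

/-- The last coface: `∂ₙ₊₁ f` at `(X₀, …, Xₙ)` is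
`V ⊗ F X₀ ⊗ ⋯ ⊗ F Xₙ ⟶ F (X₀ ⊗ ⋯ ⊗ Xₙ₋₁) ⊗ W ⊗ F Xₙ ⟶ F (X₀ ⊗ ⋯ ⊗ Xₙ₋₁) ⊗ F Xₙ ⊗ W ⟶
F (X₀ ⊗ ⋯ ⊗ Xₙ) ⊗ W`. -/
def cofaceLast {n : ℕ} (f : Cochain V W n) : Cochain V W (n + 1) where
  app X := V.obj ◁ (splitLast (fun i => F.obj (X i))).hom ≫
    actRight (f.comp (fun i => X i.castSucc)) (X (Fin.last n)) ≫ F.map (splitLast X).inv ▷ W.obj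
  naturality X Y g := by
    change V.obj ◁ tensorTupleMap (fun i => F.map (g i)) ≫
      V.obj ◁ (splitLast (fun i => F.obj (Y i))).hom ≫
      actRight (f.comp (fun i => Y i.castSucc)) (Y (Fin.last n)) ≫
        F.map (splitLast Y).inv ▷ W.obj =
      (V.obj ◁ (splitLast (fun i => F.obj (X i))).hom ≫
      actRight (f.comp (fun i => X i.castSucc)) (X (Fin.last n)) ≫
        F.map (splitLast X).inv ▷ W.obj) ≫ F.map (tensorTupleMap g) ▷ W.obj
    have h : (tensorTupleMap (fun i => g i.castSucc) ⊗ₘ g (Fin.last n)) ≫ (splitLast Y).inv =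
        (splitLast X).inv ≫ tensorTupleMap g := by
      rw [Iso.comp_inv_eq, Category.assoc, Iso.eq_inv_comp]
      exact (splitLast_naturality g).symm
    rw [← whiskerLeft_comp_assoc, splitLast_naturality, whiskerLeft_comp_assoc,
      ← Category.assoc (_ ◁ (tensorTupleMap _ ⊗ₘ _)),
      actRight_naturality _ _ _ _ (f.comp_naturality fun i => g i.castSucc)]
    simp only [Category.assoc, ← comp_whiskerRight, ← F.map_comp]
    rw [← h]

/-- The coface maps `∂ᵢ`, `0 ≤ i ≤ n + 1`, on `n`-cochains. -/
def coface {n : ℕ} (i : Fin (n + 2)) (f : Cochain V W n) : Cochain V W (n + 1) :=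
  Fin.cases (motive := fun _ => Cochain V W (n + 1)) (cofaceZero f)
    (fun i' : Fin (n + 1) => Fin.lastCases (motive := fun _ => Cochain V W (n + 1))
      (cofaceLast f) (fun j => cofaceMid j f) i') i

lemma cofaceMid_comp {n : ℕ} (j : Fin n) (f : Cochain V W n) (X : Fin (n + 1) → C) :
    (cofaceMid j f).comp X = V.obj ◁ (mergeIso F j X).hom ≫ f.comp (merge j X) ≫
      F.map (mergeIso (𝟭 C) j X).inv ▷ W.obj := rfl

lemma cofaceLast_comp {n : ℕ} (f : Cochain V W n) (X : Fin (n + 1) → C) :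
    (cofaceLast f).comp X = V.obj ◁ (splitLast (fun i => F.obj (X i))).hom ≫
      actRight (f.comp (fun i => X i.castSucc)) (X (Fin.last n)) ≫
        F.map (splitLast X).inv ▷ W.obj := rfl

lemma coface_zero_zero {n : ℕ} (f : Cochain V W n) :
    cofaceMid 0 (cofaceZero f) = cofaceZero (cofaceZero f) := by
  ext X
  refine Eq.trans ?_ (actLeft_actLeft (X 0) (X 1) (f.comp fun i => X i.succ.succ))
  have : (mergeIso (𝟭 C) 0 X).inv =
      (α_ (X 0) (X 1) (tensorTuple fun i => X i.succ.succ)).hom := by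
    change (Functor.Monoidal.μIso (𝟭 C) (X 0) (X 1)).inv ▷ _ ≫ (α_ _ _ _).hom = _
    simp
  rw [cofaceMid_comp, this]
  rfl

lemma coface_zero_mid {n : ℕ} (j : Fin n) (f : Cochain V W n) :
    cofaceMid j.succ (cofaceZero f) = cofaceZero (cofaceMid j f) := by
  ext X
  have h := actLeft_naturality (V := V) (W := W) (𝟙 (X 0)) (mergeIso F j fun i => X i.succ).hom
    (mergeIso (𝟭 C) j fun i => X i.succ).hom
    ((cofaceMid j f).comp fun i => X i.succ) (f.comp (merge j fun i => X i.succ)) (by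
      rw [cofaceMid_comp]
      simp only [Category.assoc, ← comp_whiskerRight, ← F.map_comp, Iso.inv_hom_id]
      simp)
  rw [F.map_id, id_tensorHom, id_tensorHom] at h
  change V.obj ◁ (F.obj (X 0) ◁ (mergeIso F j fun i => X i.succ).hom) ≫
    actLeft (X 0) (f.comp (merge j fun i => X i.succ)) ≫
      F.map (X 0 ◁ (mergeIso (𝟭 C) j fun i => X i.succ).inv) ▷ W.obj = _
  rw [← Category.assoc, h, Category.assoc, ← comp_whiskerRight, ← F.map_comp,
    ← whiskerLeft_comp, Iso.hom_inv_id]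
  simp
  rfl

lemma coface_zero_last {n : ℕ} (f : Cochain V W n) :
    cofaceLast (cofaceZero f) = cofaceZero (cofaceLast f) := by
  ext X
  have h := actLeft_naturality (V := V) (W := W) (𝟙 (X 0))
    (splitLast fun i => F.obj (X i.succ)).hom (splitLast fun i => X i.succ).hom
    ((cofaceLast f).comp fun i => X i.succ)
    (actRight (f.comp fun i => X i.castSucc.succ) (X (Fin.last (n + 1)))) (by
      rw [cofaceLast_comp]
      simp only [Category.assoc, ← comp_whiskerRight, ← F.map_comp, Iso.inv_hom_id]
      simp)
  rw [F.map_id, id_tensorHom, id_tensorHom] at h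
  change V.obj ◁ (F.obj (X 0) ◁ (splitLast fun i => F.obj (X i.succ)).hom ≫ (α_ _ _ _).inv) ≫
    actRight (actLeft (X 0) (f.comp fun i => X i.castSucc.succ)) (X (Fin.last (n + 1))) ≫
      F.map ((α_ _ _ _).hom ≫ X 0 ◁ (splitLast fun i => X i.succ).inv) ▷ W.obj =
    actLeft (X 0) ((cofaceLast f).comp fun i => X i.succ)
  rw [F.map_comp, comp_whiskerRight, whiskerLeft_comp_assoc]
  have h2 := actLeft_actRight (V := V) (W := W) (X 0) (X (Fin.last (n + 1)))
    (f.comp fun i => X i.castSucc.succ)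
  have h3 := congrArg (fun z => z ≫ F.map (X 0 ◁ (splitLast fun i => X i.succ).inv) ▷ W.obj) h2
  simp only [Category.assoc] at h3
  refine Eq.trans (congrArg (fun z => _ ≫ z) h3) ?_
  rw [← Category.assoc]
  refine Eq.trans (congrArg (fun z => z ≫ _) h) ?_
  rw [Category.assoc, ← comp_whiskerRight, ← F.map_comp, ← whiskerLeft_comp, Iso.hom_inv_id]
  simp

lemma iso_aux₁ {A : Type u} [Category.{v} A] {a b c d e : A} (p : a ≅ b) (q : b ≅ c) (r : a ≅ d)
    (s : d ≅ e) (t : c ⟶ e) (h : p.hom ≫ q.hom ≫ t = r.hom ≫ s.hom) :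
    q.inv ≫ p.inv = t ≫ s.inv ≫ r.inv := by
  rw [← cancel_epi q.hom, ← cancel_epi p.hom, reassoc_of% h]
  simp

lemma iso_aux₂ {A : Type u} [Category.{v} A] {a b c d : A} (p : a ≅ b) (q : b ≅ c) (r : a ≅ d)
    (t : d ⟶ c) (h : p.hom ≫ q.hom = r.hom ≫ t) : t ≫ q.inv ≫ p.inv = r.inv := by
  rw [← cancel_epi r.hom, ← reassoc_of% h]
  simp

lemma coface_mid_mid {n : ℕ} (i j : Fin n) (hij : i ≤ j) (f : Cochain V W n) :
    cofaceMid j.succ (cofaceMid i f) = cofaceMid i.castSucc (cofaceMid j f) := by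
  ext X
  obtain ⟨θ, h1, h2⟩ := merge_merge F i j hij X
  have h3 : (mergeIso (𝟭 C) i (merge j.succ X)).inv ≫ (mergeIso (𝟭 C) j.succ X).inv =
      tensorTupleMap θ ≫ (mergeIso (𝟭 C) j (merge i.castSucc X)).inv ≫
        (mergeIso (𝟭 C) i.castSucc X).inv := iso_aux₁ _ _ _ _ _ h2
  have h4 := f.comp_naturality θ
  rw [cofaceMid_comp j.succ, cofaceMid_comp i, cofaceMid_comp i.castSucc, cofaceMid_comp j]
  simp only [Category.assoc]
  rw [← comp_whiskerRight, ← F.map_comp, ← comp_whiskerRight, ← F.map_comp]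
  refine Eq.trans (congrArg (fun z => _ ≫ _ ≫ _ ≫ F.map z ▷ W.obj) h3) ?_
  rw [F.map_comp (tensorTupleMap θ), comp_whiskerRight, ← reassoc_of% h4,
    ← whiskerLeft_comp_assoc, ← whiskerLeft_comp_assoc, ← whiskerLeft_comp_assoc,
    Category.assoc, h1]

lemma coface_mid_last {n : ℕ} (i : Fin n) (f : Cochain V W n) :
    cofaceLast (cofaceMid i f) = cofaceMid i.castSucc (cofaceLast f) := by
  ext X
  obtain ⟨θ, l, h1, h2⟩ := merge_castSucc F i X
  have h := actRight_naturality (V := V) (W := W)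
    ((mergeIso F i fun i => X i.castSucc).hom ≫ tensorTupleMap fun k => F.map (θ k))
    ((mergeIso (𝟭 C) i fun i => X i.castSucc).hom ≫ tensorTupleMap θ)
    ((cofaceMid i f).comp fun i => X i.castSucc)
    (f.comp fun k => merge i.castSucc X k.castSucc) (by
      rw [cofaceMid_comp, whiskerLeft_comp, Category.assoc, f.comp_naturality θ]
      simp only [Category.assoc, ← comp_whiskerRight, ← F.map_comp, Iso.inv_hom_id_assoc]) l
  have h3 : (((mergeIso (𝟭 C) i fun i => X i.castSucc).hom ≫ tensorTupleMap θ) ⊗ₘ l) ≫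
      (splitLast (merge i.castSucc X)).inv ≫ (mergeIso (𝟭 C) i.castSucc X).inv =
        (splitLast X).inv := iso_aux₂ _ _ _ _ h2
  rw [cofaceLast_comp, cofaceMid_comp i.castSucc, cofaceLast_comp]
  simp only [Category.assoc]
  rw [← comp_whiskerRight, ← F.map_comp, ← whiskerLeft_comp_assoc, h1, whiskerLeft_comp_assoc,
    reassoc_of% h, ← comp_whiskerRight, ← F.map_comp]
  exact congrArg (fun z => _ ≫ _ ≫ F.map z ▷ W.obj) h3.symm

lemma coface_last_last {n : ℕ} (f : Cochain V W n) :
    cofaceLast (cofaceLast f) = cofaceMid (Fin.last n) (cofaceLast f) := by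
  ext X
  obtain ⟨θ, l, h1, h2⟩ := merge_last F X
  have h3 : ((splitLast (fun i : Fin (n + 1) => X i.castSucc)).hom ▷ X (Fin.last (n + 1)) ≫
      (α_ _ _ _).hom ≫ (tensorTupleMap θ ⊗ₘ (μ (𝟭 C) _ _ ≫ l))) ≫
        (splitLast (merge (Fin.last n) X)).inv ≫ (mergeIso (𝟭 C) (Fin.last n) X).inv =
      (splitLast X).inv := iso_aux₂ _ _ _ _ h2
  have hl : μ (𝟭 C) (X (Fin.last n).castSucc) (X (Fin.last (n + 1))) ≫ l = l := by
    rw [Functor.LaxMonoidal.id_μ]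
    exact Category.id_comp l
  rw [hl] at h3
  have h4 := actRight_naturality (V := V) (W := W) _ _ _ _ (f.comp_naturality θ) l
  have h5 := actRight_actRight (V := V) (W := W) (X (Fin.last n).castSucc) (X (Fin.last (n + 1)))
    (f.comp fun k => X k.castSucc.castSucc)
  have h6 := actRight_naturality (V := V) (W := W)
    (splitLast fun i : Fin (n + 1) => F.obj (X i.castSucc)).hom
    (splitLast fun i : Fin (n + 1) => X i.castSucc).hom
    ((cofaceLast f).comp fun i => X i.castSucc)
    (actRight (f.comp fun k => X k.castSucc.castSucc) (X (Fin.last n).castSucc)) (by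
      rw [cofaceLast_comp]
      simp only [Category.assoc, ← comp_whiskerRight, ← F.map_comp, Iso.inv_hom_id]
      simp) (𝟙 (X (Fin.last (n + 1))))
  rw [F.map_id, tensorHom_id, tensorHom_id] at h6
  rw [cofaceLast_comp (cofaceLast f) X, cofaceMid_comp (Fin.last n),
    cofaceLast_comp f (merge (Fin.last n) X)]
  simp only [Category.assoc]
  rw [← comp_whiskerRight _ _ W.obj, ← F.map_comp, ← whiskerLeft_comp_assoc, h1]
  have h7 : (tensorTupleMap fun k => F.map (θ k)) ⊗ₘ (μ F (X (Fin.last n).castSucc)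
      (X (Fin.last (n + 1))) ≫ F.map l) = (_ ◁ μ F _ _) ≫
        ((tensorTupleMap fun k => F.map (θ k)) ⊗ₘ F.map l) := by
    rw [← id_tensorHom, tensorHom_comp_tensorHom, Category.id_comp]
  rw [h7]
  simp only [whiskerLeft_comp, Category.assoc]
  simp only [whiskerLeft_comp, Category.assoc] at h5
  rw [reassoc_of% h4, reassoc_of% h5, reassoc_of% h6]
  simp only [← comp_whiskerRight, ← F.map_comp]
  rw [← h3]
  simp only [Category.assoc]

@[simp] lemma coface_zero {n : ℕ} (f : Cochain V W n) : coface 0 f = cofaceZero f := rfl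

@[simp] lemma coface_mid {n : ℕ} (j : Fin n) (f : Cochain V W n) :
    coface j.castSucc.succ f = cofaceMid j f := by
  simp [coface]

@[simp] lemma coface_last {n : ℕ} (f : Cochain V W n) :
    coface (Fin.last n).succ f = cofaceLast f := by
  simp only [coface, Fin.cases_succ, Fin.lastCases_last]

lemma coface_coface {n : ℕ} (i j : Fin (n + 2)) (hij : i ≤ j) (f : Cochain V W n) :
    coface j.succ (coface i f) = coface i.castSucc (coface j f) := by
  revert hij
  refine Fin.cases ?_ (fun i' => ?_) i <;> refine Fin.cases ?_ (fun j' => ?_) j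
  · intro _
    exact (coface_mid (0 : Fin (n + 1)) (cofaceZero f)).trans (coface_zero_zero f)
  · intro _
    refine Fin.lastCases ?_ (fun j'' => ?_) j'
    · exact (coface_last (cofaceZero f)).trans ((coface_zero_last f).trans
        (congrArg cofaceZero (coface_last f).symm))
    · exact (coface_mid j''.succ (cofaceZero f)).trans ((coface_zero_mid j'' f).trans
        (congrArg cofaceZero (coface_mid j'' f).symm))
  · intro h
    simp at h
  · refine Fin.lastCases ?_ (fun j'' => ?_) j' <;> refine Fin.lastCases ?_ (fun i'' => ?_) i'
    · intro _
      rw [coface_last]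
      exact (coface_last (cofaceLast f)).trans ((coface_last_last f).trans
        (coface_mid (Fin.last n) (cofaceLast f)).symm)
    · intro _
      rw [coface_last, coface_mid]
      exact (coface_last (cofaceMid i'' f)).trans ((coface_mid_last i'' f).trans
        (coface_mid i''.castSucc (cofaceLast f)).symm)
    · intro h
      have := Fin.succ_le_succ_iff.mp h
      exact absurd this (not_le.mpr (Fin.castSucc_lt_last j''))
    · intro h
      rw [coface_mid, coface_mid]
      exact (coface_mid j''.succ (cofaceMid i'' f)).trans
        ((coface_mid_mid i'' j'' (by simpa using h) f).trans
        (coface_mid i''.castSucc (cofaceMid j'' f)).symm)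

section Linear

variable [Preadditive D] [MonoidalPreadditive D]

lemma actLeft_add (X : C) {S : D} {P : C} (f g : V.obj ⊗ S ⟶ F.obj P ⊗ W.obj) :
    actLeft X (f + g) = actLeft X f + actLeft X g := by
  simp [actLeft, MonoidalPreadditive.whiskerLeft_add]

lemma actRight_add {S : D} {P : C} (f g : V.obj ⊗ S ⟶ F.obj P ⊗ W.obj) (Y : C) :
    actRight (f + g) Y = actRight f Y + actRight g Y := by
  simp [actRight, MonoidalPreadditive.add_whiskerRight]

lemma coface_add {n : ℕ} (i : Fin (n + 2)) (f g : Cochain V W n) :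
    coface i (f + g) = coface i f + coface i g := by
  refine Fin.cases ?_ (fun i' => Fin.lastCases ?_ (fun j => ?_) i') i
  · ext X
    exact actLeft_add _ (f.comp _) (g.comp _)
  · rw [coface_last, coface_last, coface_last]
    ext X
    change _ = (cofaceLast f).comp X + (cofaceLast g).comp X
    simp only [cofaceLast_comp]
    rw [← Preadditive.comp_add, ← Preadditive.add_comp, ← actRight_add]
    rfl
  · rw [coface_mid, coface_mid, coface_mid]
    ext X
    change _ = (cofaceMid j f).comp X + (cofaceMid j g).comp X
    simp only [cofaceMid_comp]
    rw [← Preadditive.comp_add, ← Preadditive.add_comp]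
    rfl

variable (k : Type w) [Semiring k] [Linear k D] [MonoidalLinear k D]

lemma actLeft_smul (X : C) {S : D} {P : C} (r : k) (f : V.obj ⊗ S ⟶ F.obj P ⊗ W.obj) :
    actLeft X (r • f) = r • actLeft X f := by
  simp [actLeft]

lemma actRight_smul {S : D} {P : C} (r : k) (f : V.obj ⊗ S ⟶ F.obj P ⊗ W.obj) (Y : C) :
    actRight (r • f) Y = r • actRight f Y := by
  simp [actRight]

lemma coface_smul {n : ℕ} (i : Fin (n + 2)) (r : k) (f : Cochain V W n) :
    coface i (r • f) = r • coface i f := by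
  refine Fin.cases ?_ (fun i' => Fin.lastCases ?_ (fun j => ?_) i') i
  · ext X
    exact actLeft_smul k _ r (f.comp _)
  · rw [coface_last, coface_last]
    ext X
    change _ = r • (cofaceLast f).comp X
    simp only [cofaceLast_comp]
    rw [← Linear.comp_smul, ← Linear.smul_comp, ← actRight_smul]
    rfl
  · rw [coface_mid, coface_mid]
    ext X
    change _ = r • (cofaceMid j f).comp X
    simp only [cofaceMid_comp]
    rw [← Linear.comp_smul, ← Linear.smul_comp]
    rfl

end Linear

section Complex

variable [Preadditive D] [MonoidalPreadditive D]
variable (k : Type w) [CommRing k] [Linear k D] [MonoidalLinear k D]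

/-- The coface maps as linear maps. -/
def cofaceLinear (V W : Centralizer F) (n : ℕ) (i : Fin (n + 2)) :
    Cochain V W n →ₗ[k] Cochain V W (n + 1) where
  toFun f := coface i f
  map_add' f g := coface_add i f g
  map_smul' r f := coface_smul k i r f

/-- The Davydov--Yetter differential `δ = ∑ᵢ (-1)ⁱ ∂ᵢ`. -/
def differential (V W : Centralizer F) (n : ℕ) : Cochain V W n →ₗ[k] Cochain V W (n + 1) :=
  ∑ i : Fin (n + 2), (-1 : ℤ) ^ (i : ℕ) • cofaceLinear k V W n i

lemma alternating_sum_eq_zero {M : Type v} [AddCommGroup M] (n : ℕ)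
    (T : Fin (n + 3) → Fin (n + 2) → M)
    (h : ∀ i j : Fin (n + 2), i ≤ j → T j.succ i = T i.castSucc j) :
    ∑ j : Fin (n + 3), ∑ i : Fin (n + 2), (-1 : ℤ) ^ ((j : ℕ) + (i : ℕ)) • T j i = 0 := by
  simp only [← Finset.sum_product', Finset.univ_product_univ]
  let S : Finset (Fin (n + 3) × Fin (n + 2)) := {p | (p.1 : ℕ) ≤ (p.2 : ℕ)}
  rw [← Finset.sum_add_sum_compl S, ← eq_neg_iff_add_eq_zero, ← Finset.sum_neg_distrib]
  refine Finset.sum_bij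
    (fun p hp => (p.2.succ, Fin.castLT p.1
      (lt_of_le_of_lt (Finset.mem_filter.mp hp).right p.2.is_lt))) ?_ ?_ ?_ ?_
  · rintro ⟨j, i⟩ hp
    simp only [S, Finset.compl_filter, Finset.mem_filter_univ, Fin.val_succ,
      Fin.val_castLT] at hp ⊢
    lia
  · rintro ⟨j, i⟩ hp ⟨j', i'⟩ hp' e
    simp only [Prod.mk.injEq, Fin.ext_iff, Fin.val_castLT, Fin.val_succ] at e ⊢
    omega
  · rintro ⟨j, i⟩ hp
    simp only [S, Finset.compl_filter, Finset.mem_filter_univ, not_le] at hp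
    refine ⟨(i.castSucc, j.pred (fun e => by simp [e] at hp)), ?_, ?_⟩
    · simp only [S, Finset.mem_filter_univ, Fin.val_castSucc, Fin.val_pred]
      lia
    · simp
  · rintro ⟨j, i⟩ hp
    simp only [S, Finset.mem_filter_univ] at hp
    rw [h _ _ (by simpa [Fin.le_def] using hp)]
    simp only [Fin.castSucc_castLT, Fin.val_succ, Fin.val_castLT, ← neg_smul]
    congr 1
    ring

lemma differential_comp_differential (V W : Centralizer F) (n : ℕ) :
    differential k V W (n + 1) ∘ₗ differential k V W n = 0 := by
  ext1 f
  have := alternating_sum_eq_zero n (fun j i => coface j (coface i f))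
    (fun i j hij => coface_coface i j hij f)
  rw [LinearMap.comp_apply, differential, differential, LinearMap.sum_apply, LinearMap.zero_apply,
    ← this]
  refine Finset.sum_congr rfl fun j _ => ?_
  rw [LinearMap.sum_apply, map_sum]
  refine Finset.sum_congr rfl fun i _ => ?_
  rw [LinearMap.smul_apply, LinearMap.smul_apply, map_zsmul, smul_smul, pow_add]
  rfl

/-- The Davydov--Yetter complex `C^•_DY(F; V, W)` of `F` with coefficients `V, W`. -/
def dyComplex (V W : Centralizer F) : CochainComplex (ModuleCat.{max u₁ v₂} k) ℕ :=
  CochainComplex.of (fun n => ModuleCat.of k (Cochain V W n))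
    (fun n => ModuleCat.ofHom (differential k V W n))
    (fun n => by
      rw [← ModuleCat.ofHom_comp, differential_comp_differential]
      rfl)

/-- The Davydov--Yetter cohomology `H^n_DY(F; V, W)`. -/
abbrev dyCohomology (V W : Centralizer F) (n : ℕ) : ModuleCat.{max u₁ v₂} k :=
  (dyComplex k V W).homology n

end Complex

end Cochains

section Relative

variable {A : Type u₁} [Category.{v₁} A] {B : Type u₂} [Category.{v₂} B]

/-- `Gⁿ(V)` for an endofunctor `G`. -/
def iterate (G : A ⥤ A) (V : A) : ℕ → A
  | 0 => V
  | n + 1 => G.obj (iterate G V n)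

/-- The counit `ε : Gⁿ⁺¹(V) ⟶ Gⁿ(V)` of the comonad `G = L U` of an adjunction `L ⊣ U`. -/
def barEps {L : B ⥤ A} {U : A ⥤ B} (adj : L ⊣ U) (V : A) (n : ℕ) :
    iterate (U ⋙ L) V (n + 1) ⟶ iterate (U ⋙ L) V n :=
  adj.counit.app (iterate (U ⋙ L) V n)

/-- `G(f) : Gᵐ⁺¹(V) ⟶ Gⁿ⁺¹(V)` for `f : Gᵐ(V) ⟶ Gⁿ(V)`. -/
def iterateMap (G : A ⥤ A) (V : A) {m n : ℕ} (f : iterate G V m ⟶ iterate G V n) :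
    iterate G V (m + 1) ⟶ iterate G V (n + 1) :=
  G.map f

/-- For an adjunction `L ⊣ U` with comonad `G = L U` and counit `ε`, the morphism
`∂ₙ,ᵢ = Gⁿ⁻ⁱ(ε_{Gⁱ(V)}) : Gⁿ⁺¹(V) ⟶ Gⁿ(V)`, `0 ≤ i ≤ n`. -/
def barFace {L : B ⥤ A} {U : A ⥤ B} (adj : L ⊣ U) (V : A) : ∀ (n : ℕ), Fin (n + 1) →
    (iterate (U ⋙ L) V (n + 1) ⟶ iterate (U ⋙ L) V n)
  | 0, _ => barEps adj V 0
  | n + 1, i =>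
      Fin.lastCases
        (motive := fun _ => iterate (U ⋙ L) V (n + 2) ⟶ iterate (U ⋙ L) V (n + 1))
        (barEps adj V (n + 1))
        (fun j => iterateMap (U ⋙ L) V (barFace adj V n j)) i

/-- `dₙ = ∑ᵢ (-1)ⁱ ∂ₙ,ᵢ : Gⁿ⁺¹(V) ⟶ Gⁿ(V)`. -/
def barD [Preadditive A] {L : B ⥤ A} {U : A ⥤ B} (adj : L ⊣ U) (V : A) (n : ℕ) :
    iterate (U ⋙ L) V (n + 1) ⟶ iterate (U ⋙ L) V n :=
  ∑ i : Fin (n + 1), (-1 : ℤ) ^ (i : ℕ) • barFace adj V n i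

lemma barEps_naturality {L : B ⥤ A} {U : A ⥤ B} (adj : L ⊣ U) (V : A) {m n : ℕ}
    (f : iterate (U ⋙ L) V m ⟶ iterate (U ⋙ L) V n) :
    iterateMap (U ⋙ L) V f ≫ barEps adj V n = barEps adj V m ≫ f :=
  adj.counit.naturality f

lemma barD_zero [Preadditive A] {L : B ⥤ A} {U : A ⥤ B} (adj : L ⊣ U) (V : A) :
    barD adj V 0 = barEps adj V 0 := by
  simp [barD, barFace]

lemma barD_succ [Preadditive A] {L : B ⥤ A} {U : A ⥤ B} (adj : L ⊣ U) [(U ⋙ L).Additive] (V : A)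
    (n : ℕ) : barD adj V (n + 1) = iterateMap (U ⋙ L) V (barD adj V n) +
      (-1 : ℤ) ^ (n + 1) • barEps adj V (n + 1) := by
  unfold barD iterateMap
  rw [Fin.sum_univ_castSucc, Functor.map_sum]
  simp only [Functor.map_zsmul, barFace, Fin.lastCases_castSucc, Fin.lastCases_last,
    Fin.val_castSucc, Fin.val_last]
  rfl

lemma barD_comp_barD [Preadditive A] {L : B ⥤ A} {U : A ⥤ B} (adj : L ⊣ U) [(U ⋙ L).Additive]
    (V : A) (n : ℕ) : barD adj V (n + 1) ≫ barD adj V n = 0 := by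
  induction n with
  | zero =>
      rw [barD_succ, barD_zero, Preadditive.add_comp, Preadditive.zsmul_comp, barEps_naturality]
      simp
  | succ n ih =>
      have h : iterateMap (U ⋙ L) V (barD adj V (n + 1)) ≫ iterateMap (U ⋙ L) V (barD adj V n) =
          0 := by
        refine ((U ⋙ L).map_comp _ _).symm.trans ?_
        rw [ih]
        exact (U ⋙ L).map_zero _ _
      rw [barD_succ adj V (n + 1), Preadditive.add_comp, Preadditive.zsmul_comp]
      nth_rw 2 [barD_succ adj V n]
      rw [Preadditive.comp_add, Preadditive.comp_zsmul, barEps_naturality, h, zero_add,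
        ← add_smul, pow_succ (-1 : ℤ) (n + 1)]
      simp

variable [Preadditive A] [Preadditive B]

/-- The bar complex `⋯ ⟶ G³(V) ⟶ G²(V) ⟶ G(V)` of an object with respect to an adjunction `L ⊣ U`
with comonad `G = L U`. -/
def barComplex {L : B ⥤ A} {U : A ⥤ B} (adj : L ⊣ U) [U.Additive] (V : A) : ChainComplex A ℕ :=
  haveI : L.Additive := adj.left_adjoint_additive
  ChainComplex.of (fun n => iterate (U ⋙ L) V (n + 1)) (fun n => barD adj V (n + 1))
    (fun n => barD_comp_barD adj V (n + 1))

/-- The cochain complex `Hom(P_•, W)`. -/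
def homComplex (k : Type w) [CommRing k] [Linear k A] (P : ChainComplex A ℕ) (W : A) :
    CochainComplex (ModuleCat.{v₁} k) ℕ :=
  CochainComplex.of (fun n => ModuleCat.of k (P.X n ⟶ W))
    (fun n => ModuleCat.ofHom (Linear.leftComp k W (P.d (n + 1) n)))
    (fun n => by
      ext f
      change P.d _ _ ≫ P.d _ _ ≫ f = 0
      simp)

/-- A morphism `f` is allowable with respect to a functor `U` if `U f ∘ s ∘ U f = U f` for
some `s`. -/
def IsAllowable (U : A ⥤ B) {M N : A} (f : M ⟶ N) : Prop :=
  ∃ s : U.obj N ⟶ U.obj M, U.map f ≫ s ≫ U.map f = U.map f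

/-- An object is relatively projective if morphisms from it lift along allowable epimorphisms. -/
def IsRelativelyProjective (U : A ⥤ B) (P : A) : Prop :=
  ∀ ⦃M N : A⦄ (p : M ⟶ N), Epi p → IsAllowable U p → ∀ g : P ⟶ N, ∃ h : P ⟶ M, h ≫ p = g

/-- A relatively projective resolution `0 ⟵ V ⟵ P₀ ⟵ P₁ ⟵ ⋯`: an exact sequence of allowable
morphisms in which all `Pₙ` are relatively projective. -/
structure RelProjResolution (U : A ⥤ B) (V : A) where
  /-- The complex `P_•`. -/
  complex : ChainComplex A ℕ
  /-- The augmentation. -/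
  π : complex.X 0 ⟶ V
  d_comp_π : complex.d 1 0 ≫ π = 0
  epi_π : Epi π
  exact_zero : (ShortComplex.mk (complex.d 1 0) π d_comp_π).Exact
  exact_succ : ∀ n : ℕ, complex.ExactAt (n + 1)
  allowable_π : IsAllowable U π
  allowable_d : ∀ n : ℕ, IsAllowable U (complex.d (n + 1) n)
  projective : ∀ n : ℕ, IsRelativelyProjective U (complex.X n)

/-- The relative Ext space `Ext^n(V, W)` computed with a relatively projective resolution of `V`. -/
abbrev RelProjResolution.ext (k : Type w) [CommRing k] [Linear k A] {U : A ⥤ B} {V : A}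
    (P : RelProjResolution U V) (W : A) (n : ℕ) : ModuleCat.{v₁} k :=
  (homComplex k P.complex W).homology n

/-- The properties of a right adjoint `U : A ⥤ B` in a resolvent pair: `A` is abelian
(for its given additive structure) and `U` is additive, exact and faithful and has a left adjoint. -/
structure IsResolvent {B : Type u₂} [Category.{v₂} B] [Abelian B] (U : A ⥤ B) : Prop where
  abelian : ∃ h : Abelian A, h.toPreadditive = ‹Preadditive A›
  additive : U.Additive
  preservesFiniteLimits : PreservesFiniteLimits U
  preservesFiniteColimits : PreservesFiniteColimits U
  faithful : U.Faithful
  isRightAdjoint : U.IsRightAdjoint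

end Relative

/-- A `k`-linear category is finite if it is equivalent, as a `k`-linear category, to the category
of finite-dimensional modules over a finite-dimensional `k`-algebra. -/
def IsFiniteLinear (k : Type w) [Field k] (C : Type u) [Category.{v} C] [Preadditive C]
    [Linear k C] : Prop :=
  ∃ (R : Type w) (_ : Ring R) (_ : Algebra k R) (_ : Module.Finite k R)
    (E : C ≌ FGModuleCat.{w} R), E.functor.Additive ∧ E.functor.Linear k

end DavydovYetter

end

open DavydovYetter

/-!
Write `Z` for the centralizer of `F`, `U` for its forgetful functor and `G` for the comonad `L U` of
an adjunction `L ⊣ U`.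

**Abelian structure.** Since `C` is rigid, every `F X` has duals, so tensoring with `F X` preserves
finite limits, and it preserves finite colimits by hypothesis. Hence `U` creates finite limits and
finite colimits (`Centralizer.limitObj`, `Centralizer.colimitObj`), and `Z` is abelian because the
comparison of coimages with images is invertible after applying `U` (`Centralizer.abelian`).

**Free objects.** The free object on `V` should be the coend of `F(X)ᘁ ⊗ V ⊗ F(X)`, which represents
the natural transformations `V ⊗ F(-) ⟶ F(-) ⊗ B` as a functor of `B`; this universal property is
`IsUniversal`. As `C` is finite, it has an object `P` such that `Hom(P, -)` is faithful with
finite-dimensional values. A natural transformation between `k`-linear functors, the first of which is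
right exact, is then the same as a morphism at `P` that commutes with `End(P)`
(`IsFiniteGenerator.exists_extension`), so the coend is the cokernel of a single morphism between finite direct sums (`exists_isUniversal`). Its
universal property extends to natural transformations `V ⊗ F(-) ⊗ S ⟶ F(-) ⊗ B` for `S` with a dual
(`IsUniversal.exists_tensor`). This yields a half-braiding on the coend, except for invertibility,
which is automatic because `C` is rigid (`LaxHalfBraiding.isIso_σ`). Conversely, every left adjoint
of `U` gives universal natural transformations (`isUniversal_of_adjunction`).

**Cochains.** Applying the unit `V ⟶ G(V)` and then moving `F X₁` to the left, applying the unit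
again and moving `F X₂` to the left, and so on, gives a cochain in `Cⁿ(V, Gⁿ⁺¹(V))`, the universal
cochain `universalCochain`. Its cofaces correspond to the faces of the bar complex
(`coface_universalCochain`): the last one by a triangle identity, the other ones by the identities
between cofaces and induction. Composition with the universal cochains is therefore a morphism of
complexes from `Hom(Bar(V), W)` to the Davydov--Yetter complex. It is bijective in each degree by
induction (`universalCochain_post_bijective`): the universal property of `G(V)` identifies
`Cⁿ⁺¹(V, W)` with `Cⁿ(G(V), W)` (`shift_bijective`).

**Relative Ext.** The unit is a contracting homotopy of the image of the augmented bar complex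
under `U`. As `U` is exact and faithful and objects of the form `L X` are relatively projective, the
bar complex is a relatively projective resolution (`barResolution`). The usual comparison theorem
holds for relatively projective resolutions, because a morphism from a relatively projective object
lifts through allowable morphisms in exact sequences (`IsRelativelyProjective.exists_lift`).
-/

noncomputable section

namespace DavydovYetter

open Functor.LaxMonoidal

/-! ### Dual pairs and half-braidings -/

section HalfBraiding

variable {C : Type u₁} [Category.{v₁} C] [MonoidalCategory C]
  {D : Type u₂} [Category.{v₂} D] [MonoidalCategory D]

/-- A monoidal functor preserves dual pairs. -/
@[reducible]
def mapExactPairing (F : C ⥤ D) [F.Monoidal] (X Y : C) [ExactPairing X Y] :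
    ExactPairing (F.obj X) (F.obj Y) where
  coevaluation' := ε F ≫ F.map (η_ X Y) ≫ Functor.OplaxMonoidal.δ F X Y
  evaluation' := μ F Y X ≫ F.map (ε_ X Y) ≫ Functor.OplaxMonoidal.η F
  coevaluation_evaluation' := by
    have h := congrArg F.map (ExactPairing.coevaluation_evaluation X Y)
    simp only [Functor.map_comp, Functor.Monoidal.map_whiskerLeft,
      Functor.Monoidal.map_whiskerRight, Functor.Monoidal.map_associator_inv,
      Functor.Monoidal.map_rightUnitor, Functor.Monoidal.map_leftUnitor_inv, Category.assoc,
      Functor.Monoidal.μ_δ_assoc] at h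
    rw [cancel_epi] at h
    simp only [← Category.assoc, cancel_mono] at h
    simp only [Category.assoc] at h
    simp only [whiskerLeft_comp, comp_whiskerRight, Category.assoc]
    rw [reassoc_of% h]
    simp
  evaluation_coevaluation' := by
    have h := congrArg F.map (ExactPairing.evaluation_coevaluation X Y)
    simp only [Functor.map_comp, Functor.Monoidal.map_whiskerLeft,
      Functor.Monoidal.map_whiskerRight, Functor.Monoidal.map_associator,
      Functor.Monoidal.map_rightUnitor_inv, Functor.Monoidal.map_leftUnitor, Category.assoc,
      Functor.Monoidal.μ_δ_assoc] at h
    rw [cancel_epi] at h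
    simp only [← Category.assoc, cancel_mono] at h
    simp only [Category.assoc] at h
    simp only [whiskerLeft_comp, comp_whiskerRight, Category.assoc]
    rw [reassoc_of% h]
    simp

/-- A natural family of morphisms `T ⊗ F X ⟶ F X ⊗ T` that is compatible with tensor products and
with the unit; the invertibility of its components is not required. -/
structure LaxHalfBraiding (F : C ⥤ D) [F.Monoidal] (T : D) where
  /-- The components of the family. -/
  σ : ∀ X : C, T ⊗ F.obj X ⟶ F.obj X ⊗ T
  naturality : ∀ {X Y : C} (g : X ⟶ Y), T ◁ F.map g ≫ σ Y = σ X ≫ F.map g ▷ T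
  monoidal : ∀ X Y : C, T ◁ μ F X Y ≫ σ (X ⊗ Y) =
    (α_ T (F.obj X) (F.obj Y)).inv ≫ σ X ▷ F.obj Y ≫ (α_ (F.obj X) T (F.obj Y)).hom ≫
      F.obj X ◁ σ Y ≫ (α_ (F.obj X) (F.obj Y) T).inv ≫ μ F X Y ▷ T
  unital : T ◁ ε F ≫ σ (𝟙_ C) = (ρ_ T).hom ≫ (λ_ T).inv ≫ ε F ▷ T

section Inverse

variable {A B T : D} (a : T ⊗ A ⟶ A ⊗ T) (b : T ⊗ B ⟶ B ⊗ T) [ExactPairing B A]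

/-- The candidate for the inverse of `a : T ⊗ A ⟶ A ⊗ T` that is built from a morphism
`b : T ⊗ B ⟶ B ⊗ T` for the dual `B` of `A`. -/
def dualInverse : A ⊗ T ⟶ T ⊗ A :=
  𝟙 _ ⊗≫ (A ⊗ T) ◁ η_ B A ⊗≫ A ◁ b ▷ A ⊗≫ ε_ B A ▷ (T ⊗ A) ⊗≫ 𝟙 (T ⊗ A)

lemma comp_dualInverse
    (h : 𝟙 _ ⊗≫ a ▷ B ⊗≫ A ◁ b ⊗≫ ε_ B A ▷ T ⊗≫ 𝟙 T = T ◁ ε_ B A ≫ (ρ_ T).hom) :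
    a ≫ dualInverse b = 𝟙 (T ⊗ A) := by
  unfold dualInverse
  calc _ = 𝟙 _ ⊗≫ (a ▷ 𝟙_ D ≫ (A ⊗ T) ◁ η_ B A) ⊗≫ A ◁ b ▷ A ⊗≫
        ε_ B A ▷ (T ⊗ A) ⊗≫ 𝟙 (T ⊗ A) := by monoidal
    _ = 𝟙 _ ⊗≫ (T ⊗ A) ◁ η_ B A ⊗≫
        (𝟙 (T ⊗ A ⊗ B) ⊗≫ a ▷ B ⊗≫ A ◁ b ⊗≫ ε_ B A ▷ T ⊗≫ 𝟙 T) ▷ A := by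
        rw [← MonoidalCategory.whisker_exchange]; monoidal
    _ = 𝟙 _ ⊗≫ T ◁ (A ◁ η_ B A ⊗≫ ε_ B A ▷ A) ⊗≫ 𝟙 (T ⊗ A) := by rw [h]; monoidal
    _ = _ := by rw [ExactPairing.coevaluation_evaluation'']; monoidal

lemma dualInverse_comp
    (h : 𝟙 _ ⊗≫ T ◁ η_ B A ⊗≫ b ▷ A ⊗≫ B ◁ a ⊗≫ 𝟙 ((B ⊗ A) ⊗ T) = (λ_ T).inv ≫ η_ B A ▷ T) :
    dualInverse b ≫ a = 𝟙 (A ⊗ T) := by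
  unfold dualInverse
  calc _ = 𝟙 _ ⊗≫ (A ⊗ T) ◁ η_ B A ⊗≫ A ◁ b ▷ A ⊗≫ (ε_ B A ▷ (T ⊗ A) ≫ 𝟙_ D ◁ a) ⊗≫
        𝟙 (A ⊗ T) := by monoidal
    _ = 𝟙 _ ⊗≫ A ◁ (𝟙 T ⊗≫ T ◁ η_ B A ⊗≫ b ▷ A ⊗≫ B ◁ a ⊗≫ 𝟙 ((B ⊗ A) ⊗ T)) ⊗≫
        ε_ B A ▷ (A ⊗ T) ⊗≫ 𝟙 (A ⊗ T) := by rw [← MonoidalCategory.whisker_exchange]; monoidal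
    _ = 𝟙 _ ⊗≫ (A ◁ η_ B A ⊗≫ ε_ B A ▷ A) ▷ T ⊗≫ 𝟙 (A ⊗ T) := by rw [h]; monoidal
    _ = _ := by rw [ExactPairing.coevaluation_evaluation'']; monoidal

end Inverse

namespace LaxHalfBraiding

variable {F : C ⥤ D} [F.Monoidal] {T : D} (h : LaxHalfBraiding F T)

/-- Compatibility of a lax half-braiding with the evaluation, from naturality at the evaluation. -/
lemma σ_comp_evaluation (X Y : C) [ExactPairing X Y] :
    letI := mapExactPairing F X Y
    𝟙 _ ⊗≫ h.σ Y ▷ F.obj X ⊗≫ F.obj Y ◁ h.σ X ⊗≫ ε_ (F.obj X) (F.obj Y) ▷ T ⊗≫ 𝟙 T =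
      T ◁ ε_ (F.obj X) (F.obj Y) ≫ (ρ_ T).hom := by
  let := mapExactPairing F X Y
  have e : ε_ (F.obj X) (F.obj Y) = μ F Y X ≫ F.map (ε_ X Y) ≫ Functor.OplaxMonoidal.η F := rfl
  have hu : h.σ (𝟙_ C) ≫ Functor.OplaxMonoidal.η F ▷ T =
      T ◁ Functor.OplaxMonoidal.η F ≫ (ρ_ T).hom ≫ (λ_ T).inv := by
    rw [← cancel_epi (T ◁ ε F), reassoc_of% h.unital]
    simp
  calc _ = 𝟙 _ ⊗≫ ((α_ T _ _).inv ≫ h.σ Y ▷ F.obj X ≫ (α_ _ T _).hom ≫ F.obj Y ◁ h.σ X ≫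
        (α_ _ _ T).inv ≫ μ F Y X ▷ T) ≫ F.map (ε_ X Y) ▷ T ≫
          Functor.OplaxMonoidal.η F ▷ T ≫ (λ_ T).hom := by rw [e]; monoidal
    _ = _ := by
      rw [← h.monoidal, e, Category.assoc, ← reassoc_of% (h.naturality (ε_ X Y)),
        reassoc_of% hu]
      monoidal

/-- Compatibility of a lax half-braiding with the coevaluation, from naturality at the
coevaluation. -/
lemma coevaluation_comp_σ (X Y : C) [ExactPairing X Y] :
    letI := mapExactPairing F X Y
    𝟙 _ ⊗≫ T ◁ η_ (F.obj X) (F.obj Y) ⊗≫ h.σ X ▷ F.obj Y ⊗≫ F.obj X ◁ h.σ Y ⊗≫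
      𝟙 ((F.obj X ⊗ F.obj Y) ⊗ T) =
      (λ_ T).inv ≫ η_ (F.obj X) (F.obj Y) ▷ T := by
  let := mapExactPairing F X Y
  have e : η_ (F.obj X) (F.obj Y) = ε F ≫ F.map (η_ X Y) ≫ Functor.OplaxMonoidal.δ F X Y := rfl
  rw [← cancel_mono (μ F X Y ▷ T)]
  calc _ = 𝟙 _ ⊗≫ T ◁ ε F ≫ T ◁ F.map (η_ X Y) ≫ T ◁ Functor.OplaxMonoidal.δ F X Y ≫
        ((α_ T _ _).inv ≫ h.σ X ▷ F.obj Y ≫ (α_ _ T _).hom ≫ F.obj X ◁ h.σ Y ≫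
        (α_ _ _ T).inv ≫ μ F X Y ▷ T) := by rw [e]; monoidal
    _ = _ := by
      rw [← h.monoidal, e, Functor.Monoidal.whiskerLeft_δ_μ_assoc, h.naturality,
        reassoc_of% h.unital]
      simp [monoidalComp]

/-- The components of a lax half-braiding at objects with a left dual are invertible: the inverse at
`Y` is built from the component at the dual `X`. -/
lemma isIso_σ (X Y : C) [ExactPairing X Y] : IsIso (h.σ Y) := by
  let := mapExactPairing F X Y
  exact ⟨dualInverse (h.σ X), comp_dualInverse _ _ (h.σ_comp_evaluation X Y),
    dualInverse_comp _ _ (h.coevaluation_comp_σ X Y)⟩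

/-- The object of the centralizer given by a lax half-braiding, for a left rigid source. -/
def toCentralizer [LeftRigidCategory C] : Centralizer F where
  obj := T
  β X := haveI := h.isIso_σ (ᘁX) X; asIso (h.σ X)
  naturality g := h.naturality g
  monoidal X Y := h.monoidal X Y

end LaxHalfBraiding

/-- A half-braiding is compatible with the unit: this follows from compatibility with the tensor
product `𝟙 ⊗ 𝟙` because the half-braiding is invertible. -/
lemma Centralizer.unital {F : C ⥤ D} [F.Monoidal] (V : Centralizer F) :
    V.obj ◁ ε F ≫ (V.β (𝟙_ C)).hom = (ρ_ V.obj).hom ≫ (λ_ V.obj).inv ≫ ε F ▷ V.obj := by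
  set b := (V.β (𝟙_ C)).hom with hb
  -- `z` measures the failure of `b` to be the canonical isomorphism.
  set z : V.obj ⊗ 𝟙_ D ⟶ 𝟙_ D ⊗ V.obj := V.obj ◁ ε F ≫ b ≫ Functor.OplaxMonoidal.η F ▷ V.obj
    with hz
  have h1 : V.obj ◁ ε F ≫ b = z ≫ ε F ▷ V.obj := by simp [hz]
  have hl : ε F ▷ F.obj (𝟙_ C) ≫ μ F (𝟙_ C) (𝟙_ C) ≫ F.map (λ_ (𝟙_ C)).hom =
      (λ_ (F.obj (𝟙_ C))).hom := (left_unitality F (𝟙_ C)).symm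
  have h2 : V.obj ◁ (λ_ (F.obj (𝟙_ C))).hom ≫ b =
      ((α_ _ _ _).inv ≫ z ▷ F.obj (𝟙_ C) ≫ (α_ _ _ _).hom ≫ (λ_ _).hom) ≫ b := by
    calc _ = V.obj ◁ (ε F ▷ F.obj (𝟙_ C)) ≫ V.obj ◁ μ F (𝟙_ C) (𝟙_ C) ≫
          V.obj ◁ F.map (λ_ (𝟙_ C)).hom ≫ b := by
            rw [← hl]; simp only [whiskerLeft_comp, Category.assoc]
      _ = 𝟙 _ ⊗≫ (V.obj ◁ ε F ≫ b) ▷ F.obj (𝟙_ C) ⊗≫ F.obj (𝟙_ C) ◁ b ⊗≫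
          (μ F (𝟙_ C) (𝟙_ C) ≫ F.map (λ_ (𝟙_ C)).hom) ▷ V.obj := by
            rw [V.naturality, reassoc_of% (V.monoidal (𝟙_ C) (𝟙_ C))]; monoidal
      _ = 𝟙 _ ⊗≫ z ▷ F.obj (𝟙_ C) ⊗≫ (ε F ▷ (V.obj ⊗ F.obj (𝟙_ C)) ≫ F.obj (𝟙_ C) ◁ b) ⊗≫
          (μ F (𝟙_ C) (𝟙_ C) ≫ F.map (λ_ (𝟙_ C)).hom) ▷ V.obj := by
            rw [h1]; monoidal
      _ = 𝟙 _ ⊗≫ z ▷ F.obj (𝟙_ C) ⊗≫ 𝟙_ D ◁ b ⊗≫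
          (ε F ▷ F.obj (𝟙_ C) ≫ μ F (𝟙_ C) (𝟙_ C) ≫ F.map (λ_ (𝟙_ C)).hom) ▷ V.obj := by
            rw [← MonoidalCategory.whisker_exchange]; monoidal
      _ = _ := by rw [hl]; monoidal
  rw [cancel_mono] at h2
  have h3 : (z ≫ (λ_ V.obj).hom) ▷ F.obj (𝟙_ C) = (ρ_ V.obj).hom ▷ F.obj (𝟙_ C) := by
    rw [← cancel_epi (α_ _ _ _).inv]
    calc _ = V.obj ◁ (λ_ (F.obj (𝟙_ C))).hom := by rw [h2]; monoidal
      _ = _ := by monoidal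
  have h4 : (z ≫ (λ_ V.obj).hom) ▷ 𝟙_ D = (ρ_ V.obj).hom ▷ 𝟙_ D := by
    rw [← cancel_mono (V.obj ◁ ε F), ← MonoidalCategory.whisker_exchange, h3,
      MonoidalCategory.whisker_exchange]
  have h5 : z ≫ (λ_ V.obj).hom = (ρ_ V.obj).hom := by
    rw [← cancel_epi (ρ_ _).hom, ← MonoidalCategory.rightUnitor_naturality,
      ← MonoidalCategory.rightUnitor_naturality, h4]
  rw [h1, ← reassoc_of% h5]
  simp

end HalfBraiding

/-! ### The centralizer is abelian -/

namespace Centralizer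

variable {C : Type u₁} [Category.{v₁} C] [MonoidalCategory C]
  {D : Type u₂} [Category.{v₂} D] [MonoidalCategory D] {F : C ⥤ D} [F.Monoidal]

instance : (forget F).Faithful where
  map_injective h := hom_ext h

/-- A morphism of the centralizer with invertible underlying morphism is invertible. -/
instance : (forget F).ReflectsIsomorphisms where
  reflects {V W} f hf := by
    change IsIso f.hom at hf
    refine ⟨⟨inv f.hom, fun X => ?_⟩, ?_, ?_⟩
    · rw [← cancel_epi (f.hom ▷ F.obj X), ← comp_whiskerRight_assoc, IsIso.hom_inv_id,
        id_whiskerRight, Category.id_comp, reassoc_of% (f.comm X), ← whiskerLeft_comp,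
        IsIso.hom_inv_id, whiskerLeft_id, Category.comp_id]
    · ext; exact IsIso.hom_inv_id f.hom
    · ext; exact IsIso.inv_hom_id f.hom

section Transfer

/-! If a family `b` of morphisms `T ⊗ F X ⟶ F X ⊗ T` is intertwined with the half-braiding of `V` by
a morphism between `T` and `V`, then it satisfies the axioms of a half-braiding up to composition
with this morphism. On a limit or a colimit of objects of the centralizer, the canonical morphisms
are jointly monomorphic or jointly epimorphic, so the axioms hold there. -/

variable (V : Centralizer F) {T : D} (b : ∀ X, T ⊗ F.obj X ⟶ F.obj X ⊗ T)

lemma naturality_of_comp (p : T ⟶ V.obj)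
    (h : ∀ X, b X ≫ F.obj X ◁ p = p ▷ F.obj X ≫ (V.β X).hom) {X Y : C} (g : X ⟶ Y) :
    (T ◁ F.map g ≫ b Y) ≫ F.obj Y ◁ p = (b X ≫ F.map g ▷ T) ≫ F.obj Y ◁ p := by
  rw [Category.assoc, h, Category.assoc, ← MonoidalCategory.whisker_exchange, reassoc_of% h,
    ← V.naturality, MonoidalCategory.whisker_exchange_assoc]

lemma monoidal_of_comp (p : T ⟶ V.obj)
    (h : ∀ X, b X ≫ F.obj X ◁ p = p ▷ F.obj X ≫ (V.β X).hom) (X Y : C) :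
    (T ◁ μ F X Y ≫ b (X ⊗ Y)) ≫ F.obj (X ⊗ Y) ◁ p =
      ((α_ T (F.obj X) (F.obj Y)).inv ≫ b X ▷ F.obj Y ≫ (α_ (F.obj X) T (F.obj Y)).hom ≫
        F.obj X ◁ b Y ≫ (α_ (F.obj X) (F.obj Y) T).inv ≫ μ F X Y ▷ T) ≫
          F.obj (X ⊗ Y) ◁ p := by
  calc _ = (T ◁ μ F X Y ≫ p ▷ F.obj (X ⊗ Y)) ≫ (V.β (X ⊗ Y)).hom := by
        rw [Category.assoc, h, Category.assoc]
    _ = 𝟙 _ ⊗≫ (p ▷ F.obj X ≫ (V.β X).hom) ▷ F.obj Y ⊗≫ F.obj X ◁ (V.β Y).hom ⊗≫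
        μ F X Y ▷ V.obj := by
        rw [MonoidalCategory.whisker_exchange, Category.assoc, V.monoidal]; monoidal
    _ = 𝟙 _ ⊗≫ b X ▷ F.obj Y ⊗≫ F.obj X ◁ (p ▷ F.obj Y ≫ (V.β Y).hom) ⊗≫
          μ F X Y ▷ V.obj := by
        rw [← h]; monoidal
    _ = 𝟙 _ ⊗≫ b X ▷ F.obj Y ⊗≫ F.obj X ◁ b Y ⊗≫
        ((F.obj X ⊗ F.obj Y) ◁ p ≫ μ F X Y ▷ V.obj) := by
        rw [← h]; monoidal
    _ = _ := by
        rw [MonoidalCategory.whisker_exchange]; monoidal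

lemma comp_naturality (i : V.obj ⟶ T)
    (h : ∀ X, i ▷ F.obj X ≫ b X = (V.β X).hom ≫ F.obj X ◁ i) {X Y : C} (g : X ⟶ Y) :
    i ▷ F.obj X ≫ T ◁ F.map g ≫ b Y = i ▷ F.obj X ≫ b X ≫ F.map g ▷ T := by
  rw [← MonoidalCategory.whisker_exchange_assoc, h, reassoc_of% h,
    MonoidalCategory.whisker_exchange, reassoc_of% (V.naturality g)]

lemma comp_monoidal (i : V.obj ⟶ T)
    (h : ∀ X, i ▷ F.obj X ≫ b X = (V.β X).hom ≫ F.obj X ◁ i) (X Y : C) :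
    i ▷ (F.obj X ⊗ F.obj Y) ≫ T ◁ μ F X Y ≫ b (X ⊗ Y) =
      i ▷ (F.obj X ⊗ F.obj Y) ≫ (α_ T (F.obj X) (F.obj Y)).inv ≫ b X ▷ F.obj Y ≫
        (α_ (F.obj X) T (F.obj Y)).hom ≫ F.obj X ◁ b Y ≫ (α_ (F.obj X) (F.obj Y) T).inv ≫
          μ F X Y ▷ T := by
  symm
  calc _ = 𝟙 _ ⊗≫ (i ▷ F.obj X ≫ b X) ▷ F.obj Y ⊗≫ F.obj X ◁ b Y ⊗≫ μ F X Y ▷ T := by monoidal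
    _ = 𝟙 _ ⊗≫ (V.β X).hom ▷ F.obj Y ⊗≫ F.obj X ◁ (i ▷ F.obj Y ≫ b Y) ⊗≫ μ F X Y ▷ T := by
        rw [h]; monoidal
    _ = 𝟙 _ ⊗≫ (V.β X).hom ▷ F.obj Y ⊗≫ F.obj X ◁ (V.β Y).hom ⊗≫
        ((F.obj X ⊗ F.obj Y) ◁ i ≫ μ F X Y ▷ T) := by
        rw [h]; monoidal
    _ = (V.obj ◁ μ F X Y ≫ (V.β (X ⊗ Y)).hom) ≫ F.obj (X ⊗ Y) ◁ i := by
        rw [MonoidalCategory.whisker_exchange, V.monoidal]; monoidal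
    _ = _ := by
        rw [Category.assoc, ← h, MonoidalCategory.whisker_exchange_assoc]

end Transfer

section Limits

variable {J : Type w} [Category.{v} J] (K : J ⥤ Centralizer F)

/-- The half-braidings of a diagram in the centralizer, as an isomorphism of diagrams. -/
def diagramβ (X : C) : (K ⋙ forget F) ⋙ tensorRight (F.obj X) ≅
    (K ⋙ forget F) ⋙ tensorLeft (F.obj X) :=
  NatIso.ofComponents (fun j => (K.obj j).β X) (fun f => (K.map f).comm X)

section

variable {c : Cone (K ⋙ forget F)} [∀ X : C, PreservesLimitsOfShape J (tensorLeft (F.obj X))]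

lemma limit_hom_ext (hc : IsLimit c) {Z : D} {X : C} {f g : Z ⟶ F.obj X ⊗ c.pt}
    (h : ∀ j, f ≫ F.obj X ◁ c.π.app j = g ≫ F.obj X ◁ c.π.app j) : f = g :=
  (isLimitOfPreserves (tensorLeft (F.obj X)) hc).hom_ext h

variable [∀ X : C, PreservesLimitsOfShape J (tensorRight (F.obj X))]

/-- The half-braiding on the limit of the underlying objects of a diagram in the centralizer. -/
def limitβ (hc : IsLimit c) (X : C) : c.pt ⊗ F.obj X ≅ F.obj X ⊗ c.pt :=
  IsLimit.conePointsIsoOfNatIso (isLimitOfPreserves (tensorRight (F.obj X)) hc)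
    (isLimitOfPreserves (tensorLeft (F.obj X)) hc) (diagramβ K X)

lemma limitβ_hom_π (hc : IsLimit c) (X : C) (j : J) : (limitβ K hc X).hom ≫ F.obj X ◁ c.π.app j =
    c.π.app j ▷ F.obj X ≫ ((K.obj j).β X).hom :=
  IsLimit.conePointsIsoOfNatIso_hom_comp (isLimitOfPreserves (tensorRight (F.obj X)) hc)
    (isLimitOfPreserves (tensorLeft (F.obj X)) hc) (diagramβ K X) j

/-- The limit in the centralizer. -/
def limitObj (hc : IsLimit c) : Centralizer F where
  obj := c.pt
  β := limitβ K hc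
  naturality g := limit_hom_ext K hc fun j =>
    naturality_of_comp (K.obj j) (fun X => (limitβ K hc X).hom) (c.π.app j)
      (fun X => limitβ_hom_π K hc X j) g
  monoidal X Y := limit_hom_ext K hc fun j =>
    monoidal_of_comp (K.obj j) (fun X => (limitβ K hc X).hom) (c.π.app j)
      (fun X => limitβ_hom_π K hc X j) X Y

/-- The limit cone in the centralizer. -/
def limitCone (hc : IsLimit c) : Cone K where
  pt := limitObj K hc
  π :=
    { app j := ⟨c.π.app j, fun X => (limitβ_hom_π K hc X j).symm⟩
      naturality _ _ f := hom_ext (c.π.naturality f) }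

/-- The lift of underlying objects commutes with the half-braidings, because this can be tested
after projection to the diagram. -/
def isLimitLimitCone (hc : IsLimit c) : IsLimit (limitCone K hc) where
  lift s := ⟨hc.lift ((forget F).mapCone s), fun X => limit_hom_ext K hc fun j => by
    have h : hc.lift ((forget F).mapCone s) ≫ c.π.app j = (s.π.app j).hom := hc.fac _ j
    have h' : hc.lift ((forget F).mapCone s) ▷ F.obj X ≫ c.π.app j ▷ F.obj X =
      (s.π.app j).hom ▷ F.obj X := by rw [← comp_whiskerRight, h]; rfl
    have h'' : F.obj X ◁ hc.lift ((forget F).mapCone s) ≫ F.obj X ◁ c.π.app j =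
      F.obj X ◁ (s.π.app j).hom := by rw [← whiskerLeft_comp, h]; rfl
    refine (Category.assoc _ _ _).trans ((congrArg (_ ≫ ·) (limitβ_hom_π K hc X j)).trans ?_)
    refine ((Category.assoc _ _ _).symm.trans (congrArg (· ≫ _) h')).trans ?_
    refine ((s.π.app j).comm X).trans ?_
    exact (congrArg (_ ≫ ·) h''.symm).trans (Category.assoc _ _ _).symm⟩
  fac s j := hom_ext (hc.fac ((forget F).mapCone s) j)
  uniq s m hm := hom_ext (hc.uniq ((forget F).mapCone s) m.hom fun j => congrArg Hom.hom (hm j))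

lemma hasLimitsOfShape [HasLimitsOfShape J D] : HasLimitsOfShape J (Centralizer F) where
  has_limit K := ⟨⟨⟨_, isLimitLimitCone K (limit.isLimit (K ⋙ forget F))⟩⟩⟩

lemma preservesLimitsOfShape_forget [HasLimitsOfShape J D] :
    PreservesLimitsOfShape J (forget F) where
  preservesLimit {K} := preservesLimit_of_preserves_limit_cone
    (isLimitLimitCone K (limit.isLimit (K ⋙ forget F)))
    (IsLimit.ofIsoLimit (limit.isLimit (K ⋙ forget F))
      (Cone.ext (Iso.refl _) fun _ => (Category.id_comp _).symm))

end

section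

variable {c : Cocone (K ⋙ forget F)} [∀ Y : D, PreservesColimitsOfShape J (tensorRight Y)]

lemma colimit_hom_ext (hc : IsColimit c) {Z : D} {X : C} {f g : c.pt ⊗ F.obj X ⟶ Z}
    (h : ∀ j, c.ι.app j ▷ F.obj X ≫ f = c.ι.app j ▷ F.obj X ≫ g) : f = g :=
  (isColimitOfPreserves (tensorRight (F.obj X)) hc).hom_ext h

variable [∀ X : C, PreservesColimitsOfShape J (tensorLeft (F.obj X))]

/-- The half-braiding on the colimit of the underlying objects of a diagram in the centralizer. -/
def colimitβ (hc : IsColimit c) (X : C) : c.pt ⊗ F.obj X ≅ F.obj X ⊗ c.pt :=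
  IsColimit.coconePointsIsoOfNatIso (isColimitOfPreserves (tensorRight (F.obj X)) hc)
    (isColimitOfPreserves (tensorLeft (F.obj X)) hc) (diagramβ K X)

lemma ι_colimitβ_hom (hc : IsColimit c) (X : C) (j : J) :
    c.ι.app j ▷ F.obj X ≫ (colimitβ K hc X).hom =
      ((K.obj j).β X).hom ≫ F.obj X ◁ c.ι.app j :=
  IsColimit.comp_coconePointsIsoOfNatIso_hom (isColimitOfPreserves (tensorRight (F.obj X)) hc)
    (isColimitOfPreserves (tensorLeft (F.obj X)) hc) (diagramβ K X) j

/-- The colimit in the centralizer. -/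
def colimitObj (hc : IsColimit c) : Centralizer F where
  obj := c.pt
  β := colimitβ K hc
  naturality g := colimit_hom_ext K hc fun j =>
    comp_naturality (K.obj j) (fun X => (colimitβ K hc X).hom) (c.ι.app j)
      (fun X => ι_colimitβ_hom K hc X j) g
  monoidal X Y := (isColimitOfPreserves (tensorRight (F.obj X ⊗ F.obj Y)) hc).hom_ext fun j =>
    comp_monoidal (K.obj j) (fun X => (colimitβ K hc X).hom) (c.ι.app j)
      (fun X => ι_colimitβ_hom K hc X j) X Y

/-- The colimit cocone in the centralizer. -/
def colimitCocone (hc : IsColimit c) : Cocone K where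
  pt := colimitObj K hc
  ι :=
    { app j := ⟨c.ι.app j, fun X => ι_colimitβ_hom K hc X j⟩
      naturality _ _ f := hom_ext (c.ι.naturality f) }

/-- The descent of underlying objects commutes with the half-braidings, because this can be tested
after precomposition with the inclusions of the diagram. -/
def isColimitColimitCocone (hc : IsColimit c) : IsColimit (colimitCocone K hc) where
  desc s := ⟨hc.desc ((forget F).mapCocone s), fun X => colimit_hom_ext K hc fun j => by
    have h : c.ι.app j ≫ hc.desc ((forget F).mapCocone s) = (s.ι.app j).hom := hc.fac _ j
    have h' : c.ι.app j ▷ F.obj X ≫ hc.desc ((forget F).mapCocone s) ▷ F.obj X =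
      (s.ι.app j).hom ▷ F.obj X := by rw [← comp_whiskerRight, h]; rfl
    have h'' : F.obj X ◁ c.ι.app j ≫ F.obj X ◁ hc.desc ((forget F).mapCocone s) =
      F.obj X ◁ (s.ι.app j).hom := by rw [← whiskerLeft_comp, h]; rfl
    refine ((Category.assoc _ _ _).symm.trans (congrArg (· ≫ _) h')).trans ?_
    refine ((s.ι.app j).comm X).trans ((congrArg (_ ≫ ·) h''.symm).trans ?_)
    refine (Category.assoc _ _ _).symm.trans ?_
    exact (congrArg (· ≫ _) (ι_colimitβ_hom K hc X j).symm).trans (Category.assoc _ _ _)⟩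
  fac s j := hom_ext (hc.fac ((forget F).mapCocone s) j)
  uniq s m hm := hom_ext (hc.uniq ((forget F).mapCocone s) m.hom fun j => congrArg Hom.hom (hm j))

lemma hasColimitsOfShape [HasColimitsOfShape J D] : HasColimitsOfShape J (Centralizer F) where
  has_colimit K := ⟨⟨⟨_, isColimitColimitCocone K (colimit.isColimit (K ⋙ forget F))⟩⟩⟩

lemma preservesColimitsOfShape_forget [HasColimitsOfShape J D] :
    PreservesColimitsOfShape J (forget F) where
  preservesColimit {K} := preservesColimit_of_preserves_colimit_cocone
    (isColimitColimitCocone K (colimit.isColimit (K ⋙ forget F)))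
    (IsColimit.ofIsoColimit (colimit.isColimit (K ⋙ forget F))
      (Cocone.ext (Iso.refl _) fun _ => Category.comp_id _))

end

end Limits

section Abelian

lemma hasFiniteColimits [HasFiniteColimits D]
    (hDl : ∀ Y : D, PreservesFiniteColimits (tensorLeft Y))
    (hDr : ∀ Y : D, PreservesFiniteColimits (tensorRight Y)) :
    HasFiniteColimits (Centralizer F) where
  out _ _ _ := hasColimitsOfShape

lemma preservesFiniteColimits_forget [HasFiniteColimits D]
    (hDl : ∀ Y : D, PreservesFiniteColimits (tensorLeft Y))
    (hDr : ∀ Y : D, PreservesFiniteColimits (tensorRight Y)) :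
    PreservesFiniteColimits (forget F) where
  preservesFiniteColimits _ _ _ := preservesColimitsOfShape_forget

variable [RigidCategory C]

variable (F) in
lemma preservesLimitsOfSize_tensorLeft (X : C) :
    PreservesLimitsOfSize.{v, w} (tensorLeft (F.obj X)) :=
  letI := mapExactPairing F X (Xᘁ)
  (tensorLeftAdjunction (F.obj X) (F.obj (Xᘁ))).rightAdjoint_preservesLimits

variable (F) in
lemma preservesLimitsOfSize_tensorRight (X : C) :
    PreservesLimitsOfSize.{v, w} (tensorRight (F.obj X)) :=
  letI := mapExactPairing F (ᘁX) X
  (tensorRightAdjunction (F.obj (ᘁX)) (F.obj X)).rightAdjoint_preservesLimits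

lemma hasFiniteLimits [HasFiniteLimits D] : HasFiniteLimits (Centralizer F) where
  out _ _ _ :=
    haveI := fun X => preservesLimitsOfSize_tensorLeft.{0, 0} F X
    haveI := fun X => preservesLimitsOfSize_tensorRight.{0, 0} F X
    hasLimitsOfShape

lemma preservesFiniteLimits_forget [HasFiniteLimits D] : PreservesFiniteLimits (forget F) where
  preservesFiniteLimits _ _ _ :=
    haveI := fun X => preservesLimitsOfSize_tensorLeft.{0, 0} F X
    haveI := fun X => preservesLimitsOfSize_tensorRight.{0, 0} F X
    preservesLimitsOfShape_forget

end Abelian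

/-- The centralizer is abelian: kernels and cokernels are created by the forgetful functor, so the
comparison of the coimage with the image is an isomorphism because it is one in the target. -/
@[reducible]
def abelian {C : Type u₁} [Category.{v₁} C] [MonoidalCategory C] [RigidCategory C]
    {D : Type u₂} [Category.{v₂} D] [Abelian D] [MonoidalCategory D] [MonoidalPreadditive D]
    (F : C ⥤ D) [F.Monoidal]
    (hDl : ∀ Y : D, PreservesFiniteColimits (tensorLeft Y))
    (hDr : ∀ Y : D, PreservesFiniteColimits (tensorRight Y)) : Abelian (Centralizer F) :=
  haveI := hasFiniteLimits (F := F)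
  haveI := hasFiniteColimits (F := F) hDl hDr
  haveI := preservesFiniteLimits_forget (F := F)
  haveI := preservesFiniteColimits_forget (F := F) hDl hDr
  haveI : ∀ {V W : Centralizer F} (f : V ⟶ W), IsIso (Abelian.coimageImageComparison f) :=
    fun f =>
      haveI := IsIso.of_isIso_fac_right
        (Abelian.PreservesCoimage.hom_coimageImageComparison (forget F) f).symm
      isIso_of_reflects_iso _ (forget F)
  Abelian.ofCoimageImageComparisonIsIso

end Centralizer

/-! ### Finite generators and extension of natural transformations -/

section Generator

variable (k : Type w) [Field k] {C : Type u₁} [Category.{v₁} C]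

/-- An object `P` of a `k`-linear category is a finite generator if the functor `Hom(P, -)` is
faithful with finite-dimensional values. -/
structure IsFiniteGenerator [Preadditive C] [Linear k C] (P : C) : Prop where
  isSeparator : IsSeparator P
  finite : ∀ X : C, Module.Finite k (P ⟶ X)

open ModuleCat in
lemma isFiniteGenerator_of_self (R : Type w) [Ring R] [Algebra k R] [Module.Finite k R] :
    IsFiniteGenerator k (FGModuleCat.of R R) where
  isSeparator := (isSeparator_def _).2 fun X Y f g h => by
    ext x
    have := congrArg (fun φ => φ.hom.hom (1 : R))
      (h (FGModuleCat.ofHom (LinearMap.toSpanSingleton R X x)))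
    change f.hom.hom ((1 : R) • x) = g.hom.hom ((1 : R) • x) at this
    rwa [one_smul] at this
  finite X := by
    have : Module.Finite k X.obj := Module.Finite.trans R _
    let e : (FGModuleCat.of R R ⟶ X) →ₗ[k] X.obj :=
      { toFun f := f.hom.hom (1 : R)
        map_add' _ _ := rfl
        map_smul' _ _ := rfl }
    refine Module.Finite.of_injective e fun f g h => ?_
    ext
    exact h

/-- A finite `k`-linear category has a finite generator, corresponding to the regular module. -/
lemma IsFiniteLinear.exists_isFiniteGenerator [Preadditive C] [Linear k C]
    (hC : IsFiniteLinear k C) : ∃ P : C, IsFiniteGenerator k P := by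
  obtain ⟨R, _, _, _, E, _, _⟩ := hC
  have hR := isFiniteGenerator_of_self k R
  refine ⟨E.inverse.obj (FGModuleCat.of R R), hR.isSeparator.of_equivalence E.symm, fun X => ?_⟩
  have := hR.finite (E.functor.obj X)
  let e : (E.inverse.obj (FGModuleCat.of R R) ⟶ X) →ₗ[k] (FGModuleCat.of R R ⟶ E.functor.obj X) :=
    (Linear.leftComp k _ (E.counitInv.app _)).comp (E.functor.mapLinearMap k)
  refine Module.Finite.of_injective e fun f g h => E.functor.map_injective ?_
  exact (cancel_epi (E.counitInv.app _)).1 h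

end Generator

section Extension

variable {k : Type w} [Field k] {C : Type u₁} [Category.{v₁} C] [Abelian C] [Linear k C]
  {D : Type u₂} [Category.{v₂} D] [Abelian D]
  {P : C}

attribute [local instance] Abelian.hasFiniteBiproducts

/-- A spanning family of `Hom(P, X)` exhibits `X` as a quotient of a finite power of `P`. -/
lemma IsFiniteGenerator.exists_cover (hP : IsFiniteGenerator k P) (X : C) :
    ∃ (n : ℕ) (p : Fin n → (P ⟶ X)),
    Submodule.span k (Set.range p) = ⊤ ∧ Epi (biproduct.desc p) := by
  have := hP.finite X
  obtain ⟨n, p, hp⟩ := Module.Finite.exists_fin (R := k) (M := P ⟶ X)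
  refine ⟨n, p, hp, ⟨fun {Z} a b hab => hP.isSeparator.def a b fun f => ?_⟩⟩
  have hf : f ∈ Submodule.span k (Set.range p) := hp ▸ Submodule.mem_top
  have hle : Submodule.span k (Set.range p) ≤
      LinearMap.eqLocus (Linear.rightComp k P a) (Linear.rightComp k P b) := by
    rw [Submodule.span_le]
    rintro _ ⟨i, rfl⟩
    change p i ≫ a = p i ≫ b
    rw [← biproduct.ι_desc p i, Category.assoc, hab, Category.assoc]
  exact hle hf

variable (H : C ⥤ D) [H.Additive]

lemma map_biproduct_desc {n : ℕ} {X : C} (p : Fin n → (P ⟶ X)) :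
    H.map (biproduct.desc p) = ∑ i, H.map (biproduct.π _ i) ≫ H.map (p i) := by
  rw [biproduct.desc_eq, H.map_sum]
  simp

variable [PreservesFiniteColimits H]

/-- The images of the morphisms from a finite generator under a right exact functor are jointly
epimorphic. -/
lemma IsFiniteGenerator.map_hom_ext (hP : IsFiniteGenerator k P) {X : C} {Z : D} {a b : H.obj X ⟶ Z}
    (h : ∀ f : P ⟶ X, H.map f ≫ a = H.map f ≫ b) : a = b := by
  obtain ⟨n, p, -, _⟩ := hP.exists_cover X
  rw [← cancel_epi (H.map (biproduct.desc p)), map_biproduct_desc]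
  simp [Preadditive.sum_comp, h]

variable (K : C ⥤ D)

lemma IsFiniteGenerator.natTrans_ext (hP : IsFiniteGenerator k P) {s t : H ⟶ K}
    (h : s.app P = t.app P) : s = t := by
  ext X
  exact hP.map_hom_ext H fun f => by rw [s.naturality, t.naturality, h]

variable [K.Additive] [Linear k D] [H.Linear k] [K.Linear k]

/-- The component at `X` of the extension in `IsFiniteGenerator.exists_extension`. -/
lemma IsFiniteGenerator.exists_extension_app (hP : IsFiniteGenerator k P)
    (h : H.obj P ⟶ K.obj P)
    (hh : ∀ r : P ⟶ P, H.map r ≫ h = h ≫ K.map r) (X : C) :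
    ∃ t : H.obj X ⟶ K.obj X, ∀ f : P ⟶ X, H.map f ≫ t = h ≫ K.map f := by
  obtain ⟨n, p, hp, _⟩ := hP.exists_cover X
  -- `φ` is the required morphism precomposed with `H(Pⁿ) ⟶ H(X)`; it factors through `H(X)`, which
  -- is the cokernel of `H` of the kernel because `H` is right exact.
  let φ : H.obj (⨁ fun _ : Fin n => P) ⟶ K.obj X := ∑ i, H.map (biproduct.π _ i) ≫ h ≫ K.map (p i)
  have hφ (g : P ⟶ ⨁ fun _ : Fin n => P) :
      H.map g ≫ φ = h ≫ K.map (g ≫ biproduct.desc p) := by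
    simp only [φ, biproduct.desc_eq, Preadditive.comp_sum, K.map_sum]
    refine Finset.sum_congr rfl fun i _ => ?_
    rw [← H.map_comp_assoc, reassoc_of% hh, ← K.map_comp, Category.assoc]
  have hker : H.map (kernel.ι (biproduct.desc p)) ≫ φ = 0 := by
    refine hP.map_hom_ext H fun f => ?_
    rw [← H.map_comp_assoc, hφ, Category.assoc, kernel.condition]
    simp
  have hc := Abelian.epiIsCokernelOfKernel _ (kernelIsKernel (biproduct.desc p))
  obtain ⟨t, ht⟩ : ∃ t : H.obj X ⟶ K.obj X, H.map (biproduct.desc p) ≫ t = φ :=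
    let l := CokernelCofork.IsColimit.desc' (CokernelCofork.mapIsColimit _ hc H) φ hker
    ⟨l.1, l.2⟩
  refine ⟨t, fun f => ?_⟩
  have hf : f ∈ Submodule.span k (Set.range p) := hp ▸ Submodule.mem_top
  have hle : Submodule.span k (Set.range p) ≤
      LinearMap.eqLocus ((Linear.rightComp k _ t).comp (H.mapLinearMap k))
        ((Linear.leftComp k _ h).comp (K.mapLinearMap k)) := by
    rw [Submodule.span_le]
    rintro _ ⟨i, rfl⟩
    change H.map (p i) ≫ t = h ≫ K.map (p i)
    rw [← biproduct.ι_desc p i, H.map_comp, Category.assoc, ht, hφ]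
  exact hle hf

/-- A morphism `H(P) ⟶ K(P)` that commutes with the endomorphisms of a finite generator `P` extends
to a natural transformation `H ⟶ K` if `H` is right exact. -/
lemma IsFiniteGenerator.exists_extension (hP : IsFiniteGenerator k P)
    (h : H.obj P ⟶ K.obj P)
    (hh : ∀ r : P ⟶ P, H.map r ≫ h = h ≫ K.map r) :
    ∃ t : H ⟶ K, t.app P = h := by
  choose t ht using hP.exists_extension_app H K h hh
  refine ⟨{ app := t, naturality := fun X Y g => hP.map_hom_ext H fun f => ?_ }, ?_⟩
  · rw [← H.map_comp_assoc, ht, ← Category.assoc, ht, Category.assoc, ← K.map_comp]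
  · simpa using ht P (𝟙 P)

end Extension

/-! ### Universal natural transformations -/

section Universal

variable {C : Type u₁} [Category.{v₁} C]
  {D : Type u₂} [Category.{v₂} D] [MonoidalCategory D]

/-- A natural transformation `τ : V ⊗ F(-) ⟶ F(-) ⊗ T` is universal if every natural transformation
`V ⊗ F(-) ⟶ F(-) ⊗ B` factors uniquely through it; then `T` is the coend of `F(X)ᘁ ⊗ V ⊗ F(X)`. -/
structure IsUniversal (F : C ⥤ D) {V T : D} (τ : ∀ X : C, V ⊗ F.obj X ⟶ F.obj X ⊗ T) : Prop where
  naturality : ∀ {X Y : C} (f : X ⟶ Y), V ◁ F.map f ≫ τ Y = τ X ≫ F.map f ▷ T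
  existsUnique : ∀ {B : D} (σ : ∀ X : C, V ⊗ F.obj X ⟶ F.obj X ⊗ B),
    (∀ {X Y : C} (f : X ⟶ Y), V ◁ F.map f ≫ σ Y = σ X ≫ F.map f ▷ B) →
      ∃! g : T ⟶ B, ∀ X : C, τ X ≫ F.obj X ◁ g = σ X

/-- The universal natural transformations exist: `T` is the cokernel of the difference of the two
actions of `End(P)` on `F(P)ᘁ ⊗ V ⊗ F(P)`, for a finite generator `P`. -/
lemma exists_isUniversal {k : Type w} [Field k]
    {C : Type u₁} [Category.{v₁} C] [Abelian C] [Linear k C] [MonoidalCategory C] [RigidCategory C]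
    {D : Type u₂} [Category.{v₂} D] [Abelian D] [Linear k D]
    [MonoidalCategory D] [MonoidalPreadditive D] [MonoidalLinear k D]
    {P : C} (hP : IsFiniteGenerator k P)
    (hDl : ∀ Y : D, PreservesFiniteColimits (tensorLeft Y))
    (F : C ⥤ D) [F.Additive] [F.Linear k] [F.Monoidal] [PreservesFiniteColimits F] (V : D) :
    ∃ (T : D) (τ : ∀ X : C, V ⊗ F.obj X ⟶ F.obj X ⊗ T), IsUniversal F τ := by
  let _ := mapExactPairing F P (Pᘁ)
  let _ : HasFiniteBiproducts D := Abelian.hasFiniteBiproducts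
  let Q : D := F.obj (Pᘁ) ⊗ V ⊗ F.obj P
  -- By duality, morphisms `V ⊗ F P ⟶ F P ⊗ B` are morphisms `Q ⟶ B`, with universal element `c`.
  let e (B : D) : (Q ⟶ B) ≃ (V ⊗ F.obj P ⟶ F.obj P ⊗ B) := tensorLeftHomEquiv _ _ _ _
  let c : V ⊗ F.obj P ⟶ F.obj P ⊗ Q := e Q (𝟙 Q)
  have he {B : D} (g : Q ⟶ B) : e B g = c ≫ F.obj P ◁ g := by
    rw [← tensorLeftHomEquiv_naturality, Category.id_comp]
  -- `a r` is the relation that forces commutation with the endomorphism `r`.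
  let a (r : P ⟶ P) : Q ⟶ Q := (e Q).symm (V ◁ F.map r ≫ c - c ≫ F.map r ▷ Q)
  have ha (r : P ⟶ P) {B : D} (g : Q ⟶ B) :
      V ◁ F.map r ≫ (c ≫ F.obj P ◁ g) = (c ≫ F.obj P ◁ g) ≫ F.map r ▷ B ↔ a r ≫ g = 0 := by
    have h1 : e B (a r ≫ g) = V ◁ F.map r ≫ (c ≫ F.obj P ◁ g) -
        (c ≫ F.obj P ◁ g) ≫ F.map r ▷ B := by
      rw [tensorLeftHomEquiv_naturality, Equiv.apply_symm_apply, Preadditive.sub_comp]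
      simp only [Category.assoc]
      rw [MonoidalCategory.whisker_exchange]
    have h0 : e B 0 = 0 := by
      rw [he, MonoidalPreadditive.whiskerLeft_zero, comp_zero]
    rw [← sub_eq_zero, ← h1, ← h0, (e B).apply_eq_iff_eq]
  have := hP.finite P
  obtain ⟨n, r, hr⟩ := Module.Finite.exists_fin (R := k) (M := P ⟶ P)
  let d : (⨁ fun _ : Fin n => Q) ⟶ Q := biproduct.desc fun i => a (r i)
  -- `c ≫ F P ◁ g` commutes with `End P` as soon as `g` vanishes on the relations.
  have hd {B : D} (g : Q ⟶ B) (hg : d ≫ g = 0) (s : P ⟶ P) :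
      V ◁ F.map s ≫ (c ≫ F.obj P ◁ g) = (c ≫ F.obj P ◁ g) ≫ F.map s ▷ B := by
    have hs : s ∈ Submodule.span k (Set.range r) := hr ▸ Submodule.mem_top
    have hle : Submodule.span k (Set.range r) ≤
        LinearMap.eqLocus
          ((Linear.rightComp k _ (c ≫ F.obj P ◁ g)).comp ((F ⋙ tensorLeft V).mapLinearMap k))
          ((Linear.leftComp k _ (c ≫ F.obj P ◁ g)).comp ((F ⋙ tensorRight B).mapLinearMap k)) := by
      rw [Submodule.span_le]
      rintro _ ⟨i, rfl⟩
      refine (ha (r i) g).2 ?_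
      have := congrArg (fun z => biproduct.ι _ i ≫ z) hg
      simpa [d] using this
    exact hle hs
  obtain ⟨τ, hτ⟩ := hP.exists_extension (F ⋙ tensorLeft V) (F ⋙ tensorRight (cokernel d))
    (c ≫ F.obj P ◁ cokernel.π d) (hd _ (cokernel.condition d))
  refine ⟨cokernel d, τ.app, fun f => τ.naturality f, fun {B} σ' hσ' => ?_⟩
  let σ : F ⋙ tensorLeft V ⟶ F ⋙ tensorRight B := ⟨σ', fun _ _ f => hσ' f⟩
  have hσ : σ.app P = c ≫ F.obj P ◁ (e B).symm (σ.app P) := by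
    rw [← he, Equiv.apply_symm_apply]
  have hdσ : d ≫ (e B).symm (σ.app P) = 0 := by
    ext i
    have h1 : a (r i) ≫ (e B).symm (σ.app P) = 0 := by
      rw [← ha, ← hσ]
      exact σ.naturality (r i)
    simp [d, h1]
  have key (g : cokernel d ⟶ B) : (∀ X : C, τ.app X ≫ F.obj X ◁ g = σ.app X) ↔
      cokernel.π d ≫ g = (e B).symm (σ.app P) := by
    have h1 : (τ.app P ≫ F.obj P ◁ g = σ.app P) ↔ cokernel.π d ≫ g = (e B).symm (σ.app P) := by
      rw [← (e B).apply_eq_iff_eq, Equiv.apply_symm_apply, he, hτ]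
      simp
    rw [← h1]
    refine ⟨fun h => h P, fun h X => ?_⟩
    let ψ : F ⋙ tensorRight (cokernel d) ⟶ F ⋙ tensorRight B :=
      { app X := F.obj X ◁ g
        naturality X Y f := (MonoidalCategory.whisker_exchange _ _).symm }
    have : τ ≫ ψ = σ := hP.natTrans_ext _ _ h
    exact congrArg (fun s => s.app X) this
  refine ⟨cokernel.desc d _ hdσ, (key _).2 (cokernel.π_desc _ _ _), fun g hg => ?_⟩
  rw [← cancel_epi (cokernel.π d), (key g).1 hg, cokernel.π_desc]

end Universal

/-! ### Free objects of the centralizer -/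

section FreeObject

variable {C : Type u₁} [Category.{v₁} C]
  {D : Type u₂} [Category.{v₂} D] [MonoidalCategory D]

lemma tensorRightHomEquiv_whiskerLeft {A B S S' T : D} [ExactPairing S S'] (g : T ⊗ S ⟶ B) :
    tensorRightHomEquiv (A ⊗ T) S S' (A ⊗ B) ((α_ A T S).hom ≫ A ◁ g) =
      A ◁ tensorRightHomEquiv T S S' B g ≫ (α_ A B S').inv := by
  simp only [tensorRightHomEquiv, Equiv.coe_fn_mk]
  monoidal

lemma tensorRightHomEquiv_whiskerRight_comp {A A' S S' B : D} [ExactPairing S S'] (t : A ⟶ A')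
    (f : A' ⊗ S ⟶ B) :
    tensorRightHomEquiv A S S' B (t ▷ S ≫ f) = t ≫ tensorRightHomEquiv A' S S' B f := by
  rw [← Equiv.eq_symm_apply, tensorRightHomEquiv_symm_naturality, Equiv.symm_apply_apply]

variable {F : C ⥤ D} {V T : D} {τ : ∀ X : C, V ⊗ F.obj X ⟶ F.obj X ⊗ T}

namespace IsUniversal

lemma hom_ext (hτ : IsUniversal F τ) {B : D} {g g' : T ⟶ B}
    (h : ∀ X, τ X ≫ F.obj X ◁ g = τ X ≫ F.obj X ◁ g') : g = g' :=
  (hτ.existsUnique (fun X => τ X ≫ F.obj X ◁ g) fun f => by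
    rw [reassoc_of% (hτ.naturality f), Category.assoc, MonoidalCategory.whisker_exchange]).unique
      (fun _ => rfl) fun X => (h X).symm

/-- The universal property of `T` tensored with an object `S` that has a dual. -/
lemma exists_tensor (hτ : IsUniversal F τ) (S S' : D) [ExactPairing S S'] {B : D}
    (σ : ∀ X : C, V ⊗ (F.obj X ⊗ S) ⟶ F.obj X ⊗ B)
    (hσ : ∀ {X Y : C} (f : X ⟶ Y), V ◁ (F.map f ▷ S) ≫ σ Y = σ X ≫ F.map f ▷ B) :
    ∃ g : T ⊗ S ⟶ B, ∀ X : C,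
      τ X ▷ S ≫ (α_ (F.obj X) T S).hom ≫ F.obj X ◁ g = (α_ V (F.obj X) S).hom ≫ σ X := by
  obtain ⟨g, hg, -⟩ := hτ.existsUnique (B := B ⊗ S')
    (fun X => tensorRightHomEquiv (V ⊗ F.obj X) S S' (F.obj X ⊗ B)
        ((α_ V (F.obj X) S).hom ≫ σ X) ≫
        (α_ (F.obj X) B S').hom) fun {X Y} f => by
      rw [← Category.assoc, ← tensorRightHomEquiv_whiskerRight_comp,
        associator_naturality_middle_assoc, hσ, ← Category.assoc,
        tensorRightHomEquiv_naturality, Category.assoc, associator_naturality_left,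
        Category.assoc]
  refine ⟨(tensorRightHomEquiv T S S' B).symm g, fun X => ?_⟩
  rw [← (tensorRightHomEquiv _ S S' _).apply_eq_iff_eq, tensorRightHomEquiv_whiskerRight_comp,
    tensorRightHomEquiv_whiskerLeft, Equiv.apply_symm_apply, reassoc_of% (hg X), Iso.hom_inv_id,
    Category.comp_id]

lemma tensor_hom_ext (hτ : IsUniversal F τ) (S S' : D) [ExactPairing S S'] {B : D}
    {g g' : T ⊗ S ⟶ B}
    (h : ∀ X : C, τ X ▷ S ≫ (α_ (F.obj X) T S).hom ≫ F.obj X ◁ g =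
      τ X ▷ S ≫ (α_ (F.obj X) T S).hom ≫ F.obj X ◁ g') : g = g' := by
  refine (tensorRightHomEquiv T S S' B).injective (hτ.hom_ext fun X => ?_)
  have := congrArg (tensorRightHomEquiv _ S S' _) (h X)
  rwa [tensorRightHomEquiv_whiskerRight_comp, tensorRightHomEquiv_whiskerRight_comp,
    tensorRightHomEquiv_whiskerLeft, tensorRightHomEquiv_whiskerLeft, ← Category.assoc,
    ← Category.assoc, cancel_mono] at this

variable [MonoidalCategory C] [F.Monoidal]

/-- The transformation `V ⊗ F(-) ⊗ F(Y) ⟶ F(-) ⊗ F(Y) ⊗ T` given by `τ` at `- ⊗ Y` factors through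
`T ⊗ F(Y)`. -/
lemma exists_σ [RightRigidCategory C] (hτ : IsUniversal F τ) (Y : C) :
    ∃ b : T ⊗ F.obj Y ⟶ F.obj Y ⊗ T, ∀ X : C,
      τ X ▷ F.obj Y ≫ (α_ _ _ _).hom ≫ F.obj X ◁ b ≫ (α_ _ _ _).inv ≫ μ F X Y ▷ T =
        (α_ V (F.obj X) (F.obj Y)).hom ≫ V ◁ μ F X Y ≫ τ (X ⊗ Y) := by
  let := mapExactPairing F Y (Yᘁ)
  obtain ⟨b, hb⟩ := hτ.exists_tensor (F.obj Y) (F.obj (Yᘁ)) (B := F.obj Y ⊗ T)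
    (fun X => V ◁ μ F X Y ≫ τ (X ⊗ Y) ≫ Functor.OplaxMonoidal.δ F X Y ▷ T ≫ (α_ _ _ _).hom)
    fun {X X'} f => by
      rw [← whiskerLeft_comp_assoc, μ_natural_left, whiskerLeft_comp_assoc,
        reassoc_of% (hτ.naturality (f ▷ Y)), ← comp_whiskerRight_assoc,
        ← Functor.OplaxMonoidal.δ_natural_left]
      monoidal
  refine ⟨b, fun X => ?_⟩
  rw [reassoc_of% (hb X)]
  simp

/-- The half-braiding on the universal object `T`, before its invertibility is established. -/
def σ [RightRigidCategory C] (hτ : IsUniversal F τ) (Y : C) : T ⊗ F.obj Y ⟶ F.obj Y ⊗ T :=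
  (hτ.exists_σ Y).choose

variable [RightRigidCategory C] (hτ : IsUniversal F τ)

/-- The defining property of the half-braiding on `T`. -/
lemma τ_comp_σ (X Y : C) :
    τ X ▷ F.obj Y ≫ (α_ _ _ _).hom ≫ F.obj X ◁ hτ.σ Y ≫ (α_ _ _ _).inv ≫ μ F X Y ▷ T =
      (α_ V (F.obj X) (F.obj Y)).hom ≫ V ◁ μ F X Y ≫ τ (X ⊗ Y) :=
  (hτ.exists_σ Y).choose_spec X

/-- Morphisms `T ⊗ F Y ⟶ F Z ⊗ B` are determined by their composites with `τ`. -/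
lemma tensor_map_hom_ext (hτ : IsUniversal F τ) {Y Z : C} {B : D}
    {g g' : T ⊗ F.obj Y ⟶ F.obj Z ⊗ B}
    (h : ∀ X : C,
      τ X ▷ F.obj Y ≫ (α_ _ _ _).hom ≫ F.obj X ◁ g ≫ (α_ _ _ _).inv ≫ μ F X Z ▷ B =
      τ X ▷ F.obj Y ≫ (α_ _ _ _).hom ≫ F.obj X ◁ g' ≫ (α_ _ _ _).inv ≫ μ F X Z ▷ B) :
    g = g' := by
  let := mapExactPairing F Y (Yᘁ)
  refine hτ.tensor_hom_ext (F.obj Y) (F.obj (Yᘁ)) fun X => ?_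
  rw [← cancel_mono ((α_ (F.obj X) (F.obj Z) B).inv ≫ μ F X Z ▷ B)]
  simpa only [Category.assoc] using h X

lemma σ_naturality {Y Z : C} (f : Y ⟶ Z) :
    T ◁ F.map f ≫ hτ.σ Z = hτ.σ Y ≫ F.map f ▷ T := by
  refine hτ.tensor_map_hom_ext fun X => ?_
  symm
  calc _ = (τ X ▷ F.obj Y ≫ (α_ _ _ _).hom ≫ F.obj X ◁ hτ.σ Y ≫ (α_ _ _ _).inv) ≫
        (F.obj X ◁ F.map f ≫ μ F X Z) ▷ T := by monoidal
    _ = (τ X ▷ F.obj Y ≫ (α_ _ _ _).hom ≫ F.obj X ◁ hτ.σ Y ≫ (α_ _ _ _).inv ≫ μ F X Y ▷ T) ≫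
        F.map (X ◁ f) ▷ T := by rw [μ_natural_right]; monoidal
    _ = 𝟙 _ ⊗≫ V ◁ (F.obj X ◁ F.map f ≫ μ F X Z) ≫ τ (X ⊗ Z) := by
        rw [hτ.τ_comp_σ, Category.assoc, Category.assoc, ← hτ.naturality, μ_natural_right]
        monoidal
    _ = (V ⊗ F.obj X) ◁ F.map f ≫ (α_ _ _ _).hom ≫ V ◁ μ F X Z ≫ τ (X ⊗ Z) := by monoidal
    _ = ((V ⊗ F.obj X) ◁ F.map f ≫ τ X ▷ F.obj Z) ≫ (α_ _ _ _).hom ≫ F.obj X ◁ hτ.σ Z ≫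
        (α_ _ _ _).inv ≫ μ F X Z ▷ T := by rw [← hτ.τ_comp_σ, Category.assoc]
    _ = _ := by rw [MonoidalCategory.whisker_exchange]; monoidal

lemma σ_monoidal (Y Z : C) : T ◁ μ F Y Z ≫ hτ.σ (Y ⊗ Z) =
    (α_ T (F.obj Y) (F.obj Z)).inv ≫ hτ.σ Y ▷ F.obj Z ≫ (α_ (F.obj Y) T (F.obj Z)).hom ≫
      F.obj Y ◁ hτ.σ Z ≫ (α_ (F.obj Y) (F.obj Z) T).inv ≫ μ F Y Z ▷ T := by
  rw [← cancel_epi (T ◁ Functor.OplaxMonoidal.δ F Y Z), Functor.Monoidal.whiskerLeft_δ_μ_assoc]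
  refine hτ.tensor_map_hom_ext fun X => ?_
  symm
  calc _ = 𝟙 _ ⊗≫ (τ X ▷ F.obj (Y ⊗ Z) ≫ (F.obj X ⊗ T) ◁ Functor.OplaxMonoidal.δ F Y Z) ⊗≫
        F.obj X ◁ hτ.σ Y ▷ F.obj Z ⊗≫ F.obj X ◁ F.obj Y ◁ hτ.σ Z ⊗≫
        ((α_ _ _ _).hom ≫ F.obj X ◁ μ F Y Z ≫ μ F X (Y ⊗ Z)) ▷ T := by monoidal
    _ = 𝟙 _ ⊗≫ (V ⊗ F.obj X) ◁ Functor.OplaxMonoidal.δ F Y Z ⊗≫ τ X ▷ F.obj Y ▷ F.obj Z ⊗≫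
        F.obj X ◁ hτ.σ Y ▷ F.obj Z ⊗≫
        ((F.obj X ⊗ F.obj Y) ◁ hτ.σ Z ≫ μ F X Y ▷ (F.obj Z ⊗ T)) ⊗≫
        (μ F (X ⊗ Y) Z ≫ F.map (α_ X Y Z).hom) ▷ T := by
          rw [← associativity, ← MonoidalCategory.whisker_exchange]; monoidal
    _ = 𝟙 _ ⊗≫ (V ⊗ F.obj X) ◁ Functor.OplaxMonoidal.δ F Y Z ⊗≫
        (τ X ▷ F.obj Y ≫ (α_ _ _ _).hom ≫ F.obj X ◁ hτ.σ Y ≫ (α_ _ _ _).inv ≫ μ F X Y ▷ T) ▷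
          F.obj Z ⊗≫ F.obj (X ⊗ Y) ◁ hτ.σ Z ⊗≫
        (μ F (X ⊗ Y) Z ≫ F.map (α_ X Y Z).hom) ▷ T := by
          rw [MonoidalCategory.whisker_exchange]; monoidal
    _ = 𝟙 _ ⊗≫ (V ⊗ F.obj X) ◁ Functor.OplaxMonoidal.δ F Y Z ⊗≫ V ◁ μ F X Y ▷ F.obj Z ⊗≫
        (τ (X ⊗ Y) ▷ F.obj Z ≫ (α_ _ _ _).hom ≫ F.obj (X ⊗ Y) ◁ hτ.σ Z ≫ (α_ _ _ _).inv ≫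
          μ F (X ⊗ Y) Z ▷ T) ≫ F.map (α_ X Y Z).hom ▷ T := by
          rw [hτ.τ_comp_σ]; monoidal
    _ = 𝟙 _ ⊗≫ (V ⊗ F.obj X) ◁ Functor.OplaxMonoidal.δ F Y Z ⊗≫
        V ◁ (μ F X Y ▷ F.obj Z ≫ μ F (X ⊗ Y) Z ≫ F.map (α_ X Y Z).hom) ≫ τ (X ⊗ Y ⊗ Z) := by
          rw [hτ.τ_comp_σ, Category.assoc, Category.assoc, ← hτ.naturality]; monoidal
    _ = 𝟙 _ ⊗≫ (V ⊗ F.obj X) ◁ (Functor.OplaxMonoidal.δ F Y Z ≫ μ F Y Z) ⊗≫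
        V ◁ μ F X (Y ⊗ Z) ≫ τ (X ⊗ Y ⊗ Z) := by
          rw [associativity]; monoidal
    _ = _ := by
          rw [Functor.Monoidal.δ_μ, hτ.τ_comp_σ]; monoidal

lemma σ_unital : T ◁ ε F ≫ hτ.σ (𝟙_ C) = (ρ_ T).hom ≫ (λ_ T).inv ≫ ε F ▷ T := by
  rw [← cancel_epi (T ◁ Functor.OplaxMonoidal.η F), Functor.Monoidal.whiskerLeft_η_ε_assoc]
  refine hτ.tensor_map_hom_ext fun X => ?_
  have hρ : F.obj X ◁ ε F ≫ μ F X (𝟙_ C) = (ρ_ (F.obj X)).hom ≫ F.map (ρ_ X).inv := by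
    rw [right_unitality F X]
    simp
  have hρ' : F.obj X ◁ Functor.OplaxMonoidal.η F ≫ (ρ_ (F.obj X)).hom ≫ F.map (ρ_ X).inv =
      μ F X (𝟙_ C) := by
    rw [← hρ, Functor.Monoidal.whiskerLeft_η_ε_assoc]
  symm
  calc _ = 𝟙 _ ⊗≫ (τ X ▷ F.obj (𝟙_ C) ≫ (F.obj X ⊗ T) ◁ Functor.OplaxMonoidal.η F) ⊗≫
        (F.obj X ◁ ε F ≫ μ F X (𝟙_ C)) ▷ T := by monoidal
    _ = 𝟙 _ ⊗≫ (V ⊗ F.obj X) ◁ Functor.OplaxMonoidal.η F ⊗≫ (τ X ≫ F.map (ρ_ X).inv ▷ T) := by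
        rw [hρ, ← MonoidalCategory.whisker_exchange]; monoidal
    _ = (α_ _ _ _).hom ≫ V ◁ (F.obj X ◁ Functor.OplaxMonoidal.η F ≫ (ρ_ (F.obj X)).hom ≫
        F.map (ρ_ X).inv) ≫ τ (X ⊗ 𝟙_ C) := by
        rw [← hτ.naturality]; monoidal
    _ = _ := by
        rw [hρ', hτ.τ_comp_σ]

end IsUniversal

variable [MonoidalCategory C] [F.Monoidal] [RigidCategory C]

namespace IsUniversal

variable (hτ : IsUniversal F τ)

/-- The free object of the centralizer on `V`, with underlying object the universal object `T`. -/
def free : Centralizer F :=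
  LaxHalfBraiding.toCentralizer ⟨hτ.σ, hτ.σ_naturality, hτ.σ_monoidal, hτ.σ_unital⟩

variable (τ) in
/-- The unit `V ⟶ T`, which is `τ` at the unit object. -/
def unit : V ⟶ T :=
  (ρ_ V).inv ≫ V ◁ ε F ≫ τ (𝟙_ C) ≫ Functor.OplaxMonoidal.η F ▷ T ≫ (λ_ T).hom

lemma unit_comp_σ (Y : C) : unit τ ▷ F.obj Y ≫ hτ.σ Y = τ Y := by
  have hl : Functor.OplaxMonoidal.η F ▷ F.obj Y ≫ (λ_ (F.obj Y)).hom =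
      μ F (𝟙_ C) Y ≫ F.map (λ_ Y).hom := by
    rw [left_unitality F Y, Functor.Monoidal.whiskerRight_η_ε_assoc]
  have hl' : ε F ▷ F.obj Y ≫ μ F (𝟙_ C) Y ≫ F.map (λ_ Y).hom = (λ_ (F.obj Y)).hom :=
    (left_unitality F Y).symm
  unfold unit
  calc _ = 𝟙 _ ⊗≫ V ◁ ε F ▷ F.obj Y ⊗≫ τ (𝟙_ C) ▷ F.obj Y ⊗≫
        (Functor.OplaxMonoidal.η F ▷ (T ⊗ F.obj Y) ≫ 𝟙_ D ◁ hτ.σ Y) ⊗≫ 𝟙 (F.obj Y ⊗ T) := by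
          monoidal
    _ = 𝟙 _ ⊗≫ V ◁ ε F ▷ F.obj Y ⊗≫ τ (𝟙_ C) ▷ F.obj Y ⊗≫ F.obj (𝟙_ C) ◁ hτ.σ Y ⊗≫
        (Functor.OplaxMonoidal.η F ▷ F.obj Y ≫ (λ_ (F.obj Y)).hom) ▷ T := by
          rw [← MonoidalCategory.whisker_exchange]; monoidal
    _ = 𝟙 _ ⊗≫ V ◁ ε F ▷ F.obj Y ⊗≫ (τ (𝟙_ C) ▷ F.obj Y ≫ (α_ _ _ _).hom ≫
        F.obj (𝟙_ C) ◁ hτ.σ Y ≫ (α_ _ _ _).inv ≫ μ F (𝟙_ C) Y ▷ T) ≫ F.map (λ_ Y).hom ▷ T := by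
          rw [hl]; monoidal
    _ = 𝟙 _ ⊗≫ V ◁ (ε F ▷ F.obj Y ≫ μ F (𝟙_ C) Y ≫ F.map (λ_ Y).hom) ≫ τ Y := by
          rw [hτ.τ_comp_σ, Category.assoc, Category.assoc, ← hτ.naturality]; monoidal
    _ = _ := by rw [hl']; monoidal

/-- The universal property of the free object of the centralizer on `V`. -/
lemma existsUnique_free (W : Centralizer F) (φ : V ⟶ W.obj) :
    ∃! Φ : hτ.free ⟶ W, unit τ ≫ Φ.hom = φ := by
  -- The morphism `g` is determined by `τ X ≫ F X ◁ g = φ ▷ F X ≫ β X`, which forces its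
  -- compatibility with the half-braidings.
  obtain ⟨g, hg, huniq⟩ := hτ.existsUnique (fun X => φ ▷ F.obj X ≫ (W.β X).hom) fun f => by
    rw [MonoidalCategory.whisker_exchange_assoc, W.naturality, Category.assoc]
  have hcomm (Y : C) : g ▷ F.obj Y ≫ (W.β Y).hom = hτ.σ Y ≫ F.obj Y ◁ g := by
    refine hτ.tensor_map_hom_ext fun X => ?_
    calc _ = 𝟙 _ ⊗≫ (τ X ≫ F.obj X ◁ g) ▷ F.obj Y ⊗≫ F.obj X ◁ (W.β Y).hom ⊗≫
          μ F X Y ▷ W.obj := by monoidal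
      _ = 𝟙 _ ⊗≫ φ ▷ (F.obj X ⊗ F.obj Y) ≫ (α_ _ _ _).inv ≫ (W.β X).hom ▷ F.obj Y ≫
          (α_ _ _ _).hom ≫ F.obj X ◁ (W.β Y).hom ≫ (α_ _ _ _).inv ≫ μ F X Y ▷ W.obj := by
          rw [hg]; monoidal
      _ = 𝟙 _ ⊗≫ V ◁ μ F X Y ≫ φ ▷ F.obj (X ⊗ Y) ≫ (W.β (X ⊗ Y)).hom := by
          rw [← W.monoidal, MonoidalCategory.whisker_exchange_assoc]
      _ = ((α_ _ _ _).hom ≫ V ◁ μ F X Y ≫ τ (X ⊗ Y)) ≫ F.obj (X ⊗ Y) ◁ g := by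
          rw [← hg]; monoidal
      _ = 𝟙 _ ⊗≫ τ X ▷ F.obj Y ⊗≫ F.obj X ◁ hτ.σ Y ⊗≫
          (μ F X Y ▷ T ≫ F.obj (X ⊗ Y) ◁ g) := by
          rw [← hτ.τ_comp_σ]; monoidal
      _ = _ := by
          rw [← MonoidalCategory.whisker_exchange]; monoidal
  refine ⟨⟨g, hcomm⟩, ?_, fun Φ hΦ => Centralizer.hom_ext (huniq _ fun X => ?_)⟩
  · change unit τ ≫ g = φ
    have hu : (W.β (𝟙_ C)).hom ≫ Functor.OplaxMonoidal.η F ▷ W.obj =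
        W.obj ◁ Functor.OplaxMonoidal.η F ≫ (ρ_ W.obj).hom ≫ (λ_ W.obj).inv := by
      rw [← cancel_epi (W.obj ◁ ε F), reassoc_of% W.unital]
      simp
    calc _ = (ρ_ V).inv ≫ V ◁ ε F ≫ τ (𝟙_ C) ≫
          (Functor.OplaxMonoidal.η F ▷ T ≫ 𝟙_ D ◁ g) ≫ (λ_ W.obj).hom := by
            unfold unit; monoidal
      _ = (ρ_ V).inv ≫ V ◁ ε F ≫ (τ (𝟙_ C) ≫ F.obj (𝟙_ C) ◁ g) ≫
          Functor.OplaxMonoidal.η F ▷ W.obj ≫ (λ_ W.obj).hom := by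
            rw [← MonoidalCategory.whisker_exchange]; simp only [Category.assoc]
      _ = _ := by
            rw [hg, Category.assoc, reassoc_of% hu, MonoidalCategory.whisker_exchange_assoc,
              Functor.Monoidal.whiskerLeft_ε_η_assoc]
            simp
  · have aux (ψ : T ⟶ W.obj) (hψ : ψ ▷ F.obj X ≫ (W.β X).hom = hτ.σ X ≫ F.obj X ◁ ψ)
        (h : unit τ ≫ ψ = φ) : τ X ≫ F.obj X ◁ ψ = φ ▷ F.obj X ≫ (W.β X).hom := by
      rw [← hτ.unit_comp_σ, Category.assoc, ← hψ, ← comp_whiskerRight_assoc, h]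
    exact aux Φ.hom (Φ.comm X) hΦ

end IsUniversal

variable (F) in
/-- The forgetful functor of the centralizer has a left adjoint as soon as all universal natural
transformations exist. -/
lemma isRightAdjoint_forget (h : ∀ V : D, ∃ (T : D) (τ : ∀ X : C, V ⊗ F.obj X ⟶ F.obj X ⊗ T),
    IsUniversal F τ) : (Centralizer.forget F).IsRightAdjoint := by
  rw [isRightAdjoint_iff_hasInitial_structuredArrow]
  intro V
  obtain ⟨T, τ, hτ⟩ := h V
  let I : StructuredArrow V (Centralizer.forget F) :=
    StructuredArrow.mk (Y := hτ.free) (IsUniversal.unit τ)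
  have hI : IsInitial I := IsInitial.ofUniqueHom
    (fun X => StructuredArrow.homMk (hτ.existsUnique_free X.right X.hom).choose
      (hτ.existsUnique_free X.right X.hom).choose_spec.1)
    fun X m => by
      ext1
      exact (hτ.existsUnique_free X.right X.hom).choose_spec.2 _ (StructuredArrow.w m)
  exact hI.hasInitial

/-- A free object `Z` of the centralizer on `V` gives a universal natural transformation
`V ⊗ F(-) ⟶ Z ⊗ F(-) ⟶ F(-) ⊗ Z`. -/
lemma IsUniversal.of_free (hτ : IsUniversal F τ) (Z : Centralizer F) (u : V ⟶ Z.obj)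
    (hu : ∀ (W : Centralizer F) (φ : V ⟶ W.obj), ∃! Φ : Z ⟶ W, u ≫ Φ.hom = φ) :
    IsUniversal F (fun X => u ▷ F.obj X ≫ (Z.β X).hom) where
  naturality f := by
    rw [MonoidalCategory.whisker_exchange_assoc, Z.naturality, Category.assoc]
  existsUnique {B} σ hσ := by
    -- Both `Z` and `T` are free on `V`; only half of the resulting isomorphism is needed.
    obtain ⟨a, b, hac, ha, hab⟩ : ∃ (a : Z.obj ⟶ T) (b : T ⟶ Z.obj),
        (∀ X, a ▷ F.obj X ≫ hτ.σ X = (Z.β X).hom ≫ F.obj X ◁ a) ∧ u ≫ a = unit τ ∧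
          a ≫ b = 𝟙 Z.obj := by
      obtain ⟨a, ha, -⟩ := hu hτ.free (unit τ)
      obtain ⟨b, hb, -⟩ := hτ.existsUnique_free Z u
      exact ⟨a.hom, b.hom, a.comm, ha, congrArg Centralizer.Hom.hom
        ((hu Z u).unique (y₁ := a ≫ b) (y₂ := 𝟙 Z)
          ((Category.assoc _ _ _).symm.trans ((congrArg (· ≫ b.hom) ha).trans hb))
          (Category.comp_id u))⟩
    have ha' (X : C) (g : T ⟶ B) : (u ▷ F.obj X ≫ (Z.β X).hom) ≫ F.obj X ◁ (a ≫ g) =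
        τ X ≫ F.obj X ◁ g := by
      rw [whiskerLeft_comp, Category.assoc, ← reassoc_of% (hac X), ← comp_whiskerRight_assoc, ha,
        reassoc_of% (hτ.unit_comp_σ X)]
    obtain ⟨g, hg, huniq⟩ := hτ.existsUnique σ hσ
    refine ⟨a ≫ g, fun X => (ha' X g).trans (hg X), fun g' hg' => ?_⟩
    have h1 : a ≫ b ≫ g' = g' := by rw [reassoc_of% hab]
    have h2 : b ≫ g' = g := huniq _ fun X => by
      rw [← ha', h1]
      exact hg' X
    rw [← h2, h1]

/-- For a left adjoint `L` of the forgetful functor, the natural transformation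
`V ⊗ F(-) ⟶ L(V) ⊗ F(-) ⟶ F(-) ⊗ L(V)` is universal. -/
lemma isUniversal_of_adjunction (hτ : IsUniversal F τ) {L : D ⥤ Centralizer F}
    (adj : L ⊣ Centralizer.forget F) :
    IsUniversal F (V := V) (T := (L.obj V).obj)
      (fun X => adj.unit.app V ▷ F.obj X ≫ ((L.obj V).β X).hom) :=
  hτ.of_free (L.obj V) (adj.unit.app V) fun W φ =>
    ⟨(adj.homEquiv V W).symm φ,
      (adj.homEquiv_unit _ _ _).symm.trans (Equiv.apply_symm_apply (adj.homEquiv V W) _),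
      fun _ hΨ => ((adj.homEquiv V W).eq_symm_apply).2 ((adj.homEquiv_unit _ _ _).trans hΨ)⟩

end FreeObject

/-! ### Functoriality of cochains in the coefficients -/

section CochainFunctoriality

variable {C : Type u₁} [Category.{v₁} C] [MonoidalCategory C]
  {D : Type u₂} [Category.{v₂} D] [MonoidalCategory D] {F : C ⥤ D} [F.Monoidal]
  {V V' W W' W'' : Centralizer F} {n : ℕ}

namespace Cochain

/-- Postcomposition of a cochain with a morphism `W ⟶ W'` of the target category, which need not
commute with the half-braidings. -/
def post (f : Cochain V W n) (g : W.obj ⟶ W'.obj) : Cochain V W' n where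
  app X := f.comp X ≫ F.obj (tensorTuple X) ◁ g
  naturality X Y h := by
    change V.obj ◁ tensorTupleMap (fun i => F.map (h i)) ≫ f.comp Y ≫ _ =
      (f.comp X ≫ _) ≫ F.map (tensorTupleMap h) ▷ W'.obj
    rw [← Category.assoc, f.comp_naturality, Category.assoc, Category.assoc,
      MonoidalCategory.whisker_exchange]

/-- Precomposition of a cochain with a morphism `V ⟶ V'` of the target category, which need not
commute with the half-braidings. -/
def pre (a : V.obj ⟶ V'.obj) (f : Cochain V' W n) : Cochain V W n where
  app X := a ▷ tensorTuple (fun i => F.obj (X i)) ≫ f.comp X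
  naturality X Y h := by
    change V.obj ◁ tensorTupleMap (fun i => F.map (h i)) ≫ _ ≫ f.comp Y =
      (_ ≫ f.comp X) ≫ F.map (tensorTupleMap h) ▷ W.obj
    rw [MonoidalCategory.whisker_exchange_assoc, f.comp_naturality, Category.assoc]

@[simp]
lemma post_comp (f : Cochain V W n) (g : W.obj ⟶ W'.obj) (X : Fin n → C) :
    (f.post g).comp X = f.comp X ≫ F.obj (tensorTuple X) ◁ g := rfl

@[simp]
lemma pre_comp (a : V.obj ⟶ V'.obj) (f : Cochain V' W n) (X : Fin n → C) :
    (f.pre a).comp X = a ▷ tensorTuple (fun i => F.obj (X i)) ≫ f.comp X := rfl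

lemma post_post (f : Cochain V W n) (g : W.obj ⟶ W'.obj) (g' : W'.obj ⟶ W''.obj) :
    (f.post g).post g' = f.post (g ≫ g') := by
  ext X; simp

lemma pre_post (a : V.obj ⟶ V'.obj) (f : Cochain V' W n) (g : W.obj ⟶ W'.obj) :
    (f.pre a).post g = (f.post g).pre a := by
  ext X; simp

lemma post_id (f : Cochain V W n) : f.post (𝟙 W.obj) = f := by
  ext X; simp

end Cochain

lemma actLeft_post (X : C) {S : D} {P : C} (f : V.obj ⊗ S ⟶ F.obj P ⊗ W.obj)
    (g : W.obj ⟶ W'.obj) :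
    actLeft X (f ≫ F.obj P ◁ g) = actLeft X f ≫ F.obj (X ⊗ P) ◁ g := by
  unfold actLeft
  simp only [Category.assoc]
  rw [← MonoidalCategory.whisker_exchange]
  monoidal

lemma actRight_post {S : D} {P : C} (f : V.obj ⊗ S ⟶ F.obj P ⊗ W.obj) (Y : C) (g : W ⟶ W') :
    actRight (f ≫ F.obj P ◁ g.hom) Y = actRight f Y ≫ F.obj (P ⊗ Y) ◁ g.hom := by
  unfold actRight
  simp only [Category.assoc]
  rw [← MonoidalCategory.whisker_exchange]
  calc _ = 𝟙 _ ⊗≫ f ▷ F.obj Y ⊗≫ F.obj P ◁ (g.hom ▷ F.obj Y ≫ (W'.β Y).hom) ⊗≫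
        μ F P Y ▷ W'.obj := by monoidal
    _ = _ := by rw [g.comm]; monoidal

lemma actRight_pre (a : V.obj ⟶ V'.obj) {S : D} {P : C} (f : V'.obj ⊗ S ⟶ F.obj P ⊗ W.obj)
    (Y : C) : actRight (a ▷ S ≫ f) Y = a ▷ (S ⊗ F.obj Y) ≫ actRight f Y := by
  unfold actRight
  monoidal

lemma cofaceZero_post (f : Cochain V W n) (g : W.obj ⟶ W'.obj) :
    cofaceZero (f.post g) = (cofaceZero f).post g := by
  ext X
  exact actLeft_post _ _ _

lemma cofaceMid_post (j : Fin n) (f : Cochain V W n) (g : W.obj ⟶ W'.obj) :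
    cofaceMid j (f.post g) = (cofaceMid j f).post g := by
  ext X
  simp only [cofaceMid_comp, Cochain.post_comp, Category.assoc]
  rw [MonoidalCategory.whisker_exchange]
  rfl

lemma cofaceLast_post (f : Cochain V W n) (g : W ⟶ W') :
    cofaceLast (f.post g.hom) = (cofaceLast f).post g.hom := by
  ext X
  simp only [cofaceLast_comp, Cochain.post_comp, Category.assoc]
  rw [actRight_post, Category.assoc, MonoidalCategory.whisker_exchange]

lemma cofaceLast_pre (a : V.obj ⟶ V'.obj) (f : Cochain V' W n) :
    cofaceLast (f.pre a) = (cofaceLast f).pre a := by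
  ext X
  simp only [cofaceLast_comp, Cochain.pre_comp]
  rw [actRight_pre, Category.assoc, MonoidalCategory.whisker_exchange_assoc]

lemma coface_castSucc_post (j : Fin (n + 1)) (f : Cochain V W n) (g : W.obj ⟶ W'.obj) :
    coface j.castSucc (f.post g) = (coface j.castSucc f).post g := by
  refine Fin.cases ?_ (fun i => ?_) j
  · exact cofaceZero_post f g
  · exact (coface_mid i (f.post g)).trans ((cofaceMid_post i f g).trans
      (congrArg (fun z => z.post g) (coface_mid i f).symm))

lemma coface_post (i : Fin (n + 2)) (f : Cochain V W n) (g : W ⟶ W') :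
    coface i (f.post g.hom) = (coface i f).post g.hom := by
  refine Fin.lastCases ?_ (fun j => ?_) i
  · exact (coface_last (f.post g.hom)).trans ((cofaceLast_post f g).trans
      (congrArg (fun z => z.post g.hom) (coface_last f).symm))
  · exact coface_castSucc_post j f g.hom

variable (V) in
/-- The `0`-cochain `V ⟶ F(𝟙) ⊗ V` given by the unit isomorphism of `F`. -/
def unitCochain : Cochain V V 0 where
  app _ := (ρ_ V.obj).hom ≫ (λ_ V.obj).inv ≫ ε F ▷ V.obj
  naturality X Y h := by
    change V.obj ◁ 𝟙 (𝟙_ D) ≫ _ = _ ≫ F.map (𝟙 (𝟙_ C)) ▷ V.obj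
    rw [F.map_id, whiskerLeft_id, id_whiskerRight]
    exact (Category.id_comp _).trans (Category.comp_id _).symm

lemma unitCochain_pre (a : V.obj ⟶ V'.obj) : (unitCochain V').pre a = (unitCochain V).post a := by
  ext X
  change a ▷ 𝟙_ D ≫ (ρ_ V'.obj).hom ≫ (λ_ V'.obj).inv ≫ ε F ▷ V'.obj =
    ((ρ_ V.obj).hom ≫ (λ_ V.obj).inv ≫ ε F ▷ V.obj) ≫ F.obj (𝟙_ C) ◁ a
  simp only [Category.assoc]
  rw [← MonoidalCategory.whisker_exchange]
  monoidal

/-- The two cofaces of the unit cochain agree: both are the half-braiding. -/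
lemma cofaceZero_unitCochain : cofaceZero (unitCochain V) = cofaceLast (unitCochain V) := by
  ext X
  have hr : F.obj (X 0) ◁ ε F ≫ μ F (X 0) (𝟙_ C) =
      (ρ_ (F.obj (X 0))).hom ≫ F.map (ρ_ (X 0)).inv := by
    rw [right_unitality F (X 0)]
    simp
  have hl : ε F ▷ F.obj (X 0) ≫ μ F (𝟙_ C) (X 0) =
      (λ_ (F.obj (X 0))).hom ≫ F.map (λ_ (X 0)).inv := by
    rw [left_unitality F (X 0)]
    simp
  change actLeft (X 0) ((ρ_ V.obj).hom ≫ (λ_ V.obj).inv ≫ ε F ▷ V.obj) =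
    V.obj ◁ ((ρ_ (F.obj (X 0))).hom ≫ (λ_ (F.obj (X 0))).inv) ≫
      actRight ((ρ_ V.obj).hom ≫ (λ_ V.obj).inv ≫ ε F ▷ V.obj) (X 0) ≫
        F.map ((λ_ (X 0)).hom ≫ (ρ_ (X 0)).inv) ▷ V.obj
  unfold actLeft actRight
  symm
  calc _ = 𝟙 _ ⊗≫ (ε F ▷ (V.obj ⊗ F.obj (X 0)) ≫ F.obj (𝟙_ C) ◁ (V.β (X 0)).hom) ⊗≫
        μ F (𝟙_ C) (X 0) ▷ V.obj ≫ F.map ((λ_ (X 0)).hom ≫ (ρ_ (X 0)).inv) ▷ V.obj := by monoidal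
    _ = 𝟙 _ ⊗≫ (V.β (X 0)).hom ⊗≫
        ((ε F ▷ F.obj (X 0) ≫ μ F (𝟙_ C) (X 0)) ≫ F.map ((λ_ (X 0)).hom ≫ (ρ_ (X 0)).inv)) ▷
          V.obj := by
        rw [← MonoidalCategory.whisker_exchange]; monoidal
    _ = 𝟙 _ ⊗≫ (V.β (X 0)).hom ⊗≫ ((ρ_ (F.obj (X 0))).hom ≫ F.map (ρ_ (X 0)).inv) ▷ V.obj := by
        rw [hl, F.map_comp, Category.assoc, ← F.map_comp_assoc, Iso.inv_hom_id, F.map_id,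
          Category.id_comp]
        monoidal
    _ = _ := by
        rw [← hr]; monoidal

end CochainFunctoriality

/-! ### Removing the first variable of a cochain -/

section Shift

variable {C : Type u₁} [Category.{v₁} C] [MonoidalCategory C]
  {D : Type u₂} [Category.{v₂} D] [MonoidalCategory D] {F : C ⥤ D} [F.Monoidal]
  {V V' W : Centralizer F} {n : ℕ}

lemma exists_exactPairing_tensorTuple [RightRigidCategory C] (F : C ⥤ D) [F.Monoidal] :
    ∀ {n : ℕ} (X : Fin n → C),
      ∃ S' : D, Nonempty (ExactPairing (tensorTuple fun i => F.obj (X i)) S')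
  | 0, _ => ⟨𝟙_ D, ⟨exactPairingUnit⟩⟩
  | _ + 1, X => by
      obtain ⟨S', ⟨h⟩⟩ := exists_exactPairing_tensorTuple F fun i => X i.succ
      let := mapExactPairing F (X 0) ((X 0)ᘁ)
      exact ⟨S' ⊗ F.obj ((X 0)ᘁ), ⟨ExactPairing.tensor⟩⟩

/-- The component of an `(n + 1)`-cochain at a tuple of the form `(Y, X₁, …, Xₙ)`. -/
def Cochain.consComp (f : Cochain V W (n + 1)) (Y : C) (X : Fin n → C) :
    V.obj ⊗ (F.obj Y ⊗ tensorTuple (fun i => F.obj (X i))) ⟶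
      F.obj (Y ⊗ tensorTuple X) ⊗ W.obj :=
  f.comp (Fin.cons Y X)

lemma Cochain.ext_consComp {f g : Cochain V W (n + 1)}
    (h : ∀ Y X, f.consComp Y X = g.consComp Y X) : f = g := by
  ext X
  obtain ⟨Y, X', rfl⟩ : ∃ (Y : C) (X' : Fin n → C), X = Fin.cons Y X' :=
    ⟨_, _, (Fin.cons_self_tail X).symm⟩
  exact h Y X'

lemma Cochain.consComp_naturality (f : Cochain V W (n + 1)) {Y Z : C} (g : Y ⟶ Z)
    {X X' : Fin n → C} (h : ∀ i, X i ⟶ X' i) :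
    V.obj ◁ (F.map g ⊗ₘ tensorTupleMap (fun i => F.map (h i))) ≫ f.consComp Z X' =
      f.consComp Y X ≫ F.map (g ⊗ₘ tensorTupleMap h) ▷ W.obj :=
  f.comp_naturality (X := Fin.cons Y X) (Y := Fin.cons Z X')
    (Fin.cases (motive := fun i => (Fin.cons Y X : Fin (n + 1) → C) i ⟶
      (Fin.cons Z X' : Fin (n + 1) → C) i) g h)

/-- The map from `n`-cochains on `V'` to `(n + 1)`-cochains on `V` induced by a morphism
`a : V ⟶ V'` of the target category: the zeroth coface, restricted along `a`. -/
def shift (a : V.obj ⟶ V'.obj) (f : Cochain V' W n) : Cochain V W (n + 1) :=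
  (cofaceZero f).pre a

lemma shift_consComp (a : V.obj ⟶ V'.obj) (f : Cochain V' W n) (Y : C) (X : Fin n → C) :
    (shift a f).consComp Y X = (α_ _ _ _).inv ≫ (a ▷ F.obj Y ≫ (V'.β Y).hom) ▷ _ ≫
      (α_ _ _ _).hom ≫ F.obj Y ◁ f.comp X ≫ (α_ _ _ _).inv ≫ μ F Y (tensorTuple X) ▷ W.obj := by
  change a ▷ (F.obj Y ⊗ tensorTuple (fun i => F.obj (X i))) ≫ actLeft Y (f.comp X) = _
  unfold actLeft
  monoidal

/-- If `V ⊗ F(-) ⟶ V' ⊗ F(-) ⟶ F(-) ⊗ V'` is universal, then `n`-cochains on `V'` are the same as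
`(n + 1)`-cochains on `V`: the universal property removes the first variable. -/
lemma shift_bijective [RightRigidCategory C] (a : V.obj ⟶ V'.obj)
    (ha : IsUniversal F (fun X => a ▷ F.obj X ≫ (V'.β X).hom)) :
    Function.Bijective (shift a : Cochain V' W n → Cochain V W (n + 1)) := by
  constructor
  · intro f f' h
    ext X
    obtain ⟨S', ⟨_⟩⟩ := exists_exactPairing_tensorTuple F X
    refine ha.tensor_hom_ext _ S' fun Y => ?_
    have h1 := congrArg (fun z => z.consComp Y X) h
    simp only [shift_consComp] at h1
    rw [cancel_epi] at h1
    rw [← cancel_mono ((α_ _ _ _).inv ≫ μ F Y (tensorTuple X) ▷ W.obj)]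
    simpa only [Category.assoc] using h1
  · intro h
    -- The universal property, applied in the first variable `Y`, gives the component at each `X`.
    have key (X : Fin n → C) : ∃ g : V'.obj ⊗ tensorTuple (fun i => F.obj (X i)) ⟶
        F.obj (tensorTuple X) ⊗ W.obj, ∀ Y : C,
          (a ▷ F.obj Y ≫ (V'.β Y).hom) ▷ _ ≫ (α_ _ _ _).hom ≫ F.obj Y ◁ g =
            (α_ _ _ _).hom ≫ h.consComp Y X ≫
              Functor.OplaxMonoidal.δ F Y (tensorTuple X) ▷ W.obj ≫ (α_ _ _ _).hom := by
      obtain ⟨S', ⟨_⟩⟩ := exists_exactPairing_tensorTuple F X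
      refine ha.exists_tensor _ S' (fun Y => h.consComp Y X ≫
              Functor.OplaxMonoidal.δ F Y (tensorTuple X) ▷ W.obj ≫ (α_ _ _ _).hom) ?_
      intro Y Z f
      have h1 := h.consComp_naturality f (fun i => 𝟙 (X i))
      rw [tensorTupleMap_map_id, tensorTupleMap_id, tensorHom_id, tensorHom_id] at h1
      rw [reassoc_of% h1, ← comp_whiskerRight_assoc, ← Functor.OplaxMonoidal.δ_natural_left]
      monoidal
    choose g hg using key
    refine ⟨⟨g, fun X X' m => ?_⟩, Cochain.ext_consComp fun Y X => ?_⟩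
    -- Naturality in `X` can be tested after composition with the universal transformation.
    · change V'.obj ◁ tensorTupleMap (fun i => F.map (m i)) ≫ g X' =
        g X ≫ F.map (tensorTupleMap m) ▷ W.obj
      obtain ⟨S', ⟨_⟩⟩ := exists_exactPairing_tensorTuple F X
      refine ha.tensor_hom_ext _ S' fun Y => ?_
      have h1 := h.consComp_naturality (𝟙 Y) m
      rw [F.map_id, id_tensorHom, id_tensorHom] at h1
      have h2 : (V.obj ⊗ F.obj Y) ◁ tensorTupleMap (fun i => F.map (m i)) ≫
            (α_ _ _ _).hom ≫ h.consComp Y X' =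
          (α_ _ _ _).hom ≫ h.consComp Y X ≫ F.map (Y ◁ tensorTupleMap m) ▷ W.obj := by
        rw [← h1]; monoidal
      calc (a ▷ F.obj Y ≫ (V'.β Y).hom) ▷ _ ≫ (α_ _ _ _).hom ≫
            F.obj Y ◁ (V'.obj ◁ tensorTupleMap (fun i => F.map (m i)) ≫ g X')
          = (V.obj ⊗ F.obj Y) ◁ tensorTupleMap (fun i => F.map (m i)) ≫
              (a ▷ F.obj Y ≫ (V'.β Y).hom) ▷ _ ≫ (α_ _ _ _).hom ≫ F.obj Y ◁ g X' := by
            rw [MonoidalCategory.whisker_exchange_assoc]; monoidal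
        _ = ((α_ _ _ _).hom ≫ h.consComp Y X ≫
              Functor.OplaxMonoidal.δ F Y (tensorTuple X) ▷ W.obj ≫ (α_ _ _ _).hom) ≫
              F.obj Y ◁ F.map (tensorTupleMap m) ▷ W.obj := by
            rw [hg X' Y, reassoc_of% h2, ← comp_whiskerRight_assoc,
              ← Functor.OplaxMonoidal.δ_natural_right]
            monoidal
        _ = _ := by
            rw [← hg X Y]; monoidal
    · rw [shift_consComp]
      change _ ≫ _ ≫ _ ≫ _ ◁ g X ≫ _ = _
      rw [reassoc_of% (hg X Y)]
      simp

end Shift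

/-! ### Universal cochains -/

section Bar

variable {C : Type u₁} [Category.{v₁} C] [MonoidalCategory C]
  {D : Type u₂} [Category.{v₂} D] [MonoidalCategory D] {F : C ⥤ D} [F.Monoidal]
  {L : D ⥤ Centralizer F} (adj : L ⊣ Centralizer.forget F) (V : Centralizer F)

/-- The unit `V ⟶ G(V)` of an adjunction `L ⊣ U` with comonad `G = L U`, a morphism of the target
category of `F`. -/
def comonadUnit : V.obj ⟶ ((Centralizer.forget F ⋙ L).obj V).obj :=
  adj.unit.app V.obj

/-- The unit `Gⁿ(V) ⟶ Gⁿ⁺¹(V)`, which does not commute with the half-braidings. -/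
def barUnit (n : ℕ) : (iterate (Centralizer.forget F ⋙ L) V n).obj ⟶
    (iterate (Centralizer.forget F ⋙ L) V (n + 1)).obj :=
  comonadUnit adj (iterate (Centralizer.forget F ⋙ L) V n)

lemma barUnit_comp_barEps (n : ℕ) : barUnit adj V n ≫ (barEps adj V n).hom = 𝟙 _ :=
  adj.right_triangle_components _

lemma barUnit_naturality {m n : ℕ} (f : iterate (Centralizer.forget F ⋙ L) V m ⟶
      iterate (Centralizer.forget F ⋙ L) V n) :
    f.hom ≫ barUnit adj V n = barUnit adj V m ≫ (iterateMap _ V f).hom :=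
  adj.unit.naturality f.hom

/-- The `n`-cochain `V ⊗ F X₁ ⊗ ⋯ ⊗ F Xₙ ⟶ F (X₁ ⊗ ⋯ ⊗ Xₙ) ⊗ Gⁿ(V)` obtained by applying the unit
and moving the `Xᵢ` to the left by the half-braiding, one after the other. -/
def barCochain : ∀ n : ℕ, Cochain V (iterate (Centralizer.forget F ⋙ L) V n) n
  | 0 => unitCochain V
  | n + 1 => cofaceLast ((barCochain n).post (barUnit adj V n))

/-- The universal `n`-cochain: every `n`-cochain with values in `W` arises from it by composition
with a unique morphism `Gⁿ⁺¹(V) ⟶ W` of the centralizer. -/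
def universalCochain (n : ℕ) : Cochain V (iterate (Centralizer.forget F ⋙ L) V (n + 1)) n :=
  (barCochain adj V n).post (barUnit adj V n)

lemma barFace_last (n : ℕ) : barFace adj V n (Fin.last n) = barEps adj V n := by
  cases n with
  | zero => rfl
  | succ n => exact Fin.lastCases_last

lemma barFace_castSucc (n : ℕ) (j : Fin (n + 1)) :
    barFace adj V (n + 1) j.castSucc = iterateMap _ V (barFace adj V n j) :=
  Fin.lastCases_castSucc _

lemma universalCochain_succ_post_barEps (n : ℕ) :
    (universalCochain adj V (n + 1)).post (barEps adj V (n + 1)).hom =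
      barCochain adj V (n + 1) := by
  rw [universalCochain, Cochain.post_post, barUnit_comp_barEps, Cochain.post_id]

/-- The cofaces of the universal cochain correspond to the faces of the bar complex. Faces other
than the last one are obtained by applying `G` to a face of lower degree, which by naturality of the
unit reduces the claim to the cofaces of `barCochain`. -/
lemma coface_universalCochain : ∀ (n : ℕ) (i : Fin (n + 2)),
    coface i (universalCochain adj V n) =
      (universalCochain adj V (n + 1)).post (barFace adj V (n + 1) i).hom
  | n, i => by
    refine Fin.lastCases ?_ (fun j => ?_) i
    · rw [barFace_last, universalCochain_succ_post_barEps]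
      exact coface_last _
    · have h : coface j.castSucc (barCochain adj V n) =
          (barCochain adj V (n + 1)).post (barFace adj V n j).hom := by
        cases n with
        | zero =>
          obtain rfl : j = 0 := Subsingleton.elim (α := Fin 1) _ _
          change cofaceZero (unitCochain V) =
            (cofaceLast ((unitCochain V).post (barUnit adj V 0))).post (barEps adj V 0).hom
          refine cofaceZero_unitCochain.trans (Eq.trans ?_ (cofaceLast_post _ _))
          refine congrArg cofaceLast (Eq.trans ?_ (Cochain.post_post _ _ _).symm)
          exact ((congrArg (Cochain.post _) (barUnit_comp_barEps adj V 0)).trans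
            (Cochain.post_id _)).symm
        | succ n =>
          -- Commute the coface past the last coface in the definition of `barCochain`.
          have h1 := coface_coface j (Fin.last _) (Fin.le_last j)
            ((barCochain adj V n).post (barUnit adj V n))
          have h2 : coface (Fin.last (n + 1)) ((barCochain adj V n).post (barUnit adj V n)) =
            barCochain adj V (n + 1) := coface_last _
          rw [coface_last, h2] at h1
          refine h1.symm.trans ((congrArg cofaceLast (coface_universalCochain n j)).trans ?_)
          exact cofaceLast_post _ _
      rw [universalCochain, coface_castSucc_post, h, Cochain.post_post, barUnit_naturality,
        barFace_castSucc, universalCochain, Cochain.post_post]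

/-- The identification `Gⁿ(G(V)) ≅ Gⁿ⁺¹(V)`, which does not hold by definition because `iterate`
applies `G` on the outside. -/
def iterateShift {A : Type u₁} [Category.{v₁} A] (G : A ⥤ A) (V : A) :
    ∀ n : ℕ, iterate G (G.obj V) n ≅ iterate G V (n + 1)
  | 0 => Iso.refl _
  | n + 1 => G.mapIso (iterateShift G V n)

lemma iterateShift_comp_barUnit (n : ℕ) :
    (iterateShift _ V n).hom.hom ≫ barUnit adj V (n + 1) =
      barUnit adj ((Centralizer.forget F ⋙ L).obj V) n ≫ (iterateShift _ V (n + 1)).hom.hom :=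
  adj.unit.naturality (iterateShift (Centralizer.forget F ⋙ L) V n).hom.hom

lemma shift_post {V V' W W' : Centralizer F} {n : ℕ} (a : V.obj ⟶ V'.obj) (f : Cochain V' W n)
    (g : W.obj ⟶ W'.obj) : (shift a f).post g = shift a (f.post g) := by
  rw [shift, Cochain.pre_post, ← cofaceZero_post, shift]

lemma cofaceLast_shift {V V' W : Centralizer F} {n : ℕ} (a : V.obj ⟶ V'.obj)
    (f : Cochain V' W n) : cofaceLast (shift a f) = shift a (cofaceLast f) := by
  rw [shift, cofaceLast_pre, coface_zero_last]
  rfl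

lemma shift_post_barUnit (n : ℕ)
    (f : Cochain ((Centralizer.forget F ⋙ L).obj V)
      (iterate (Centralizer.forget F ⋙ L) ((Centralizer.forget F ⋙ L).obj V) n) n) :
    ((shift (comonadUnit adj V) f).post (iterateShift _ V n).hom.hom).post (barUnit adj V (n + 1)) =
      (shift (comonadUnit adj V) (f.post (barUnit adj _ n))).post
        (iterateShift _ V (n + 1)).hom.hom :=
  (Cochain.post_post _ _ _).trans
    ((congrArg (Cochain.post _) (iterateShift_comp_barUnit adj V n)).trans
      ((Cochain.post_post _ _ _).symm.trans
        (congrArg (fun z => Cochain.post z _) (shift_post _ _ _))))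

/-- In the iterated application of unit and half-braiding that defines `barCochain`, the first step
may be split off instead of the last one. -/
lemma barCochain_succ_eq_shift : ∀ n : ℕ,
    barCochain adj V (n + 1) = (shift (comonadUnit adj V)
      (barCochain adj ((Centralizer.forget F ⋙ L).obj V) n)).post (iterateShift _ V n).hom.hom
  | 0 => by
    change cofaceLast ((unitCochain V).post (barUnit adj V 0)) =
      (shift (comonadUnit adj V) (unitCochain ((Centralizer.forget F ⋙ L).obj V))).post (𝟙 _)
    rw [Cochain.post_id, shift, cofaceZero_unitCochain, ← cofaceLast_pre, unitCochain_pre]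
    rfl
  | n + 1 => by
    refine (congrArg (fun z => cofaceLast (Cochain.post z (barUnit adj V (n + 1))))
      (barCochain_succ_eq_shift n)).trans ?_
    refine (congrArg cofaceLast (shift_post_barUnit adj V n _)).trans ?_
    refine (cofaceLast_post _ _).trans ?_
    exact congrArg (fun z => Cochain.post z _) (cofaceLast_shift _ _)

lemma universalCochain_succ_eq_shift (n : ℕ) :
    universalCochain adj V (n + 1) = (shift (comonadUnit adj V)
      (universalCochain adj ((Centralizer.forget F ⋙ L).obj V) n)).post
        (iterateShift _ V (n + 1)).hom.hom :=
  (congrArg (fun z => Cochain.post z (barUnit adj V (n + 1)))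
    (barCochain_succ_eq_shift adj V n)).trans (shift_post_barUnit adj V n _)

lemma unitCochain_post_bijective (V W : Centralizer F) :
    Function.Bijective fun g : V.obj ⟶ W.obj => (unitCochain V).post g := by
  have key (g : V.obj ⟶ W.obj) (X : Fin 0 → C) : ((unitCochain V).post g).comp X =
      (ρ_ V.obj).hom ≫ g ≫ (λ_ W.obj).inv ≫ ε F ▷ W.obj := by
    change ((ρ_ V.obj).hom ≫ (λ_ V.obj).inv ≫ ε F ▷ V.obj) ≫ F.obj (𝟙_ C) ◁ g = _
    simp only [Category.assoc]
    rw [← MonoidalCategory.whisker_exchange]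
    monoidal
  constructor
  · intro g g' h
    have h1 := congrArg (fun z => z.comp Fin.elim0) h
    have h2 := ((key g _).symm.trans h1).trans (key g' _)
    exact (cancel_mono ((λ_ W.obj).inv ≫ ε F ▷ W.obj)).1 ((cancel_epi (ρ_ V.obj).hom).1 h2)
  · intro f
    obtain ⟨φ, hφ⟩ : ∃ φ : V.obj ⊗ 𝟙_ D ⟶ F.obj (𝟙_ C) ⊗ W.obj, φ = f.comp Fin.elim0 := ⟨_, rfl⟩
    refine ⟨(ρ_ V.obj).inv ≫ φ ≫ Functor.OplaxMonoidal.η F ▷ W.obj ≫ (λ_ W.obj).hom, ?_⟩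
    ext X
    obtain rfl : X = Fin.elim0 := Subsingleton.elim _ _
    refine (key _ _).trans (Eq.trans ?_ hφ)
    simp only [Category.assoc, Iso.hom_inv_id_assoc, ← comp_whiskerRight,
      Functor.Monoidal.η_ε, id_whiskerRight, Category.comp_id]
    rfl

lemma universalCochain_zero_post_bijective (W : Centralizer F) :
    Function.Bijective fun g : iterate (Centralizer.forget F ⋙ L) V 1 ⟶ W =>
      (universalCochain adj V 0).post g.hom := by
  have h := (unitCochain_post_bijective V W).comp (adj.homEquiv V.obj W).bijective
  have e : (fun g : iterate (Centralizer.forget F ⋙ L) V 1 ⟶ W =>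
      (universalCochain adj V 0).post g.hom) =
      (fun g => (unitCochain V).post g) ∘ adj.homEquiv V.obj W :=
    funext fun g => (Cochain.post_post _ _ _).trans
      (congrArg (fun z => (unitCochain V).post z) (adj.homEquiv_unit _ _ _).symm)
  exact e ▸ h

/-- Universality of the universal cochain, by induction on `n`: the universal property of the free
object on `V` removes the first variable of a cochain and replaces `V` by `G(V)`. -/
lemma universalCochain_post_bijective [RigidCategory C]
    (hF : ∀ V : D, ∃ (T : D) (τ : ∀ X : C, V ⊗ F.obj X ⟶ F.obj X ⊗ T), IsUniversal F τ)
    (W : Centralizer F) : ∀ (n : ℕ) (V : Centralizer F),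
    Function.Bijective fun g : iterate (Centralizer.forget F ⋙ L) V (n + 1) ⟶ W =>
      (universalCochain adj V n).post g.hom
  | 0, V => universalCochain_zero_post_bijective adj V W
  | n + 1, V => by
    obtain ⟨T, τ, hτ⟩ := hF V.obj
    have h := ((shift_bijective (W := W) (n := n) (comonadUnit adj V)
      (isUniversal_of_adjunction hτ adj)).comp
      (universalCochain_post_bijective hF W n ((Centralizer.forget F ⋙ L).obj V))).comp
      ((iterateShift (Centralizer.forget F ⋙ L) V (n + 1)).homFromEquiv (Z := W)).symm.bijective
    have e (g : iterate (Centralizer.forget F ⋙ L) V (n + 2) ⟶ W) :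
        (universalCochain adj V (n + 1)).post g.hom = shift (comonadUnit adj V)
          ((universalCochain adj ((Centralizer.forget F ⋙ L).obj V) n).post
            ((iterateShift (Centralizer.forget F ⋙ L) V (n + 1)).hom ≫ g).hom) :=
      (congrArg (fun z => Cochain.post z g.hom) (universalCochain_succ_eq_shift adj V n)).trans
        ((Cochain.post_post _ _ _).trans (shift_post _ _ _))
    exact (funext e : _ = _) ▸ h

end Bar

/-! ### The Davydov--Yetter complex and the bar complex -/

section Comparison

variable {C : Type u₁} [Category.{v₁} C] [MonoidalCategory C]
  {D : Type u₂} [Category.{v₂} D] [MonoidalCategory D] {F : C ⥤ D} [F.Monoidal]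
  [Preadditive D] [MonoidalPreadditive D]
  {L : D ⥤ Centralizer F} (adj : L ⊣ Centralizer.forget F) (V W : Centralizer F)
  (k : Type w) [CommRing k] [Linear k D] [MonoidalLinear k D]

/-- Composition with the universal cochain, as a linear map. -/
def universalCochainMap (n : ℕ) :
    (iterate (Centralizer.forget F ⋙ L) V (n + 1) ⟶ W) →ₗ[k] Cochain V W n where
  toFun g := (universalCochain adj V n).post g.hom
  map_add' g g' := by
    ext X
    change (universalCochain adj V n).comp X ≫ F.obj (tensorTuple X) ◁ (g.hom + g'.hom) =
      (universalCochain adj V n).comp X ≫ F.obj (tensorTuple X) ◁ g.hom +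
        (universalCochain adj V n).comp X ≫ F.obj (tensorTuple X) ◁ g'.hom
    rw [MonoidalPreadditive.whiskerLeft_add, Preadditive.comp_add]
  map_smul' r g := by
    ext X
    change (universalCochain adj V n).comp X ≫ F.obj (tensorTuple X) ◁ (r • g.hom) =
      r • (universalCochain adj V n).comp X ≫ F.obj (tensorTuple X) ◁ g.hom
    rw [MonoidalLinear.whiskerLeft_smul, Linear.comp_smul]

lemma differential_universalCochainMap (n : ℕ)
    (g : iterate (Centralizer.forget F ⋙ L) V (n + 1) ⟶ W) :
    differential k V W n (universalCochainMap adj V W k n g) =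
      universalCochainMap adj V W k (n + 1) (barD adj V (n + 1) ≫ g) := by
  rw [barD, Preadditive.sum_comp, map_sum, differential, LinearMap.sum_apply]
  refine Finset.sum_congr rfl fun i _ => ?_
  rw [Preadditive.zsmul_comp, map_zsmul, LinearMap.smul_apply]
  refine congrArg ((-1 : ℤ) ^ (i : ℕ) • ·) ?_
  refine (coface_post i (universalCochain adj V n) g).trans ?_
  rw [coface_universalCochain, Cochain.post_post]
  rfl

lemma dyComplex_d (n : ℕ) (f : Cochain V W n) :
    (dyComplex k V W).d n (n + 1) f = differential k V W n f := by
  have h : (dyComplex k V W).d n (n + 1) = ModuleCat.ofHom (differential k V W n) :=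
    CochainComplex.of_d (fun n => ModuleCat.of k (Cochain V W n))
      (fun n => ModuleCat.ofHom (differential k V W n)) n
  rw [h]
  rfl

lemma barComplex_d {A : Type u₁} [Category.{v₁} A] [Preadditive A] {B : Type u₂} [Category.{v₂} B]
    [Preadditive B] {L : B ⥤ A} {U : A ⥤ B} (adj : L ⊣ U) [U.Additive] (V : A) (n : ℕ) :
    (barComplex adj V).d (n + 1) n = barD adj V (n + 1) :=
  ChainComplex.of_d (fun n => iterate (U ⋙ L) V (n + 1)) (fun n => barD adj V (n + 1)) n

lemma homComplex_d {A : Type u₁} [Category.{v₁} A] [Preadditive A] [Linear k A]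
    (P : ChainComplex A ℕ) (W : A) (n : ℕ) (g : P.X n ⟶ W) :
    (homComplex k P W).d n (n + 1) g = P.d (n + 1) n ≫ g := by
  have h : (homComplex k P W).d n (n + 1) =
      ModuleCat.ofHom (Linear.leftComp k W (P.d (n + 1) n)) :=
    CochainComplex.of_d (fun n => ModuleCat.of k (P.X n ⟶ W))
      (fun n => ModuleCat.ofHom (Linear.leftComp k W (P.d (n + 1) n))) n
  rw [h]
  rfl

/-- The isomorphism between the Davydov--Yetter complex and the complex of morphisms out of the bar
complex; its inverse is composition with the universal cochains. -/
lemma exists_dyComplex_equiv [RigidCategory C]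
    (hF : ∀ V : D, ∃ (T : D) (τ : ∀ X : C, V ⊗ F.obj X ⟶ F.obj X ⊗ T), IsUniversal F τ) :
    ∃ Γ : ∀ n : ℕ, (dyComplex k V W).X n ≃ₗ[k] (homComplex k (barComplex adj V) W).X n,
        ∀ (n : ℕ) (f : (dyComplex k V W).X n),
          Γ (n + 1) ((dyComplex k V W).d n (n + 1) f) =
            (homComplex k (barComplex adj V) W).d n (n + 1) (Γ n f) := by
  let Φ (n : ℕ) := LinearEquiv.ofBijective (universalCochainMap adj V W k n)
    (universalCochain_post_bijective adj hF W n V)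
  have hΦ (n : ℕ) (g : iterate (Centralizer.forget F ⋙ L) V (n + 1) ⟶ W) :
      Φ (n + 1) (barD adj V (n + 1) ≫ g) = differential k V W n (Φ n g) :=
    (differential_universalCochainMap adj V W k n g).symm
  refine ⟨fun n => (Φ n).symm, fun n f => ?_⟩
  obtain ⟨g, rfl⟩ := (Φ n).surjective f
  have h1 : (homComplex k (barComplex adj V) W).d n (n + 1) g = barD adj V (n + 1) ≫ g :=
    (homComplex_d k (barComplex adj V) W n g).trans (congrArg (· ≫ g) (barComplex_d adj V n))
  have h2 := (dyComplex_d V W k n (Φ n g)).trans (hΦ n g).symm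
  refine ((congrArg (Φ (n + 1)).symm h2).trans ((Φ (n + 1)).symm_apply_apply _)).trans ?_
  refine h1.symm.trans ?_
  exact congrArg _ ((Φ n).symm_apply_apply g).symm

end Comparison

/-! ### Relatively projective resolutions -/

section RelativeHomologicalAlgebra

variable {A : Type u₁} [Category.{v₁} A] {B : Type u₂} [Category.{v₂} B]

lemma isRelativelyProjective_of_adjunction {L : B ⥤ A} {U : A ⥤ B} (adj : L ⊣ U)
    [U.PreservesEpimorphisms] (X : B) : IsRelativelyProjective U (L.obj X) := by
  intro M N p hp ⟨s, hs⟩ g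
  -- An allowable epimorphism splits after applying `U`.
  have hs' : s ≫ U.map p = 𝟙 _ := by
    rw [← cancel_epi (U.map p), hs, Category.comp_id]
  refine ⟨(adj.homEquiv _ _).symm (adj.homEquiv _ _ g ≫ s), ?_⟩
  rw [← adj.homEquiv_naturality_right_symm, Category.assoc, hs', Category.comp_id,
    Equiv.symm_apply_apply]

/-- Morphisms from a relatively projective object lift through allowable morphisms in exact
sequences: the corestriction of an allowable morphism to its image is an allowable epimorphism. -/
lemma IsRelativelyProjective.exists_lift [Abelian A] {U : A ⥤ B} [U.PreservesMonomorphisms] {X : A}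
    (hX : IsRelativelyProjective U X) {S : ShortComplex A} (hS : S.Exact) (hf : IsAllowable U S.f)
    (g : X ⟶ S.X₂) (hg : g ≫ S.g = 0) : ∃ h : X ⟶ S.X₁, h ≫ S.f = g := by
  have hp := S.exact_iff_epi_kernel_lift.1 hS
  obtain ⟨s, hs⟩ := hf
  have hall : IsAllowable U (kernel.lift S.g S.f S.zero) := by
    refine ⟨U.map (kernel.ι S.g) ≫ s, ?_⟩
    rw [← cancel_mono (U.map (kernel.ι S.g))]
    simp only [Category.assoc]
    rw [← U.map_comp, kernel.lift_ι, ← U.map_comp_assoc, kernel.lift_ι, hs]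
  obtain ⟨h, hh⟩ := hX _ hp hall (kernel.lift S.g g hg)
  refine ⟨h, ?_⟩
  rw [← kernel.lift_ι S.g S.f S.zero, ← Category.assoc, hh, kernel.lift_ι]

namespace RelProjResolution

variable [Abelian A] {U : A ⥤ B} [U.PreservesMonomorphisms] {V : A} (P Q : RelProjResolution U V)

lemma exists_lift_zero {X : A} (hX : IsRelativelyProjective U X) (g : X ⟶ Q.complex.X 0)
    (hg : g ≫ Q.π = 0) : ∃ h : X ⟶ Q.complex.X 1, h ≫ Q.complex.d 1 0 = g :=
  hX.exists_lift Q.exact_zero (Q.allowable_d 0) g hg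

lemma exists_lift_succ {X : A} (hX : IsRelativelyProjective U X) (n : ℕ)
    (g : X ⟶ Q.complex.X (n + 1)) (hg : g ≫ Q.complex.d (n + 1) n = 0) :
    ∃ h : X ⟶ Q.complex.X (n + 2), h ≫ Q.complex.d (n + 2) (n + 1) = g :=
  hX.exists_lift ((Q.complex.exactAt_iff' (n + 2) (n + 1) n (by simp) (by simp)).1 (Q.exact_succ n))
    (Q.allowable_d (n + 1)) g hg

/-- The comparison map between two relatively projective resolutions. -/
lemma exists_comparison : ∃ φ : P.complex ⟶ Q.complex, φ.f 0 ≫ Q.π = P.π := by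
  obtain ⟨f₀, h₀⟩ := P.projective 0 Q.π Q.epi_π Q.allowable_π P.π
  obtain ⟨f₁, h₁⟩ := Q.exists_lift_zero (P.projective 1) (P.complex.d 1 0 ≫ f₀)
    (by rw [Category.assoc, h₀, P.d_comp_π])
  have key (n : ℕ) (p : Σ' (f : P.complex.X n ⟶ Q.complex.X n)
      (f' : P.complex.X (n + 1) ⟶ Q.complex.X (n + 1)),
        f' ≫ Q.complex.d (n + 1) n = P.complex.d (n + 1) n ≫ f) :
      ∃ f'' : P.complex.X (n + 2) ⟶ Q.complex.X (n + 2),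
        f'' ≫ Q.complex.d (n + 2) (n + 1) = P.complex.d (n + 2) (n + 1) ≫ p.2.1 :=
    Q.exists_lift_succ (P.projective (n + 2)) n _ (by
      rw [Category.assoc, p.2.2, HomologicalComplex.d_comp_d_assoc, zero_comp])
  exact ⟨ChainComplex.mkHom _ _ f₀ f₁ h₁ fun n p => ⟨(key n p).choose, (key n p).choose_spec⟩, h₀⟩

/-- Uniqueness of comparison maps up to homotopy. -/
lemma nonempty_homotopy_zero (φ : P.complex ⟶ Q.complex) (hφ : φ.f 0 ≫ Q.π = 0) :
    Nonempty (Homotopy φ 0) := by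
  obtain ⟨h₀, e₀⟩ := Q.exists_lift_zero (P.projective 0) (φ.f 0) hφ
  obtain ⟨h₁, e₁⟩ := Q.exists_lift_succ (P.projective 1) 0 (φ.f 1 - P.complex.d 1 0 ≫ h₀) (by
    rw [Preadditive.sub_comp, Category.assoc, e₀, φ.comm, sub_self])
  have key (n : ℕ) (p : Σ' (f : P.complex.X n ⟶ Q.complex.X (n + 1))
      (f' : P.complex.X (n + 1) ⟶ Q.complex.X (n + 2)),
        φ.f (n + 1) = P.complex.d (n + 1) n ≫ f + f' ≫ Q.complex.d (n + 2) (n + 1)) :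
      ∃ f'' : P.complex.X (n + 2) ⟶ Q.complex.X (n + 3),
        f'' ≫ Q.complex.d (n + 3) (n + 2) = φ.f (n + 2) - P.complex.d (n + 2) (n + 1) ≫ p.2.1 :=
    Q.exists_lift_succ (P.projective (n + 2)) (n + 1) _ (by
      have h := congrArg (P.complex.d (n + 2) (n + 1) ≫ ·) p.2.2
      simp only [Preadditive.comp_add, HomologicalComplex.d_comp_d_assoc, zero_comp,
        zero_add] at h
      rw [Preadditive.sub_comp, Category.assoc, φ.comm, h, sub_self])
  exact ⟨Homotopy.mkInductive φ h₀ e₀.symm h₁ (by rw [e₁, add_sub_cancel]) fun n p =>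
    ⟨(key n p).choose, by rw [(key n p).choose_spec, add_sub_cancel]⟩⟩

/-- An endomorphism of a relatively projective resolution over the identity acts trivially on
cocycles, up to coboundaries. -/
lemma exists_eq_d_comp (φ : P.complex ⟶ P.complex) (hφ : φ.f 0 ≫ P.π = P.π) {W : A} :
    (∀ x : P.complex.X 0 ⟶ W, P.complex.d 1 0 ≫ x = 0 → φ.f 0 ≫ x = x) ∧
    ∀ (n : ℕ) (x : P.complex.X (n + 1) ⟶ W), P.complex.d (n + 2) (n + 1) ≫ x = 0 →
      ∃ y : P.complex.X n ⟶ W, P.complex.d (n + 1) n ≫ y = φ.f (n + 1) ≫ x - x := by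
  obtain ⟨H⟩ := nonempty_homotopy_zero P P (φ - 𝟙 _) (by
    rw [HomologicalComplex.sub_f_apply, Preadditive.sub_comp, hφ]
    simp)
  constructor
  · intro x hx
    have h := H.comm 0
    rw [Homotopy.dNext_zero_chainComplex, Homotopy.prevD_chainComplex] at h
    have h' := congrArg (· ≫ x) h
    simpa [hx, sub_eq_zero] using h'
  · intro n x hx
    have h := H.comm (n + 1)
    rw [Homotopy.dNext_succ_chainComplex, Homotopy.prevD_chainComplex] at h
    have h' := congrArg (· ≫ x) h
    refine ⟨H.hom n (n + 1) ≫ x, ?_⟩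
    simpa [hx] using h'.symm

end RelProjResolution

/-! ### The bar resolution -/

/-- The unit `U Gⁿ(V) ⟶ U Gⁿ⁺¹(V)` of an adjunction `L ⊣ U` with comonad `G = L U`, a section of the
counit after applying `U`. For the centralizer it agrees with `barUnit`. -/
def extraDegeneracy {L : B ⥤ A} {U : A ⥤ B} (adj : L ⊣ U) (V : A) (n : ℕ) :
    U.obj (iterate (U ⋙ L) V n) ⟶ U.obj (iterate (U ⋙ L) V (n + 1)) :=
  adj.unit.app (U.obj (iterate (U ⋙ L) V n))

lemma extraDegeneracy_comp_map_barEps {L : B ⥤ A} {U : A ⥤ B} (adj : L ⊣ U) (V : A) (n : ℕ) :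
    extraDegeneracy adj V n ≫ U.map (barEps adj V n) = 𝟙 _ :=
  adj.right_triangle_components _

lemma extraDegeneracy_naturality {L : B ⥤ A} {U : A ⥤ B} (adj : L ⊣ U) (V : A) {m n : ℕ}
    (f : iterate (U ⋙ L) V m ⟶ iterate (U ⋙ L) V n) :
    extraDegeneracy adj V m ≫ U.map (iterateMap (U ⋙ L) V f) =
      U.map f ≫ extraDegeneracy adj V n :=
  (adj.unit.naturality (U.map f)).symm

/-- The unit of an adjunction is a contracting homotopy of the augmented bar complex, up to sign. -/
lemma extraDegeneracy_comp_map_barD_succ [Preadditive A] [Preadditive B] {L : B ⥤ A} {U : A ⥤ B}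
    [U.Additive] (adj : L ⊣ U) (V : A) (n : ℕ) :
    extraDegeneracy adj V (n + 1) ≫ U.map (barD adj V (n + 1)) =
      U.map (barD adj V n) ≫ extraDegeneracy adj V n + (-1 : ℤ) ^ (n + 1) • 𝟙 _ := by
  have : L.Additive := adj.left_adjoint_additive
  rw [barD_succ, U.map_add, U.map_zsmul, Preadditive.comp_add, Preadditive.comp_zsmul,
    extraDegeneracy_naturality, extraDegeneracy_comp_map_barEps]

lemma extraDegeneracy_comp_map_barD_zero [Preadditive A] {L : B ⥤ A} {U : A ⥤ B} (adj : L ⊣ U)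
    (V : A) : extraDegeneracy adj V 0 ≫ U.map (barD adj V 0) = 𝟙 _ := by
  rw [barD_zero, extraDegeneracy_comp_map_barEps]

lemma isAllowable_barD [Preadditive A] [Preadditive B] {L : B ⥤ A} {U : A ⥤ B} [U.Additive]
    (adj : L ⊣ U) (V : A) : ∀ n : ℕ, IsAllowable U (barD adj V n)
  | 0 => ⟨extraDegeneracy adj V 0, by
      rw [extraDegeneracy_comp_map_barD_zero, Category.comp_id]⟩
  | n + 1 => by
    have : L.Additive := adj.left_adjoint_additive
    refine ⟨(-1 : ℤ) ^ (n + 1) • extraDegeneracy adj V (n + 1), ?_⟩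
    rw [Preadditive.zsmul_comp, Preadditive.comp_zsmul, extraDegeneracy_comp_map_barD_succ,
      Preadditive.comp_add, Preadditive.comp_zsmul, ← U.map_comp_assoc, barD_comp_barD,
      U.map_zero, zero_comp, zero_add, Category.comp_id, smul_smul, ← mul_pow]
    simp

lemma barD_exact [Abelian A] [Abelian B] {L : B ⥤ A} {U : A ⥤ B} [U.Additive]
    [PreservesFiniteLimits U] [PreservesFiniteColimits U] [U.Faithful] (adj : L ⊣ U) (V : A)
    (n : ℕ) {a : iterate (U ⋙ L) V (n + 2) ⟶ iterate (U ⋙ L) V (n + 1)}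
    {b : iterate (U ⋙ L) V (n + 1) ⟶ iterate (U ⋙ L) V n}
    (ha : a = barD adj V (n + 1)) (hb : b = barD adj V n) (w : a ≫ b = 0) :
    (ShortComplex.mk a b w).Exact := by
  subst ha hb
  rw [← ShortComplex.exact_map_iff_of_faithful _ U,
    ShortComplex.exact_iff_exact_up_to_refinements]
  intro X x hx
  have key (x : X ⟶ U.obj (iterate (U ⋙ L) V (n + 1))) (hx : x ≫ U.map (barD adj V n) = 0) :
      x = ((-1 : ℤ) ^ (n + 1) • x ≫ extraDegeneracy adj V (n + 1)) ≫
        U.map (barD adj V (n + 1)) := by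
    rw [Preadditive.zsmul_comp, Category.assoc, extraDegeneracy_comp_map_barD_succ,
      Preadditive.comp_add, reassoc_of% hx, zero_comp, zero_add, Preadditive.comp_zsmul,
      smul_smul, ← mul_pow]
    simp
  exact ⟨X, 𝟙 X, inferInstance, _, (Category.id_comp x).trans (key x hx)⟩

/-- The bar complex is a relatively projective resolution. -/
def barResolution [Abelian A] [Abelian B] {L : B ⥤ A} {U : A ⥤ B} [U.Additive]
    [PreservesFiniteLimits U] [PreservesFiniteColimits U] [U.Faithful] (adj : L ⊣ U) (V : A) :
    RelProjResolution U V where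
  complex := barComplex adj V
  π := barD adj V 0
  d_comp_π := by
    have : L.Additive := adj.left_adjoint_additive
    rw [barComplex_d]
    exact barD_comp_barD adj V 0
  epi_π := by
    refine U.epi_of_epi_map (SplitEpi.epi ?_)
    exact ⟨extraDegeneracy adj V 0, extraDegeneracy_comp_map_barD_zero adj V⟩
  exact_zero := barD_exact adj V 0 (barComplex_d adj V 0) rfl _
  exact_succ n := by
    rw [(barComplex adj V).exactAt_iff' (n + 2) (n + 1) n (by simp) (by simp)]
    exact barD_exact adj V (n + 1) (barComplex_d adj V (n + 1)) (barComplex_d adj V n) _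
  allowable_π := isAllowable_barD adj V 0
  allowable_d n := by
    rw [barComplex_d]
    exact isAllowable_barD adj V (n + 1)
  projective n := isRelativelyProjective_of_adjunction adj _

end RelativeHomologicalAlgebra

/-! ### Comparison of cohomology -/

section Cohomology

/-- A criterion for an isomorphism of homologies, in terms of elements. The two complexes may live
in different universes. -/
lemma nonempty_homology_linearEquiv {k : Type w} [CommRing k] {S : ShortComplex (ModuleCat.{u₁} k)}
    {T : ShortComplex (ModuleCat.{u₂} k)} (a : S.X₂ →ₗ[k] T.X₂) (b : T.X₂ →ₗ[k] S.X₂)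
    (ha : ∀ x, S.g x = 0 → T.g (a x) = 0) (hb : ∀ x, T.g x = 0 → S.g (b x) = 0)
    (ha' : ∀ x, ∃ y, T.f y = a (S.f x)) (hb' : ∀ x, ∃ y, S.f y = b (T.f x))
    (hab : ∀ x, S.g x = 0 → ∃ y, S.f y = b (a x) - x)
    (hba : ∀ x, T.g x = 0 → ∃ y, T.f y = a (b x) - x) :
    Nonempty (S.homology ≃ₗ[k] T.homology) := by
  let a' : LinearMap.ker S.g.hom →ₗ[k] LinearMap.ker T.g.hom := a.restrict ha
  let b' : LinearMap.ker T.g.hom →ₗ[k] LinearMap.ker S.g.hom := b.restrict hb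
  have h1 : LinearMap.range S.moduleCatToCycles ≤
      (LinearMap.range T.moduleCatToCycles).comap a' := by
    rintro _ ⟨x, rfl⟩
    obtain ⟨y, hy⟩ := ha' x
    exact ⟨y, Subtype.ext hy⟩
  have h2 : LinearMap.range T.moduleCatToCycles ≤
      (LinearMap.range S.moduleCatToCycles).comap b' := by
    rintro _ ⟨x, rfl⟩
    obtain ⟨y, hy⟩ := hb' x
    exact ⟨y, Subtype.ext hy⟩
  refine ⟨S.moduleCatHomologyIso.toLinearEquiv ≪≫ₗ
    (LinearEquiv.ofLinearMap (Submodule.mapQ _ _ a' h1) (Submodule.mapQ _ _ b' h2) ?_ ?_) ≪≫ₗ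
      T.moduleCatHomologyIso.toLinearEquiv.symm⟩
  · refine Submodule.linearMap_qext _ (LinearMap.ext fun x => ?_)
    obtain ⟨y, hy⟩ := hba x.1 x.2
    exact (Submodule.Quotient.eq _).2 ⟨y, Subtype.ext hy⟩
  · refine Submodule.linearMap_qext _ (LinearMap.ext fun x => ?_)
    obtain ⟨y, hy⟩ := hab x.1 x.2
    exact (Submodule.Quotient.eq _).2 ⟨y, Subtype.ext hy⟩

lemma nonempty_homology_linearEquiv_of_equiv {k : Type w} [CommRing k]
    {K : CochainComplex (ModuleCat.{u₁} k) ℕ} {M : CochainComplex (ModuleCat.{u₂} k) ℕ}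
    (e : ∀ n, K.X n ≃ₗ[k] M.X n)
    (he : ∀ n x, e (n + 1) (K.d n (n + 1) x) = M.d n (n + 1) (e n x)) (n : ℕ) :
    Nonempty (K.homology n ≃ₗ[k] M.homology n) := by
  have he' (i j : ℕ) (x : K.X i) : e j (K.d i j x) = M.d i j (e i x) := by
    by_cases h : i + 1 = j
    · subst h
      exact he i x
    · rw [K.shape _ _ h, M.shape _ _ h]
      exact map_zero (e j)
  have he'' (i j : ℕ) (x : M.X i) : (e j).symm (M.d i j x) = K.d i j ((e i).symm x) := by
    rw [LinearEquiv.symm_apply_eq, he', LinearEquiv.apply_symm_apply]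
  refine nonempty_homology_linearEquiv (S := K.sc n) (T := M.sc n) (e n).toLinearMap
    (e n).symm.toLinearMap (fun x hx => ?_) (fun x hx => ?_) (fun x => ?_) (fun x => ?_)
    (fun x _ => ⟨0, ?_⟩) (fun x _ => ⟨0, ?_⟩)
  · exact (he' _ _ x).symm.trans ((congrArg _ hx).trans (map_zero _))
  · exact (he'' _ _ x).symm.trans ((congrArg _ hx).trans (map_zero _))
  · exact ⟨e _ x, (he' _ _ x).symm⟩
  · exact ⟨(e _).symm x, (he'' _ _ x).symm⟩
  · refine (map_zero _).trans (sub_eq_zero.2 ?_).symm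
    exact (e n).symm_apply_apply x
  · refine (map_zero _).trans (sub_eq_zero.2 ?_).symm
    exact (e n).apply_symm_apply x

variable {A : Type u₁} [Category.{v₁} A] {B : Type u₂} [Category.{v₂} B]

/-- Precomposition with a chain map commutes with the differentials. The degrees `i` and `j` are
arbitrary, so that this applies to the differentials in `HomologicalComplex.sc`. -/
lemma homComplex_d_comp {k : Type w} [CommRing k] [Preadditive A] [Linear k A]
    {P Q : ChainComplex A ℕ} (φ : P ⟶ Q) (W : A) (i j : ℕ) (x : Q.X i ⟶ W) :
    φ.f j ≫ (show Q.X j ⟶ W from (homComplex k Q W).d i j x) =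
      (homComplex k P W).d i j (φ.f i ≫ x) := by
  by_cases h : i + 1 = j
  · subst h
    rw [homComplex_d]
    refine Eq.trans ?_ (homComplex_d k P W i (φ.f i ≫ x)).symm
    exact φ.comm_assoc _ _ _
  · rw [(homComplex k Q W).shape _ _ h, (homComplex k P W).shape _ _ h]
    exact comp_zero

/-- Relative Ext does not depend on the relatively projective resolution. -/
lemma RelProjResolution.nonempty_ext_linearEquiv {k : Type w} [CommRing k] [Abelian A] [Linear k A]
    {U : A ⥤ B} [U.PreservesMonomorphisms] {V : A} (P Q : RelProjResolution U V) (W : A) (n : ℕ) :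
    Nonempty (P.ext k W n ≃ₗ[k] Q.ext k W n) := by
  obtain ⟨φ, hφ⟩ := exists_comparison P Q
  obtain ⟨ψ, hψ⟩ := exists_comparison Q P
  -- By uniqueness of comparison maps up to homotopy, both composites are the identity on cocycles
  -- up to coboundaries.
  have key {P Q : RelProjResolution U V} (φ : P.complex ⟶ Q.complex) (ψ : Q.complex ⟶ P.complex)
      (hφ : φ.f 0 ≫ Q.π = P.π) (hψ : ψ.f 0 ≫ P.π = Q.π) (x : P.complex.X n ⟶ W)
      (hx : ((homComplex k P.complex W).sc n).g x = 0) :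
      ∃ y, ((homComplex k P.complex W).sc n).f y = φ.f n ≫ ψ.f n ≫ x - x := by
    have h := P.exists_eq_d_comp (φ ≫ ψ) (W := W) (by
      rw [HomologicalComplex.comp_f, Category.assoc, hψ, hφ])
    have hx' : P.complex.d (n + 1) n ≫ x = 0 := by
      change (homComplex k P.complex W).d n ((ComplexShape.up ℕ).next n) x = 0 at hx
      rw [CochainComplex.next] at hx
      exact (homComplex_d k P.complex W n x).symm.trans hx
    cases n with
    | zero => exact ⟨0, (map_zero _).trans (by
        rw [← Category.assoc]
        exact (sub_eq_zero.2 (h.1 x hx')).symm)⟩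
    | succ n =>
      obtain ⟨y, hy⟩ := h.2 n x hx'
      change ∃ y, (homComplex k P.complex W).d ((ComplexShape.up ℕ).prev (n + 1)) (n + 1) y = _
      rw [CochainComplex.prev_nat_succ]
      exact ⟨y, (homComplex_d k P.complex W n y).trans (hy.trans (by
        rw [HomologicalComplex.comp_f, Category.assoc]))⟩
  refine nonempty_homology_linearEquiv (Linear.leftComp k W (ψ.f n)) (Linear.leftComp k W (φ.f n))
    ?_ ?_ ?_ ?_ ?_ ?_
  · intro x hx
    exact (homComplex_d_comp ψ W _ _ x).symm.trans ((congrArg (ψ.f _ ≫ ·) hx).trans comp_zero)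
  · intro x hx
    exact (homComplex_d_comp φ W _ _ x).symm.trans ((congrArg (φ.f _ ≫ ·) hx).trans comp_zero)
  · intro x
    exact ⟨ψ.f _ ≫ x, (homComplex_d_comp ψ W _ _ x).symm⟩
  · intro x
    exact ⟨φ.f _ ≫ x, (homComplex_d_comp φ W _ _ x).symm⟩
  · exact key φ ψ hφ hψ
  · exact key ψ φ hψ hφ

end Cohomology

end DavydovYetter

end

open DavydovYetter
theorem mainTheorem6 {k : Type w} [Field k]
    {C : Type u₁} [Category.{v₁} C] [Abelian C] [Linear k C]
    [MonoidalCategory C] [MonoidalPreadditive C] [MonoidalLinear k C] [RigidCategory C]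
    {D : Type u₂} [Category.{v₂} D] [Abelian D] [Linear k D]
    [MonoidalCategory D] [MonoidalPreadditive D] [MonoidalLinear k D]
    (hC : IsFiniteLinear k C)
    (hDl : ∀ Y : D, PreservesFiniteColimits (tensorLeft Y))
    (hDr : ∀ Y : D, PreservesFiniteColimits (tensorRight Y))
    (F : C ⥤ D) [F.Additive] [F.Linear k] [F.Monoidal] [PreservesFiniteColimits F] :
    IsResolvent (Centralizer.forget F) ∧
    ∀ (L : D ⥤ Centralizer F) (adj : L ⊣ Centralizer.forget F) (V W : Centralizer F),
      (∃ Γ : ∀ n : ℕ, (dyComplex k V W).X n ≃ₗ[k] (homComplex k (barComplex adj V) W).X n,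
        ∀ (n : ℕ) (f : (dyComplex k V W).X n),
          Γ (n + 1) ((dyComplex k V W).d n (n + 1) f) =
            (homComplex k (barComplex adj V) W).d n (n + 1) (Γ n f)) ∧
      (∃ P : RelProjResolution (Centralizer.forget F) V, P.complex = barComplex adj V) ∧
      ∀ (P : RelProjResolution (Centralizer.forget F) V) (n : ℕ),
        Nonempty (dyCohomology k V W n ≃ₗ[k] P.ext k W n) := by
  have hU (V : D) : ∃ (T : D) (τ : ∀ X : C, V ⊗ F.obj X ⟶ F.obj X ⊗ T), IsUniversal F τ := by
    obtain ⟨P, hP⟩ := IsFiniteLinear.exists_isFiniteGenerator k hC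
    exact exists_isUniversal hP hDl F V
  -- The additive structure of this instance is definitionally the given one.
  let abelianZ := Centralizer.abelian F hDl hDr
  have hL := Centralizer.preservesFiniteLimits_forget (F := F)
  have hR := Centralizer.preservesFiniteColimits_forget (F := F) hDl hDr
  refine ⟨⟨⟨Centralizer.abelian F hDl hDr, rfl⟩, inferInstance, hL, hR, inferInstance,
    isRightAdjoint_forget F hU⟩, fun L adj V W => ?_⟩
  have hΓ := exists_dyComplex_equiv adj V W k hU
  refine ⟨hΓ, ⟨barResolution (A := Centralizer F) adj V, rfl⟩, fun P n => ?_⟩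
  obtain ⟨Γ, h⟩ := hΓ
  obtain ⟨e₁⟩ := nonempty_homology_linearEquiv_of_equiv Γ h n
  obtain ⟨e₂⟩ := RelProjResolution.nonempty_ext_linearEquiv (k := k)
    (barResolution (A := Centralizer F) adj V) P W n
  exact ⟨e₁ ≪≫ₗ e₂⟩
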